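/- **Geometric Fröhlich Theorem for distributions.** Let $M$ be a finite-dimensional (Hausdorff) smooth manifold without boundary and let $K$ be a positive definite distribution on $M\times M$, i.e. an antilinear functional on $C^\infty_c(M\times M,\mathbb{C})$, continuous for the LF topology, such that $\langle\phi,\psi\rangle_K := K(\overline{\phi}\otimes\psi)$ is a positive semidefinite hermitian form on $C^\infty_c(M,\mathbb{C})$. Let $\mathcal{H}_K$ be the corresponding Hilbert space completion, $K_\phi\in\mathcal{H}_K$ the image of $\phi\in C^\infty_c(M)$, and $\mathcal{H}_K^0=\{K_\phi : \phi\in C^\infty_c(M)\}$. Identify $v\in\mathcal{H}_K$ with the distribution $\phi\mapsto\langle v,K_\phi\rangle$ on $M$, and for a smooth vector field $X$ on $M$ let $(\mathcal{L}_XD)(\phi):=-D(\mathcal{L}_X\phi)$ for distributions $D$ on $M$. Suppose that $X$ is locally integrable, i.e. the velocity field of a smooth local flow, and $K$-symmetric, i.e. $K(\mathcal{L}_X\phi\otimes\psi)=K(\phi\otimes\mathcal{L}_X\psi)$ for all $\phi,\psi\in C^\infty_c(M)$. Then $\mathcal{L}_X$ maps $\mathcal{H}_K^0$ into $\mathcal{H}_K$,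 and the operator $\mathcal{L}_X\colon\mathcal{H}_K^0\to\mathcal{H}_K$ is essentially selfadjoint. Its closure $\mathcal{L}_X^K$ coincides with $\mathcal{L}_X|_{\mathcal{D}_X}$, where $\mathcal{D}_X:=\{D\in\mathcal{H}_K : \mathcal{L}_XD\in\mathcal{H}_K\}$. Moreover, let $\Phi^X$ be the maximal local flow of $X$ (given by the maximal integral curves), let $\phi\in C^\infty_c(M)$ and $\varepsilon\ge 0$. If $\Phi^X$ is defined on $[0,\varepsilon]\times\operatorname{supp}(\phi)$, then for all $0\le t\le\varepsilon$ the function $\phi\circ\Phi^X_{-t}$, extended by zero outside the domain of $\Phi^X_{-t}$, belongs to $C^\infty_c(M)$, the vector $K_\phi$ lies in the domain of $e^{t\mathcal{L}_X^K}$ (defined by the spectral calculus of the selfadjoint operator $\mathcal{L}_X^K$), and $$e^{t\mathcal{L}_X^K}K_\phi=K_{\phi\circ\Phi^X_{-t}}.$$ -/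

import Mathlib

open scoped Manifold ContDiff Topology ComplexConjugate

noncomputable section

namespace FrohlichDist

section TestFunctions

variable {E : Type*} [NormedAddCommGroup E] [NormedSpace ℝ E]
  {H : Type*} [TopologicalSpace H] (I : ModelWithCorners ℝ E H)
  (M : Type*) [TopologicalSpace M] [ChartedSpace H M]

/-- The complex vector space `C_c^∞(M)` of smooth compactly supported functions `M → ℂ`. -/
def smoothCc : Submodule ℂ (M → ℂ) where
  carrier := {f | ContMDiff I 𝓘(ℝ, ℂ) ∞ f ∧ HasCompactSupport f}
  add_mem' := fun hf hg => ⟨hf.1.add hg.1, hf.2.add hg.2⟩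
  zero_mem' := ⟨contMDiff_const, HasCompactSupport.zero⟩
  smul_mem' := fun c f hf => by
    refine ⟨?_, hf.2.mono (Function.support_const_smul_subset c f)⟩
    exact (contDiff_const.mul contDiff_id : ContDiff ℝ ∞ (fun z : ℂ => c * z)).comp_contMDiff hf.1

variable {I M}

/-- `u` is a distribution on the manifold `M` (without boundary): an antilinear functional on
`C_c^∞(M)` whose restriction to the Fréchet space of test functions supported in any given
compact set `C` is continuous, i.e. is bounded by a multiple of the maximum of finitely many of
the seminorms `φ ↦ sup_{y ∈ L} ‖D^j (φ ∘ κ⁻¹)(y)‖`, where `κ` is a chart and `L` is a compact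
subset of its image. This is continuity for the LF topology of `C_c^∞(M)`. -/
def IsDistribution (u : smoothCc I M →ₗ⋆[ℂ] ℂ) : Prop :=
  ∀ C : Set M, IsCompact C →
    ∃ (n k : ℕ) (x : Fin n → M) (L : Fin n → Set E) (c : ℝ),
      (∀ i, IsCompact (L i) ∧ L i ⊆ (extChartAt I (x i)).target) ∧
      ∀ φ : smoothCc I M, tsupport (φ : M → ℂ) ⊆ C → ∀ b : ℝ, 0 ≤ b →
        (∀ i, ∀ j ≤ k, ∀ y ∈ L i,
          ‖iteratedFDeriv ℝ j ((φ : M → ℂ) ∘ (extChartAt I (x i)).symm) y‖ ≤ b) →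
        ‖u φ‖ ≤ c * b

/-- The complex conjugate of a test function. -/
def conjFun (φ : smoothCc I M) : smoothCc I M :=
  ⟨fun x => conj ((φ : M → ℂ) x),
    (Complex.conjCLE.contDiff : ContDiff ℝ ∞ Complex.conjCLE).comp_contMDiff φ.2.1,
    φ.2.2.comp_left (g := fun z : ℂ => conj z) (map_zero _)⟩

/-- The test function `φ ⊗ ψ : (x, y) ↦ φ(x) ψ(y)` on `M × M`. -/
def tensor (φ ψ : smoothCc I M) : smoothCc (I.prod I) (M × M) :=
  ⟨fun p => (φ : M → ℂ) p.1 * (ψ : M → ℂ) p.2, by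
    constructor
    · have h1 : ContMDiff (I.prod I) 𝓘(ℝ, ℂ) ∞ (fun p : M × M => (φ : M → ℂ) p.1) :=
        φ.2.1.comp contMDiff_fst
      have h2 : ContMDiff (I.prod I) 𝓘(ℝ, ℂ) ∞ (fun p : M × M => (ψ : M → ℂ) p.2) :=
        ψ.2.1.comp contMDiff_snd
      exact (contDiff_mul : ContDiff ℝ ∞ (fun p : ℂ × ℂ => p.1 * p.2)).comp_contMDiff
        (h1.prodMk_space h2)
    · refine IsCompact.of_isClosed_subset (φ.2.2.prod ψ.2.2) (isClosed_tsupport _) ?_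
      refine closure_minimal ?_ ((isClosed_tsupport _).prod (isClosed_tsupport _))
      intro p hp
      exact ⟨subset_tsupport _ (left_ne_zero_of_mul hp),
        subset_tsupport _ (right_ne_zero_of_mul hp)⟩⟩

end TestFunctions

section VectorFields

variable {E : Type*} [NormedAddCommGroup E] [NormedSpace ℝ E]
  {H : Type*} [TopologicalSpace H] (I : ModelWithCorners ℝ E H)
  (M : Type*) [TopologicalSpace M] [ChartedSpace H M] [IsManifold I ∞ M]

/-- The space `𝒱(M)` of smooth vector fields on `M`. -/
abbrev SmoothField : Type _ := ContMDiffSection I E ∞ (TangentSpace I : M → Type _)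

variable {I M}

/-- The derivative of the function `f` in the direction of the vector field `X`. -/
def derivAlong (X : SmoothField I M) (f : M → ℂ) (x : M) : ℂ :=
  mfderiv I 𝓘(ℝ, ℂ) f x (X x)

theorem contMDiff_derivAlong (X : SmoothField I M) {f : M → ℂ}
    (hf : ContMDiff I 𝓘(ℝ, ℂ) ∞ f) : ContMDiff I 𝓘(ℝ, ℂ) ∞ (derivAlong X f) := by
  have h1 : ContMDiff I.tangent 𝓘(ℝ, ℂ).tangent ∞ (tangentMap I 𝓘(ℝ, ℂ) f) :=
    hf.contMDiff_tangentMap (by simp)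
  have h2 : ContMDiff I 𝓘(ℝ, ℂ).tangent ∞
      (fun x => tangentMap I 𝓘(ℝ, ℂ) f (⟨x, X x⟩ : TangentBundle I M)) :=
    h1.comp X.contMDiff
  exact (contMDiff_snd_tangentBundle_modelSpace ℂ 𝓘(ℝ, ℂ)).comp h2

theorem derivAlong_eq_zero (X : SmoothField I M) {f : M → ℂ} {x : M} (hx : x ∉ tsupport f) :
    derivAlong X f x = 0 := by
  have h : f =ᶠ[𝓝 x] fun _ => (0 : ℂ) := notMem_tsupport_iff_eventuallyEq.mp hx
  have h0 : mfderiv I 𝓘(ℝ, ℂ) f x = mfderiv I 𝓘(ℝ, ℂ) (fun _ : M => (0 : ℂ)) x :=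
    h.mfderiv_eq
  rw [derivAlong, h0, mfderiv_const]
  rfl

/-- The Lie derivative `ℒ_X` as an operator on `C_c^∞(M)`. -/
def lieDeriv (X : SmoothField I M) : smoothCc I M →ₗ[ℂ] smoothCc I M where
  toFun φ := ⟨derivAlong X φ, contMDiff_derivAlong X φ.2.1, by
    refine IsCompact.of_isClosed_subset φ.2.2 (isClosed_tsupport _) ?_
    refine closure_minimal (fun x hx => ?_) (isClosed_tsupport _)
    by_contra h
    exact hx (derivAlong_eq_zero X h)⟩
  map_add' φ ψ := by
    ext x
    have hφ : MDifferentiableAt I 𝓘(ℝ, ℂ) (φ : M → ℂ) x := φ.2.1.mdifferentiable (by simp) x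
    have hψ : MDifferentiableAt I 𝓘(ℝ, ℂ) (ψ : M → ℂ) x := ψ.2.1.mdifferentiable (by simp) x
    have := (hφ.hasMFDerivAt.add hψ.hasMFDerivAt).mfderiv
    change mfderiv I 𝓘(ℝ, ℂ) ((φ : M → ℂ) + (ψ : M → ℂ)) x (X x) = _
    rw [this]
    rfl
  map_smul' c φ := by
    ext x
    have hφ : MDifferentiableAt I 𝓘(ℝ, ℂ) (φ : M → ℂ) x := φ.2.1.mdifferentiable (by simp) x
    let m : ℂ →L[ℝ] ℂ := ContinuousLinearMap.mul ℝ ℂ c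
    have := (m.hasMFDerivAt (x := (φ : M → ℂ) x)).comp x hφ.hasMFDerivAt
    have h := this.mfderiv
    change mfderiv I 𝓘(ℝ, ℂ) (m ∘ (φ : M → ℂ)) x (X x) = _
    rw [h]
    rfl

/-- The Lie derivative of (the antilinear functional underlying) a distribution:
`(ℒ_X D)(φ) = -D(ℒ_X φ)`. -/
def lieDist (X : SmoothField I M) :
    (smoothCc I M →ₗ⋆[ℂ] ℂ) →ₗ[ℂ] (smoothCc I M →ₗ⋆[ℂ] ℂ) where
  toFun D := -(D.comp (lieDeriv X))
  map_add' D D' := by ext φ; simp [add_comm]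
  map_smul' c D := by ext φ; simp

/-- `Φ`, defined on `𝒟 ⊆ ℝ × M`, is a smooth local flow on `M`: `𝒟` is open and contains
`{0} × M`, all sets `{t | (t, x) ∈ 𝒟}` are intervals, `Φ` is smooth on `𝒟`, `Φ_0 = id`, and
`Φ_t (Φ_s x) = Φ_{s+t} x` whenever both sides are defined. -/
structure IsLocalFlow (I : ModelWithCorners ℝ E H) (𝒟 : Set (ℝ × M)) (Φ : ℝ → M → M) : Prop where
  isOpen : IsOpen 𝒟
  zero_mem : ∀ x, ((0 : ℝ), x) ∈ 𝒟
  ordConnected : ∀ x, {t : ℝ | (t, x) ∈ 𝒟}.OrdConnected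
  smooth : ContMDiffOn (𝓘(ℝ, ℝ).prod I) I ∞ (fun p : ℝ × M => Φ p.1 p.2) 𝒟
  map_zero : ∀ x, Φ 0 x = x
  map_add : ∀ s t x, (s, x) ∈ 𝒟 → (t, Φ s x) ∈ 𝒟 → (s + t, x) ∈ 𝒟 → Φ t (Φ s x) = Φ (s + t) x

/-- `X` is locally integrable: it is the velocity field of some smooth local flow. -/
def IsLocallyIntegrable (X : SmoothField I M) : Prop :=
  ∃ (𝒟 : Set (ℝ × M)) (Φ : ℝ → M → M), IsLocalFlow I 𝒟 Φ ∧
    ∀ x, HasMFDerivAt 𝓘(ℝ, ℝ) I (fun t => Φ t x) 0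
      ((1 : ℝ →L[ℝ] ℝ).smulRight (X (Φ 0 x)))

/-- `γ` is an integral curve of `X` on some open interval containing `0` and `t`, with
`γ 0 = x`. -/
def IsFlowLine (X : SmoothField I M) (t : ℝ) (x : M) (γ : ℝ → M) : Prop :=
  γ 0 = x ∧ ∃ a b : ℝ, 0 ∈ Set.Ioo a b ∧ t ∈ Set.Ioo a b ∧
    IsMIntegralCurveOn (I := I) γ (fun y => X y) (Set.Ioo a b)

/-- The domain `𝒟_X ⊆ ℝ × M` of the maximal local flow `Φ^X` of `X`: the pairs `(t, x)` such that
the maximal integral curve of `X` through `x` is defined at time `t`. -/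
def flowDomain (X : SmoothField I M) : Set (ℝ × M) :=
  {p | ∃ γ, IsFlowLine X p.1 p.2 γ}

open Classical in
/-- The maximal local flow of `X`: `Φ^X_t(x)` is the value at time `t` of the integral curve of `X`
through `x`, for `(t, x)` in `flowDomain X` (and the irrelevant value `x` elsewhere). -/
def maxFlow (X : SmoothField I M) (t : ℝ) (x : M) : M :=
  if h : ∃ γ, IsFlowLine X t x γ then h.choose t else x

open Classical in
/-- The function `f ∘ Φ^X_t`, defined on the set of all `x` with `(t, x) ∈ flowDomain X`, and
extended by zero to `M`. -/
def pullbackFlow (X : SmoothField I M) (t : ℝ) (f : M → ℂ) (x : M) : ℂ :=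
  if (t, x) ∈ flowDomain X then f (maxFlow X t x) else 0

end VectorFields

section HilbertSpace

variable {E : Type*} [NormedAddCommGroup E] [NormedSpace ℝ E]
  {H : Type*} [TopologicalSpace H] (I : ModelWithCorners ℝ E H)
  (M : Type*) [TopologicalSpace M] [ChartedSpace H M]

/-- Positive definite distributions on `M × M`: those for which
`⟨φ, ψ⟩_K = K(conj φ ⊗ ψ)` is a positive semidefinite hermitian form on `C_c^∞(M)` (linear in `φ`
and antilinear in `ψ`). -/
structure PosDefDistribution where
  /-- the antilinear functional on `C_c^∞(M × M)` -/
  toFun : smoothCc (I.prod I) (M × M) →ₗ⋆[ℂ] ℂ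
  isDistribution : IsDistribution toFun
  hermitian : ∀ φ ψ : smoothCc I M,
    conj (toFun (tensor (conjFun φ) ψ)) = toFun (tensor (conjFun ψ) φ)
  nonneg : ∀ φ : smoothCc I M, 0 ≤ (toFun (tensor (conjFun φ) φ)).re

variable {I M}

/-- The space `C_c^∞(M)`, to be equipped with the semi-inner product given by `K`. -/
def PreHilbert (_K : PosDefDistribution I M) : Type _ := smoothCc I M

variable (K : PosDefDistribution I M)

instance : AddCommGroup (PreHilbert K) := inferInstanceAs (AddCommGroup (smoothCc I M))

instance : Module ℂ (PreHilbert K) := inferInstanceAs (Module ℂ (smoothCc I M))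

/-- The positive semidefinite form given by `K`. The inner products of Mathlib are antilinear in the
first argument, so that `inner ℂ φ ψ` is `⟨ψ, φ⟩_K = K(conj ψ ⊗ φ)`. -/
abbrev preCore : PreInnerProductSpace.Core ℂ (PreHilbert K) where
  inner φ ψ := K.toFun (tensor (conjFun (I := I) (M := M) ψ) φ)
  conj_inner_symm φ ψ := K.hermitian φ ψ
  re_inner_nonneg φ := K.nonneg φ
  add_left φ φ' ψ := by
    rw [← map_add]
    congr 1
    ext p
    exact mul_add _ _ _
  smul_left φ ψ c := by
    rw [← smul_eq_mul, ← LinearMap.map_smulₛₗ]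
    congr 1
    ext p
    exact mul_left_comm _ _ _

instance : SeminormedAddCommGroup (PreHilbert K) :=
  @InnerProductSpace.Core.toSeminormedAddCommGroup ℂ _ _ _ _ (preCore K)

instance : InnerProductSpace ℂ (PreHilbert K) := InnerProductSpace.ofCore (preCore K)

/-- The Hilbert space `ℋ_K`, the completion of `C_c^∞(M)` with respect to `⟨·,·⟩_K`. -/
abbrev HilbertSpace : Type _ := UniformSpace.Completion (PreHilbert K)

/-- The canonical linear map `C_c^∞(M) → ℋ_K`, `φ ↦ K_φ`. -/
def vec : smoothCc I M →ₗ[ℂ] HilbertSpace K where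
  toFun φ := ((show PreHilbert K from φ : PreHilbert K) : HilbertSpace K)
  map_add' φ ψ := UniformSpace.Completion.coe_add (α := PreHilbert K) φ ψ
  map_smul' c φ := UniformSpace.Completion.coe_smul (X := PreHilbert K) c φ

theorem inner_vec (φ ψ : smoothCc I M) :
    inner ℂ (vec K ψ) (vec K φ) = K.toFun (tensor (conjFun φ) ψ) :=
  UniformSpace.Completion.inner_coe (𝕜 := ℂ) (E := PreHilbert K) ψ φ

theorem denseRange_vec : DenseRange (vec K) :=
  UniformSpace.Completion.denseRange_coe (α := PreHilbert K)

/-- The dense subspace `ℋ_K^0 = {K_φ | φ ∈ C_c^∞(M)}` of `ℋ_K`. -/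
def HilbertZero : Submodule ℂ (HilbertSpace K) := LinearMap.range (vec K)

/-- The embedding of `ℋ_K` into the antilinear functionals on `C_c^∞(M)`: the element `v`
is identified with the distribution `φ ↦ ⟨v, K_φ⟩`. -/
def toDist : HilbertSpace K →ₗ[ℂ] (smoothCc I M →ₗ⋆[ℂ] ℂ) where
  toFun v :=
    { toFun := fun φ => inner ℂ (vec K φ) v
      map_add' := fun φ ψ => by rw [map_add, inner_add_left]
      map_smul' := fun c φ => by rw [map_smul, inner_smul_left]; rfl }
  map_add' v w := by
    ext φ
    exact inner_add_right (𝕜 := ℂ) (vec K φ) v w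
  map_smul' c v := by
    ext φ
    exact inner_smul_right (𝕜 := ℂ) (vec K φ) v c

theorem toDist_injective : Function.Injective (toDist K) := by
  intro v w h
  refine (denseRange_vec K).eq_of_inner_right ℂ ?_
  intro φ
  exact LinearMap.congr_fun h φ

variable [IsManifold I ∞ M]

/-- `X` is `K`-symmetric: `ℒ_X^1 K = ℒ_X^2 K`, where `(ℒ_X^1 K)(φ ⊗ ψ) = -K(ℒ_X φ ⊗ ψ)` and
`(ℒ_X^2 K)(φ ⊗ ψ) = -K(φ ⊗ ℒ_X ψ)`. -/
def IsSymmetricField (X : SmoothField I M) : Prop :=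
  ∀ φ ψ : smoothCc I M,
    -K.toFun (tensor (lieDeriv X φ) ψ) = -K.toFun (tensor φ (lieDeriv X ψ))

/-- The graph `{(v, w) | w = ℒ_X v as distributions}` in `ℋ_K × ℋ_K`. -/
def lieGraph (X : SmoothField I M) : Submodule ℂ (HilbertSpace K × HilbertSpace K) where
  carrier := {p | toDist K p.2 = lieDist X (toDist K p.1)}
  add_mem' := fun {p q} hp hq => by
    simp only [Set.mem_ofPred_eq, Prod.fst_add, Prod.snd_add, map_add] at *
    rw [hp, hq]
  zero_mem' := by simp
  smul_mem' := fun c p hp => by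
    simp only [Set.mem_ofPred_eq, Prod.smul_fst, Prod.smul_snd, map_smul] at *
    rw [hp]

/-- The restriction of the Lie derivative `ℒ_X` of distributions to its maximal domain
`𝒟_X = {D ∈ ℋ_K | ℒ_X D ∈ ℋ_K}`, as an unbounded operator on `ℋ_K`. -/
def lieOp (X : SmoothField I M) : HilbertSpace K →ₗ.[ℂ] HilbertSpace K :=
  (lieGraph K X).toLinearPMap

theorem mem_graph_lieOp (X : SmoothField I M) (v w : HilbertSpace K) :
    (v, w) ∈ (lieOp K X).graph ↔ toDist K w = lieDist X (toDist K v) := by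
  rw [lieOp, Submodule.toLinearPMap_graph_eq]
  · rfl
  · rintro ⟨v, w⟩ hp rfl
    refine toDist_injective K ?_
    have h : toDist K w = lieDist X (toDist K 0) := hp
    simpa using h

end HilbertSpace

section Spectral

open MeasureTheory

variable (𝓗 : Type*) [NormedAddCommGroup 𝓗] [InnerProductSpace ℂ 𝓗] [CompleteSpace 𝓗]

/-- Projection-valued measures on the Borel sets of `ℝ` with values in the orthogonal projections of
the Hilbert space `𝓗`. -/
structure SpectralMeasure where
  /-- the projection `P(s)`; only its values on Borel sets matter -/
  proj : Set ℝ → (𝓗 →L[ℂ] 𝓗)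
  isStarProjection : ∀ s, MeasurableSet s → IsStarProjection (proj s)
  proj_univ : proj Set.univ = 1
  proj_inter : ∀ s t, MeasurableSet s → MeasurableSet t → proj (s ∩ t) = proj s * proj t
  hasSum : ∀ s : ℕ → Set ℝ, (∀ n, MeasurableSet (s n)) → Pairwise (Function.onFun Disjoint s) →
    ∀ x, HasSum (fun n => proj (s n) x) (proj (⋃ n, s n) x)

variable {𝓗}

namespace SpectralMeasure

variable (P : SpectralMeasure 𝓗)

theorem norm_sq_proj {s : Set ℝ} (hs : MeasurableSet s) (x : 𝓗) :
    ‖P.proj s x‖ ^ 2 = RCLike.re (inner ℂ x (P.proj s x)) := by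
  have h := P.isStarProjection s hs
  have h1 : P.proj s (P.proj s x) = P.proj s x :=
    congrArg (fun T : 𝓗 →L[ℂ] 𝓗 => T x) h.isIdempotentElem.eq
  have h2 : (P.proj s).adjoint = P.proj s := h.isSelfAdjoint.star_eq
  rw [← inner_self_eq_norm_sq (𝕜 := ℂ)]
  conv_lhs => rw [← ContinuousLinearMap.adjoint_inner_right, h2, h1]

/-- The Borel measure `s ↦ ‖P(s) x‖² = ⟨x, P(s) x⟩` on `ℝ`. -/
def measureAt (x : 𝓗) : Measure ℝ :=
  Measure.ofMeasurable (fun s _ => ENNReal.ofReal (‖P.proj s x‖ ^ 2))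
    (by
      have h := P.hasSum (fun _ => ∅) (fun _ => MeasurableSet.empty)
        (fun _ _ _ => disjoint_bot_left) x
      have h0 : P.proj ∅ x = 0 := by
        have := h.summable
        simpa [summable_const_iff] using this
      simp [h0])
    (by
      intro s hs hd
      have h := P.hasSum s hs hd x
      have h2 : HasSum (fun n => ‖P.proj (s n) x‖ ^ 2) (‖P.proj (⋃ n, s n) x‖ ^ 2) := by
        rw [P.norm_sq_proj (MeasurableSet.iUnion hs) x]
        simp only [fun n => P.norm_sq_proj (hs n) x]
        exact (h.mapL (innerSL ℂ x)).mapL Complex.reCLM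
      rw [← h2.tsum_eq, ENNReal.ofReal_tsum_of_nonneg (fun n => by positivity) h2.summable])

/-- The integral `(∫ f dP) x = ∑_c c P(f = c) x` of a simple function `f`. -/
def simpleIntegral (f : SimpleFunc ℝ ℂ) (x : 𝓗) : 𝓗 :=
  ∑ c ∈ f.range, c • P.proj (f ⁻¹' {c}) x

/-- The vector `x` lies in the domain `{x | ∫ |f|² d⟨x, P x⟩ < ∞}` of the normal operator
`∫ f dP`, and `(∫ f dP) x = y`. The value is defined as the limit of the integrals of simple
functions that converge to `f` in `L²(⟨x, P x⟩)`; it is unique because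
`‖(∫ g dP) x‖ = ‖g‖_{L²(⟨x, P x⟩)}` for simple functions `g`. -/
def HasIntegral (f : ℝ → ℂ) (x y : 𝓗) : Prop :=
  MemLp f 2 (P.measureAt x) ∧
    ∃ g : ℕ → SimpleFunc ℝ ℂ,
      Filter.Tendsto (fun n => eLpNorm (fun l => f l - g n l) 2 (P.measureAt x)) Filter.atTop (𝓝 0) ∧
      Filter.Tendsto (fun n => P.simpleIntegral (g n) x) Filter.atTop (𝓝 y)

/-- `P` is the spectral measure of the operator `A`: `A = ∫ l dP(l)`, with equality of domains. -/
def IsSpectralMeasureOf (A : 𝓗 →ₗ.[ℂ] 𝓗) : Prop :=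
  ∀ x y, (x, y) ∈ A.graph ↔ P.HasIntegral (fun l => (l : ℂ)) x y

end SpectralMeasure

/-- `x` lies in the domain of the operator `e^{tA} = ∫ e^{tl} dP(l)`, where `P` is the spectral
measure of the selfadjoint operator `A`, and `e^{tA} x = y`. -/
def ExpApply (A : 𝓗 →ₗ.[ℂ] 𝓗) (t : ℝ) (x y : 𝓗) : Prop :=
  ∃ P : SpectralMeasure 𝓗, P.IsSpectralMeasureOf A ∧
    P.HasIntegral (fun l => ((Real.exp (t * l) : ℝ) : ℂ)) x y

/-- Essentially selfadjoint operators: densely defined closable operators with selfadjoint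
closure. -/
def IsEssentiallySelfAdjoint (A : 𝓗 →ₗ.[ℂ] 𝓗) : Prop :=
  Dense (A.domain : Set 𝓗) ∧ A.IsClosable ∧ IsSelfAdjoint A.closure

end Spectral

end FrohlichDist

end

noncomputable section

namespace FrohlichDist

section AnalyticVectors

open Filter

theorem nonneg_of_hasDerivAt_nonneg {δ : ℝ} {f f' : ℝ → ℝ} (h0 : 0 ≤ f 0)
    (hf : ∀ t ∈ Set.Ico 0 δ, HasDerivAt f (f' t) t) (hf' : ∀ t ∈ Set.Ico 0 δ, 0 ≤ f' t) :
    ∀ t ∈ Set.Ico 0 δ, 0 ≤ f t := by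
  intro t ht
  have hm : MonotoneOn f (Set.Icc 0 t) := by
    refine monotoneOn_of_hasDerivWithinAt_nonneg (f' := f') (convex_Icc _ _)
      (fun s hs => (hf s ⟨hs.1, hs.2.trans_lt ht.2⟩).continuousAt.continuousWithinAt)
      (fun s hs => ?_) (fun s hs => ?_)
    · rw [interior_Icc] at hs
      exact (hf s ⟨hs.1.le, hs.2.trans ht.2⟩).hasDerivWithinAt
    · rw [interior_Icc] at hs
      exact hf' s ⟨hs.1.le, hs.2.trans ht.2⟩
  exact h0.trans (hm (Set.left_mem_Icc.2 ht.1) (Set.right_mem_Icc.2 ht.1) ht.1)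

/-- Taylor's lower bound for a function whose even derivatives are nonnegative on `(-δ, δ)`. -/
theorem taylor_even_le {δ : ℝ} (n : ℕ) : ∀ g : ℕ → ℝ → ℝ,
    (∀ m, ∀ t ∈ Set.Ioo (-δ) δ, HasDerivAt (g m) (g (m + 1) t) t) →
    (∀ m, ∀ t ∈ Set.Ioo (-δ) δ, 0 ≤ g (2 * m) t) →
    ∀ t ∈ Set.Ico 0 δ, 2 * g (2 * n) 0 * t ^ (2 * n) / (2 * n).factorial ≤ g 0 t + g 0 (-t) := by
  have hpos : ∀ g : ℕ → ℝ → ℝ, (∀ m, ∀ t ∈ Set.Ioo (-δ) δ, HasDerivAt (g m) (g (m + 1) t) t) →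
      ∀ m, ∀ t ∈ Set.Ico 0 δ, HasDerivAt (fun s => g m s - g m (-s))
        (g (m + 1) t + g (m + 1) (-t)) t ∧ HasDerivAt (fun s => g m s + g m (-s))
        (g (m + 1) t - g (m + 1) (-t)) t := by
    intro g hg m t ht
    have h1 := hg m t ⟨by linarith [ht.1, ht.2], ht.2⟩
    have h2 := (hg m (-t) ⟨by linarith [ht.2], by linarith [ht.1, ht.2]⟩).scomp t (hasDerivAt_neg t)
    constructor
    · exact (h1.sub h2).congr_deriv (by simp)
    · exact (h1.add h2).congr_deriv (by simp [sub_eq_add_neg])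
  induction n with
  | zero =>
    intro g hg h0 t ht
    have h1 := nonneg_of_hasDerivAt_nonneg (δ := δ) (f := fun s => g 1 s - g 1 (-s)) (by simp)
      (fun t ht => (hpos g hg 1 t ht).1) (fun t ht => add_nonneg
        (h0 1 t ⟨by linarith [ht.1, ht.2], ht.2⟩)
        (h0 1 (-t) ⟨by linarith [ht.2], by linarith [ht.1, ht.2]⟩))
    have h2 := nonneg_of_hasDerivAt_nonneg (δ := δ) (f := fun s => g 0 s + g 0 (-s) - 2 * g 0 0)
      (by simp [two_mul]) (fun t ht => (hpos g hg 0 t ht).2.sub_const _) h1 t ht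
    simpa using h2
  | succ n ih =>
    intro g hg h0 t ht
    have h2 := ih (fun m => g (m + 2)) (fun m => hg (m + 2)) (fun m => h0 (m + 1))
    set k := 2 * n with hk
    have hk2 : 2 * (n + 1) = k + 2 := by omega
    rw [hk2]
    set c := g (k + 2) 0 with hc
    have hf : ∀ j : ℕ, ∀ s : ℝ, HasDerivAt (fun s : ℝ => 2 * c * s ^ (j + 1) / (j + 1).factorial)
        (2 * c * s ^ j / j.factorial) s := by
      intro j s
      refine (((hasDerivAt_pow (j + 1) s).const_mul (2 * c)).div_const
        ((j + 1).factorial : ℝ)).congr_deriv ?_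
      rw [Nat.factorial_succ]
      have : (j.factorial : ℝ) ≠ 0 := by positivity
      push_cast
      field_simp
    have h1 := nonneg_of_hasDerivAt_nonneg (δ := δ)
      (f := fun s => g 1 s - g 1 (-s) - 2 * c * s ^ (k + 1) / (k + 1).factorial) (by simp)
      (fun t ht => (hpos g hg 1 t ht).1.sub (hf k t)) (fun t ht => by linarith [h2 t ht])
    have h3 := nonneg_of_hasDerivAt_nonneg (δ := δ)
      (f := fun s => g 0 s + g 0 (-s) - 2 * c * s ^ (k + 2) / (k + 2).factorial) (by
        have h00 := h0 0 0 ⟨by linarith [ht.1, ht.2], by linarith [ht.1, ht.2]⟩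
        simp only [mul_zero] at h00
        simp [h00]) (fun t ht => (hpos g hg 0 t ht).2.sub (hf (k + 1) t)) h1 t ht
    linarith

variable {𝓗 : Type*} [NormedAddCommGroup 𝓗] [InnerProductSpace ℂ 𝓗]

/-- If `v n` are differentiable curves with `(v n)' = v (n + 1)`, and `⟨v (j+1), v k⟩ = ⟨v j, v (k+1)⟩`,
then `v 0` is an analytic vector. -/
theorem exists_norm_le_factorial {δ : ℝ} (hδ : 0 < δ) (v : ℕ → ℝ → 𝓗)
    (hv : ∀ n, ∀ t ∈ Set.Ioo (-δ) δ, HasDerivAt (v n) (v (n + 1) t) t)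
    (hsymm : ∀ j k t, inner ℂ (v (j + 1) t) (v k t) = inner ℂ (v j t) (v (k + 1) t)) :
    ∃ C ρ : ℝ, 0 < ρ ∧ ∀ n, ‖v n 0‖ ≤ C * ρ ^ n * n.factorial := by
  have hadd : ∀ j k t, inner ℂ (v j t) (v k t) = inner ℂ (v 0 t) (v (j + k) t) := by
    intro j
    induction j with
    | zero => intro k t; simp
    | succ j ih => intro k t; rw [hsymm, ih]; congr 2; omega
  have hsq : ∀ n t, (inner ℂ (v 0 t) (v (2 * n) t)).re = ‖v n t‖ ^ 2 := by
    intro n t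
    rw [two_mul, ← hadd, ← inner_self_eq_norm_sq (𝕜 := ℂ)]
    rfl
  set g : ℕ → ℝ → ℝ := fun m t => 2 ^ m * (inner ℂ (v 0 t) (v m t)).re with hg
  have hgd : ∀ m, ∀ t ∈ Set.Ioo (-δ) δ, HasDerivAt (g m) (g (m + 1) t) t := by
    intro m t ht
    have h1 := (hv 0 t ht).inner ℂ (hv m t ht)
    have h2 := (Complex.reCLM.hasFDerivAt.comp_hasDerivAt t h1).const_mul ((2 : ℝ) ^ m)
    refine h2.congr_deriv ?_
    simp only [hg, zero_add]
    rw [hsymm 0 m t, ← two_mul, pow_succ]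
    simp
    ring
  have hg0 : ∀ m, ∀ t ∈ Set.Ioo (-δ) δ, 0 ≤ g (2 * m) t := by
    intro m t _
    simp only [hg, hsq]
    positivity
  set t := δ / 2 with ht
  set B := g 0 t + g 0 (-t) with hB
  have hmain : ∀ n, ‖v n 0‖ ^ 2 ≤ B * ((2 * n).factorial / (2 * t) ^ (2 * n)) := by
    intro n
    have := taylor_even_le n g hgd hg0 t ⟨by positivity, by rw [ht]; linarith⟩
    simp only [hg, hsq] at this
    have ht0 : 0 < t := by positivity
    rw [← hB, div_le_iff₀ (by positivity)] at this
    rw [← mul_div_assoc, le_div_iff₀ (by positivity), mul_pow]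
    have h3 : 0 ≤ 2 ^ (2 * n) * ‖v n 0‖ ^ 2 * t ^ (2 * n) := by positivity
    nlinarith
  have hB0 : 0 ≤ B := by
    have := hmain 0
    simp at this
    nlinarith [sq_nonneg ‖v 0 0‖]
  refine ⟨√B, 1 / t, by positivity, fun n => ?_⟩
  refine abs_le_of_sq_le_sq' ?_ (by positivity) |>.2
  refine (hmain n).trans ?_
  rw [mul_pow, mul_pow, mul_pow, Real.sq_sqrt hB0, mul_assoc]
  refine mul_le_mul_of_nonneg_left ?_ hB0
  have hfac : ((2 * n).factorial : ℝ) ≤ 4 ^ n * (n.factorial : ℝ) ^ 2 := by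
    have h1 : (2 * n).factorial = n.centralBinom * n.factorial ^ 2 := by
      rw [Nat.centralBinom_eq_two_mul_choose, ← Nat.choose_mul_factorial_mul_factorial
        (show n ≤ 2 * n by omega), show 2 * n - n = n by omega]
      ring
    have h2 : n.centralBinom ≤ 4 ^ n := by
      rw [Nat.centralBinom_eq_two_mul_choose]
      calc (2 * n).choose n ≤ 2 ^ (2 * n) := Nat.choose_le_two_pow _ _
        _ = 4 ^ n := by rw [pow_mul]; norm_num
    rw [h1]
    push_cast
    gcongr
    exact_mod_cast h2
  have ht0 : 0 < t := by positivity
  rw [div_le_iff₀ (by positivity)]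
  refine hfac.trans (le_of_eq ?_)
  rw [pow_mul 2 2 n, show (2 : ℝ) ^ 2 = 4 by norm_num, ← pow_mul, one_div, inv_pow,
    mul_comm n 2]
  field_simp


theorem summable_analytic {u : ℕ → 𝓗} {C ρ : ℝ} (hρ : 0 < ρ)
    (hu : ∀ n, ‖u n‖ ≤ C * ρ ^ n * n.factorial) {z : ℂ} (hz : ‖z‖ * ρ ≤ 1 / 4) (m : ℕ) :
    Summable fun k => ‖(z ^ k / k.factorial) • u (m + k)‖ := by
  have hC : 0 ≤ C := by simpa using (norm_nonneg _).trans (hu 0)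
  refine Summable.of_nonneg_of_le (fun _ => norm_nonneg _) (fun k => ?_)
    ((summable_geometric_two).mul_left (C * (2 * ρ) ^ m * m.factorial))
  rw [norm_smul, norm_div, norm_pow, Complex.norm_natCast]
  have hk : (0 : ℝ) < k.factorial := by positivity
  have hfac : ((m + k).factorial : ℝ) ≤ 2 ^ (m + k) * m.factorial * k.factorial := by
    have h1 := Nat.add_choose_mul_factorial_mul_factorial m k
    rw [← h1]
    push_cast
    gcongr
    exact_mod_cast Nat.choose_le_two_pow _ _
  calc ‖z‖ ^ k / k.factorial * ‖u (m + k)‖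
      ≤ ‖z‖ ^ k / k.factorial * (C * ρ ^ (m + k) * (2 ^ (m + k) * m.factorial * k.factorial)) := by
        gcongr
        refine (hu _).trans ?_
        gcongr
    _ = C * (2 * ρ) ^ m * m.factorial * (2 * (‖z‖ * ρ)) ^ k := by
        simp only [mul_pow, pow_add]; field_simp
    _ ≤ C * (2 * ρ) ^ m * m.factorial * (1 / 2) ^ k := by
        gcongr; linarith

theorem sum_antidiagonal_pow_div_factorial (z w : ℂ) (n : ℕ) :
    ∑ p ∈ Finset.HasAntidiagonal.antidiagonal n, (z ^ p.1 / p.1.factorial) * (w ^ p.2 / p.2.factorial) =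
      (z + w) ^ n / n.factorial := by
  rw [(Commute.all z w).add_pow', Finset.sum_div]
  refine Finset.sum_congr rfl fun p hp => ?_
  obtain ⟨j, k⟩ := p
  obtain rfl : j + k = n := by simpa using hp
  have h1 : (((j + k).choose j * j.factorial * k.factorial : ℕ) : ℂ) = ((j + k).factorial : ℕ) :=
    congrArg _ (by rw [Nat.choose_symm_add]; exact Nat.add_choose_mul_factorial_mul_factorial j k)
  have hj : (j.factorial : ℂ) ≠ 0 := by exact_mod_cast j.factorial_ne_zero
  have hk : (k.factorial : ℂ) ≠ 0 := by exact_mod_cast k.factorial_ne_zero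
  have hjk : ((j + k).factorial : ℂ) ≠ 0 := by exact_mod_cast (j + k).factorial_ne_zero
  push_cast at h1
  rw [nsmul_eq_mul]
  field_simp
  rw [← h1]
  ring

variable [CompleteSpace 𝓗]

theorem inner_tsum_tsum {x y : ℕ → 𝓗} (hx : Summable fun k => ‖x k‖) (hy : Summable fun k => ‖y k‖) :
    inner ℂ (∑' k, x k) (∑' k, y k) =
      ∑' n, ∑ p ∈ Finset.HasAntidiagonal.antidiagonal n, inner ℂ (x p.1) (y p.2) := by
  have hs : Summable fun p : ℕ × ℕ => (inner ℂ (x p.1) (y p.2) : ℂ) := by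
    refine Summable.of_norm_bounded
      (hx.mul_of_nonneg hy (fun _ => norm_nonneg _) fun _ => norm_nonneg _) fun p => ?_
    exact norm_inner_le_norm _ _
  have h1 : inner ℂ (∑' k, x k) (∑' k, y k) = ∑' p : ℕ × ℕ, (inner ℂ (x p.1) (y p.2) : ℂ) := by
    rw [hs.tsum_prod]
    have h2 : ∀ j, ∑' k, (inner ℂ (x j) (y k) : ℂ) = inner ℂ (x j) (∑' k, y k) := fun j =>
      ((hy.of_norm.hasSum).mapL (innerSL ℂ (x j))).tsum_eq
    simp only [h2]
    exact (((hx.of_norm.hasSum).mapL ((innerSLFlip ℂ) (∑' k, y k))).tsum_eq).symm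
  have h3 := Finset.HasAntidiagonal.sigmaAntidiagonalEquivProd.summable_iff.2 hs
  rw [h1, ← Finset.HasAntidiagonal.sigmaAntidiagonalEquivProd.tsum_eq]
  refine (h3.tsum_sigma' fun n => (hasSum_fintype _).summable).trans (tsum_congr fun n => ?_)
  rw [tsum_fintype]
  exact Finset.sum_coe_sort (Finset.HasAntidiagonal.antidiagonal n)
    fun p : ℕ × ℕ => (inner ℂ (x p.1) (y p.2) : ℂ)

/-- The sum `∑ z^k / k! u_{n+k}`. -/
def analyticShift (u : ℕ → 𝓗) (z : ℂ) (n : ℕ) : 𝓗 := ∑' k, (z ^ k / k.factorial) • u (n + k)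

theorem inner_analyticShift {u : ℕ → 𝓗} {a : ℕ → ℂ} (ha : ∀ j k, inner ℂ (u j) (u k) = a (j + k))
    {C ρ : ℝ} (hρ : 0 < ρ) (hu : ∀ n, ‖u n‖ ≤ C * ρ ^ n * n.factorial)
    {z : ℂ} (hz : ‖z‖ * ρ ≤ 1 / 4) (hz' : conj z = -z) (m n : ℕ) :
    inner ℂ (analyticShift u z m) (analyticShift u z n) = a (m + n) := by
  rw [analyticShift, analyticShift, inner_tsum_tsum (summable_analytic hρ hu hz m)
    (summable_analytic hρ hu hz n)]
  have h1 : ∀ k, ∑ p ∈ Finset.HasAntidiagonal.antidiagonal k, (inner ℂ ((z ^ p.1 / p.1.factorial) • u (m + p.1))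
      ((z ^ p.2 / p.2.factorial) • u (n + p.2)) : ℂ) = 0 ^ k / k.factorial * a (m + n + k) := by
    intro k
    rw [← neg_add_cancel z, ← hz', ← sum_antidiagonal_pow_div_factorial, Finset.sum_mul]
    refine Finset.sum_congr rfl fun p hp => ?_
    have hp' : p.1 + p.2 = k := by simpa using hp
    rw [inner_smul_left, inner_smul_right, ha, ← mul_assoc, map_div₀, map_pow, map_natCast,
      show m + p.1 + (n + p.2) = m + n + k by omega]
  simp only [h1]
  rw [tsum_eq_single 0 (fun k hk => by simp [hk])]
  simp

/-- Nelson's theorem, in the form that there are no deficiency vectors: if `u n = A^n (u 0)` for a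
symmetric operator `A` and an analytic vector `u 0`, then a vector `w` with `A* w = ± i w` is
orthogonal to `u 0`. -/
theorem inner_eq_zero_of_analytic {u : ℕ → 𝓗} {a : ℕ → ℂ}
    (ha : ∀ j k, inner ℂ (u j) (u k) = a (j + k))
    {C ρ : ℝ} (hρ : 0 < ρ) (hu : ∀ n, ‖u n‖ ≤ C * ρ ^ n * n.factorial)
    {w : 𝓗} {c : ℂ} (hc : c = Complex.I ∨ c = -Complex.I)
    (hw : ∀ n, inner ℂ w (u (n + 1)) = c * inner ℂ w (u n)) : inner ℂ w (u 0) = (0 : ℂ) := by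
  set r : ℝ := 1 / (4 * ρ) with hr
  have hr0 : 0 < r := by positivity
  obtain ⟨z, hz, hzr, hzc⟩ : ∃ z : ℂ, conj z = -z ∧ ‖z‖ = r ∧ z * c = r := by
    rcases hc with rfl | rfl
    · exact ⟨-(r * Complex.I), by simp, by simp [abs_of_pos hr0], by
        rw [neg_mul, mul_assoc, Complex.I_mul_I]; simp⟩
    · exact ⟨r * Complex.I, by simp, by simp [abs_of_pos hr0], by
        rw [mul_neg, mul_assoc, Complex.I_mul_I]; simp⟩
  have hz4 : ‖z‖ * ρ ≤ 1 / 4 := by rw [hzr, hr]; field_simp; rfl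
  have hnorm : ∀ {x : 𝓗} {y : 𝓗}, (inner ℂ x x : ℂ) = inner ℂ y y → ‖x‖ = ‖y‖ := by
    intro x y h
    rw [norm_eq_sqrt_re_inner (𝕜 := ℂ), h, ← norm_eq_sqrt_re_inner (𝕜 := ℂ)]
  have key : ∀ N : ℕ, ∃ v : ℕ → 𝓗, (∀ j k, inner ℂ (v j) (v k) = a (j + k)) ∧
      ∀ n, inner ℂ w (v n) = (Real.exp (N * r) : ℂ) * inner ℂ w (u n) := by
    intro N
    induction N with
    | zero => exact ⟨u, ha, fun n => by simp⟩
    | succ N ih =>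
      obtain ⟨v, hv, hvw⟩ := ih
      have hvu : ∀ n, ‖v n‖ ≤ C * ρ ^ n * n.factorial := fun n =>
        (hnorm (by rw [hv, ha])).trans_le (hu n)
      refine ⟨analyticShift v z, inner_analyticShift hv hρ hvu hz4 hz, fun n => ?_⟩
      have h1 := (summable_analytic hρ hvu hz4 n).of_norm.hasSum.mapL (innerSL ℂ w)
      have h2 : ∀ k, inner ℂ w (v (n + k)) = c ^ k * inner ℂ w (v n) := by
        intro k
        induction k with
        | zero => simp
        | succ k ihk =>
          have : inner ℂ w (v (n + k + 1)) = c * inner ℂ w (v (n + k)) := by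
            rw [hvw, hvw, hw]; ring
          rw [← add_assoc, this, ihk, pow_succ]; ring
      have h3 := (NormedSpace.expSeries_div_hasSum_exp (𝔸 := ℂ) (z * c)).mul_right (inner ℂ w (v n) : ℂ)
      have h4 : (inner ℂ w (analyticShift v z n) : ℂ) = NormedSpace.exp (z * c) * inner ℂ w (v n) := by
        have h5 : (fun k : ℕ => innerSL ℂ w ((z ^ k / k.factorial) • v (n + k))) =
            fun k : ℕ => (z * c) ^ k / k.factorial * inner ℂ w (v n) := by
          funext k
          rw [innerSL_apply_apply, inner_smul_right, h2, mul_pow]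
          ring
        rw [h5] at h1
        exact h1.unique h3
      rw [h4, hvw, hzc, ← mul_assoc]
      congr 1
      rw [← Complex.exp_eq_exp_ℂ, ← Complex.ofReal_exp, ← Complex.ofReal_mul, ← Real.exp_add]
      congr 2
      push_cast
      ring
  by_contra h0
  have hle : ∀ N : ℕ, Real.exp (N * r) * ‖(inner ℂ w (u 0) : ℂ)‖ ≤ ‖w‖ * ‖u 0‖ := by
    intro N
    obtain ⟨v, hv, hvw⟩ := key N
    calc Real.exp (N * r) * ‖(inner ℂ w (u 0) : ℂ)‖ = ‖(inner ℂ w (v 0) : ℂ)‖ := by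
          rw [hvw, norm_mul, Complex.norm_real, Real.norm_of_nonneg (Real.exp_pos _).le]
      _ ≤ ‖w‖ * ‖v 0‖ := norm_inner_le_norm _ _
      _ = ‖w‖ * ‖u 0‖ := by rw [hnorm (x := v 0) (y := u 0) (by rw [hv, ha])]
  have hpos : 0 < ‖(inner ℂ w (u 0) : ℂ)‖ := norm_pos_iff.2 h0
  have htend : Tendsto (fun N : ℕ => Real.exp (N * r) * ‖(inner ℂ w (u 0) : ℂ)‖) atTop atTop :=
    (Real.tendsto_exp_atTop.comp
      (tendsto_natCast_atTop_atTop.atTop_mul_const hr0)).atTop_mul_const hpos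
  obtain ⟨N, hN⟩ := (htend.eventually_gt_atTop (‖w‖ * ‖u 0‖)).exists
  exact absurd (hle N) (not_le.2 hN)

end AnalyticVectors

section SymmetricGraph

variable {𝓗 : Type*} [NormedAddCommGroup 𝓗] [InnerProductSpace ℂ 𝓗]

/-- The graph `G` of an operator is symmetric. -/
def IsSymmGraph (G : Submodule ℂ (𝓗 × 𝓗)) : Prop :=
  ∀ p ∈ G, ∀ q ∈ G, (inner ℂ p.2 q.1 : ℂ) = inner ℂ p.1 q.2

/-- The graph `G` of an operator has no deficiency vectors. -/
def NoDeficiency (G : Submodule ℂ (𝓗 × 𝓗)) : Prop :=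
  ∀ c : ℂ, c = Complex.I ∨ c = -Complex.I → ∀ w : 𝓗,
    (∀ p ∈ G, (inner ℂ w p.2 : ℂ) = c * inner ℂ w p.1) → w = 0

variable {G : Submodule ℂ (𝓗 × 𝓗)}

theorem IsSymmGraph.norm_sq (hG : IsSymmGraph G) {c : ℂ} (hc : c = Complex.I ∨ c = -Complex.I)
    {p : 𝓗 × 𝓗} (hp : p ∈ G) : ‖p.2 + c • p.1‖ ^ 2 = ‖p.1‖ ^ 2 + ‖p.2‖ ^ 2 := by
  have h1 : conj (inner ℂ p.2 p.1 : ℂ) = inner ℂ p.2 p.1 := by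
    rw [inner_conj_symm, hG p hp p hp]
  have h2 : (inner ℂ p.2 p.1 : ℂ).im = 0 := Complex.conj_eq_iff_im.1 h1
  have hn : ‖c‖ = 1 := by rcases hc with rfl | rfl <;> simp
  rw [norm_add_sq (𝕜 := ℂ), inner_smul_right, norm_smul, hn]
  have h3 : RCLike.re (c * inner ℂ p.2 p.1) = 0 := by
    rcases hc with rfl | rfl <;> simp [h2]
  rw [h3]
  ring

theorem IsSymmGraph.norm_le (hG : IsSymmGraph G) {c : ℂ} (hc : c = Complex.I ∨ c = -Complex.I)
    {p : 𝓗 × 𝓗} (hp : p ∈ G) : ‖p‖ ≤ ‖p.2 + c • p.1‖ := by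
  have h := hG.norm_sq hc hp
  refine max_le ?_ ?_
  · exact abs_le_of_sq_le_sq' (by nlinarith [sq_nonneg ‖p.2‖]) (norm_nonneg _) |>.2
  · exact abs_le_of_sq_le_sq' (by nlinarith [sq_nonneg ‖p.1‖]) (norm_nonneg _) |>.2

theorem IsSymmGraph.topologicalClosure (hG : IsSymmGraph G) : IsSymmGraph G.topologicalClosure := by
  intro p hp q hq
  have h1 : ∀ q ∈ G, (inner ℂ p.2 q.1 : ℂ) = inner ℂ p.1 q.2 := by
    intro q hq
    exact closure_minimal (s := (G : Set (𝓗 × 𝓗)))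
      (t := {p | (inner ℂ p.2 q.1 : ℂ) = inner ℂ p.1 q.2}) (fun p hp => hG p hp q hq)
      (isClosed_eq (by fun_prop) (by fun_prop)) hp
  exact closure_minimal (s := (G : Set (𝓗 × 𝓗)))
    (t := {q | (inner ℂ p.2 q.1 : ℂ) = inner ℂ p.1 q.2}) h1
    (isClosed_eq (by fun_prop) (by fun_prop)) hq

theorem NoDeficiency.mono (hG : NoDeficiency G) {G' : Submodule ℂ (𝓗 × 𝓗)} (h : G ≤ G') :
    NoDeficiency G' := fun c hc w hw => hG c hc w fun p hp => hw p (h hp)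

/-- The map `(x, y) ↦ y + c x` on the graph. -/
def graphShift (G : Submodule ℂ (𝓗 × 𝓗)) (c : ℂ) : G →L[ℂ] 𝓗 :=
  (ContinuousLinearMap.snd ℂ 𝓗 𝓗 + c • ContinuousLinearMap.fst ℂ 𝓗 𝓗).comp G.subtypeL

theorem graphShift_apply (c : ℂ) (p : G) : graphShift G c p = p.1.2 + c • p.1.1 := rfl

variable [CompleteSpace 𝓗]

theorem IsSymmGraph.exists_add_smul_eq (hG : IsSymmGraph G) (hd : NoDeficiency G)
    (hcl : IsClosed (G : Set (𝓗 × 𝓗))) {c : ℂ} (hc : c = Complex.I ∨ c = -Complex.I) (y : 𝓗) :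
    ∃ p ∈ G, p.2 + c • p.1 = y := by
  have : CompleteSpace G := hcl.completeSpace_coe
  have hanti : AntilipschitzWith 1 (graphShift G c) :=
    AddMonoidHomClass.antilipschitz_of_bound _ fun p => by
      simpa [graphShift_apply] using hG.norm_le hc p.2
  have hclosed : IsClosed ((graphShift G c).range : Set 𝓗) :=
    hanti.isClosed_range (graphShift G c).uniformContinuous
  have htop : (graphShift G c).range = ⊤ := by
    have : CompleteSpace (graphShift G c).range := hclosed.completeSpace_coe
    rw [← Submodule.orthogonal_eq_bot_iff, Submodule.eq_bot_iff]
    intro w hw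
    refine hd (-c) (by rcases hc with rfl | rfl <;> simp) w fun p hp => ?_
    have h1 := (Submodule.mem_orthogonal' _ w).1 hw _ ⟨⟨p, hp⟩, rfl⟩
    have h2 : (inner ℂ w (p.2 + c • p.1) : ℂ) = 0 := h1
    rw [inner_add_right, inner_smul_right] at h2
    linear_combination h2
  have hy : y ∈ (graphShift G c).range := htop ▸ Submodule.mem_top
  obtain ⟨p, hp⟩ := hy
  exact ⟨p, p.2, hp⟩

/-- The resolvent and the Cayley transform of a selfadjoint operator with graph `G`. -/
theorem IsSymmGraph.exists_resolvent (hG : IsSymmGraph G) (hd : NoDeficiency G)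
    (hcl : IsClosed (G : Set (𝓗 × 𝓗))) :
    ∃ R : 𝓗 →L[ℂ] 𝓗, (∀ x y, (x, y) ∈ G ↔ x = R (y + Complex.I • x)) ∧
      1 - (2 * Complex.I) • R ∈ unitary (𝓗 →L[ℂ] 𝓗) := by
  have hI : Complex.I = Complex.I ∨ Complex.I = -Complex.I := Or.inl rfl
  have hI' : -Complex.I = Complex.I ∨ -Complex.I = -Complex.I := Or.inr rfl
  have hinj : Function.Injective (graphShift G Complex.I) :=
    (AddMonoidHomClass.antilipschitz_of_bound (K := 1) (graphShift G Complex.I) fun p => by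
      simpa [graphShift_apply] using hG.norm_le hI p.2).injective
  let e : G ≃ₗ[ℂ] 𝓗 := LinearEquiv.ofBijective (graphShift G Complex.I).toLinearMap
    ⟨hinj, fun y => by
      obtain ⟨p, hp, h⟩ := hG.exists_add_smul_eq hd hcl hI y
      exact ⟨⟨p, hp⟩, h⟩⟩
  have he : ∀ y, (e.symm y).1.2 + Complex.I • (e.symm y).1.1 = y := fun y => e.apply_symm_apply y
  let R : 𝓗 →L[ℂ] 𝓗 := LinearMap.mkContinuous
    ((LinearMap.fst ℂ 𝓗 𝓗).comp (G.subtype.comp e.symm.toLinearMap)) 1 fun y => by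
      rw [one_mul]
      refine (norm_fst_le _).trans ((hG.norm_le hI (e.symm y).2).trans ?_)
      rw [he]
  have hR : ∀ p ∈ G, R (p.2 + Complex.I • p.1) = p.1 := by
    intro p hp
    have h1 : e ⟨p, hp⟩ = p.2 + Complex.I • p.1 := rfl
    change (e.symm (p.2 + Complex.I • p.1)).1.1 = p.1
    rw [← h1, e.symm_apply_apply]
  refine ⟨R, fun x y => ⟨fun h => (hR _ h).symm, fun h => ?_⟩, ?_⟩
  · have h1 := he (y + Complex.I • x)
    have h2 : (e.symm (y + Complex.I • x)).1.1 = x := h.symm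
    rw [h2] at h1
    have h3 : (e.symm (y + Complex.I • x)).1 = (x, y) := Prod.ext h2 (add_right_cancel h1)
    rw [← h3]
    exact (e.symm _).2
  · set U : 𝓗 →L[ℂ] 𝓗 := 1 - (2 * Complex.I) • R with hU
    have hUp : ∀ p ∈ G, U (p.2 + Complex.I • p.1) = p.2 + (-Complex.I) • p.1 := by
      intro p hp
      change p.2 + Complex.I • p.1 - (2 * Complex.I) • R (p.2 + Complex.I • p.1) = _
      rw [hR p hp, mul_smul, two_smul, neg_smul]
      abel
    have hnorm : ∀ y, ‖U y‖ = ‖y‖ := by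
      intro y
      obtain ⟨p, hp, rfl⟩ := hG.exists_add_smul_eq hd hcl hI y
      rw [hUp p hp]
      have := (hG.norm_sq hI hp).trans (hG.norm_sq hI' hp).symm
      exact ((sq_eq_sq₀ (norm_nonneg _) (norm_nonneg _)).1 this).symm
    have h1 : star U * U = 1 := (ContinuousLinearMap.norm_map_iff_adjoint_comp_self U).1 hnorm
    refine Unitary.mem_iff.2 ⟨h1, ?_⟩
    ext y
    obtain ⟨p, hp, rfl⟩ := hG.exists_add_smul_eq hd hcl hI' y
    rw [← hUp p hp]
    change U ((star U * U) (p.2 + Complex.I • p.1)) = _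
    rw [h1]
    rfl

/-- A densely defined symmetric operator without deficiency vectors is essentially selfadjoint, and
its closure is its adjoint. -/
theorem closure_eq_adjoint {A : 𝓗 →ₗ.[ℂ] 𝓗} (hA : Dense (A.domain : Set 𝓗))
    (hG : IsSymmGraph A.graph) (hd : NoDeficiency A.graph) :
    IsEssentiallySelfAdjoint A ∧ A.closure = A.adjoint := by
  have hle : A ≤ A.adjoint := by
    refine LinearPMap.IsFormalAdjoint.le_adjoint hA fun x y => ?_
    exact hG _ (A.mem_graph x) _ (A.mem_graph y)
  have hcl : A.IsClosable := (LinearPMap.adjoint_isClosed hA).isClosable.leIsClosable hle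
  have hgr := hcl.graph_closure_eq_closure_graph
  have hGc := hG.topologicalClosure
  have hdc := hd.mono A.graph.le_topologicalClosure
  have hmax : ∀ x : 𝓗 × 𝓗, (∀ a b, (a, b) ∈ A.graph → (inner ℂ b x.1 : ℂ) - inner ℂ a x.2 = 0) →
      x ∈ A.graph.topologicalClosure := by
    intro x hx
    obtain ⟨p, hp, hpx⟩ := hGc.exists_add_smul_eq hdc A.graph.isClosed_topologicalClosure
      (Or.inl rfl) (x.2 + Complex.I • x.1)
    have h0 : x.1 - p.1 = 0 := by
      refine hd Complex.I (Or.inl rfl) _ fun q hq => ?_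
      have h1 := hx q.1 q.2 hq
      have h2 := hGc q (A.graph.le_topologicalClosure hq) p hp
      have h3 : x.2 - p.2 = -(Complex.I • (x.1 - p.1)) := by
        rw [smul_sub]
        have : x.2 = p.2 + Complex.I • p.1 - Complex.I • x.1 := by rw [hpx]; abel
        rw [this]; abel
      have h4 : (inner ℂ q.2 (x.1 - p.1) : ℂ) = inner ℂ q.1 (x.2 - p.2) := by
        rw [inner_sub_right, inner_sub_right]; linear_combination h1 - h2
      rw [h3, inner_neg_right, inner_smul_right] at h4
      have h5 := congrArg conj h4
      rw [map_neg, map_mul, inner_conj_symm, inner_conj_symm, Complex.conj_I] at h5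
      linear_combination h5
    have hx1 : x.1 = p.1 := sub_eq_zero.1 h0
    have : x = p := Prod.ext hx1 (by
      rw [hx1] at hpx
      exact (add_right_cancel hpx).symm)
    exact this ▸ hp
  have hadj : A.closure = A.adjoint := by
    refine LinearPMap.eq_of_eq_graph ?_
    rw [← hgr, LinearPMap.adjoint_graph_eq_graph_adjoint hA]
    refine le_antisymm ?_ fun x hx => hmax x ((Submodule.mem_adjoint_iff _ _).1 hx)
    intro p hp
    rw [Submodule.mem_adjoint_iff]
    intro a b hab
    exact sub_eq_zero.2 (hGc (a, b) (A.graph.le_topologicalClosure hab) p hp)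
  refine ⟨⟨hA, hcl, ?_⟩, hadj⟩
  have hdense : Dense (A.closure.domain : Set 𝓗) := hA.mono A.le_closure.1
  rw [LinearPMap.isSelfAdjoint_def]
  refine LinearPMap.eq_of_eq_graph ?_
  rw [LinearPMap.adjoint_graph_eq_graph_adjoint hdense, ← hgr]
  refine le_antisymm (fun x hx => hmax x fun a b hab => ?_) fun p hp => ?_
  · exact (Submodule.mem_adjoint_iff _ _).1 hx a b (A.graph.le_topologicalClosure hab)
  · rw [Submodule.mem_adjoint_iff]
    exact fun a b hab => sub_eq_zero.2 (hGc (a, b) hab p hp)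

end SymmetricGraph

section BorelCalculus

open MeasureTheory Filter CompactlySupported
open scoped ENNReal

variable {X : Type*} [TopologicalSpace X]
  {𝓗 : Type*} [NormedAddCommGroup 𝓗] [InnerProductSpace ℂ 𝓗] [CompleteSpace 𝓗]
  (π : C(X, ℂ) →⋆ₐ[ℂ] (𝓗 →L[ℂ] 𝓗))

theorem map_star_mul (f g : C(X, ℂ)) : π (star f * g) = ContinuousLinearMap.adjoint (π f) * π g := by
  have h1 := map_mul π (star f) g
  have h2 := map_star π f
  rw [h1, h2]
  rfl

theorem inner_map_star_mul (f g : C(X, ℂ)) (x y : 𝓗) :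
    (inner ℂ x (π (star f * g) y) : ℂ) = inner ℂ (π f x) (π g y) := by
  have h := map_star_mul π f g
  have h2 : π (star f * g) y = ContinuousLinearMap.adjoint (π f) (π g y) := by
    rw [h]
    rfl
  rw [h2]
  exact ContinuousLinearMap.adjoint_inner_right _ _ _

/-- The inclusion of the real functions into the complex functions. -/
def ofRealMap (f : C(X, ℝ)) : C(X, ℂ) := ⟨fun t => (f t : ℂ), by fun_prop⟩

theorem eLpNorm_two_eq {α : Type*} [MeasurableSpace α] {μ : Measure α} {f : α → ℂ}
    (hf : MemLp f 2 μ) : eLpNorm f 2 μ = ENNReal.ofReal (√(∫ t, ‖f t‖ ^ 2 ∂μ)) := by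
  rw [hf.eLpNorm_eq_integral_rpow_norm two_ne_zero ENNReal.ofNat_ne_top, Real.sqrt_eq_rpow]
  congr 2
  · simp
  · simp

variable [CompactSpace X] [T2Space X]
  [TopologicalSpace.PseudoMetrizableSpace X] [MeasurableSpace X] [BorelSpace X]

theorem exists_measure (x : 𝓗) : ∃ μ : Measure X, IsFiniteMeasure μ ∧
    ∀ g : C(X, ℂ), eLpNorm g 2 μ = ‖π g x‖ₑ := by
  let Λ₀ : C_c(X, ℝ) →ₗ[ℝ] ℝ :=
    { toFun := fun f => (inner ℂ x (π (ofRealMap f.toContinuousMap) x) : ℂ).re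
      map_add' := fun f g => by
        rw [← Complex.add_re, ← inner_add_right, ← _root_.add_apply, ← map_add]
        congr 4
        ext t
        simp [ofRealMap]
      map_smul' := fun c f => by
        have : ofRealMap (c • f).toContinuousMap = (c : ℂ) • ofRealMap f.toContinuousMap := by
          ext t
          simp [ofRealMap]
        rw [this, map_smul, _root_.smul_apply, inner_smul_right,
          Complex.re_ofReal_mul]
        rfl }
  have hpos : ∀ f : C_c(X, ℝ), 0 ≤ f → 0 ≤ Λ₀ f := by
    intro f hf
    let s : C(X, ℝ) := ⟨fun t => √(f t), by fun_prop⟩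
    have h1 : ofRealMap f.toContinuousMap = star (ofRealMap s) * ofRealMap s := by
      ext t
      simp only [ofRealMap, s, ContinuousMap.coe_mk, ContinuousMap.mul_apply,
        ContinuousMap.star_apply, RCLike.star_def, Complex.conj_ofReal]
      rw [← Complex.ofReal_mul, Real.mul_self_sqrt (hf t)]
      rfl
    change 0 ≤ (inner ℂ x (π (ofRealMap f.toContinuousMap) x) : ℂ).re
    rw [h1, inner_map_star_mul]
    exact inner_self_nonneg (𝕜 := ℂ)
  let Λ : C_c(X, ℝ) →ₚ[ℝ] ℝ := PositiveLinearMap.mk₀ Λ₀ hpos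
  refine ⟨RealRMK.rieszMeasure Λ, ?_, fun g => ?_⟩
  · infer_instance
  · let n : C_c(X, ℝ) := ⟨⟨fun t => ‖g t‖ ^ 2, by fun_prop⟩, HasCompactSupport.of_compactSpace _⟩
    have h1 := RealRMK.integral_rieszMeasure Λ n
    have h2 : Λ n = ‖π g x‖ ^ 2 := by
      change (inner ℂ x (π (ofRealMap n.toContinuousMap) x) : ℂ).re = _
      have h3 : ofRealMap n.toContinuousMap = star g * g := by
        ext t
        simp only [ofRealMap, n, ContinuousMap.coe_mk, ContinuousMap.mul_apply,
          ContinuousMap.star_apply, RCLike.star_def, Complex.conj_mul']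
        push_cast
        rfl
      rw [h3, inner_map_star_mul]
      exact inner_self_eq_norm_sq (𝕜 := ℂ) _
    rw [h2] at h1
    have h4 : MemLp g 2 (RealRMK.rieszMeasure Λ) :=
      MemLp.of_bound g.continuous.aestronglyMeasurable ‖g‖
        (Eventually.of_forall g.norm_coe_le_norm)
    rw [eLpNorm_two_eq h4]
    have h5 : ∫ t, ‖g t‖ ^ 2 ∂(RealRMK.rieszMeasure Λ) = ‖π g x‖ ^ 2 := h1
    rw [h5, Real.sqrt_sq (norm_nonneg _), ofReal_norm]

/-- The measure `μ_x` with `∫ |g|² dμ_x = ‖π(g) x‖²`. -/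
def vecMeasure (x : 𝓗) : Measure X := (exists_measure π x).choose

instance (x : 𝓗) : IsFiniteMeasure (vecMeasure π x) := (exists_measure π x).choose_spec.1

theorem eLpNorm_vecMeasure (x : 𝓗) (g : C(X, ℂ)) : eLpNorm g 2 (vecMeasure π x) = ‖π g x‖ₑ :=
  (exists_measure π x).choose_spec.2 g

/-- The filter of continuous approximations of `f` in `L²(ν)`. -/
def approxFilter (ν : Measure X) (f : X → ℂ) : Filter C(X, ℂ) :=
  comap (fun g : C(X, ℂ) => eLpNorm (fun t => f t - g t) 2 ν) (𝓝 0)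

omit [CompactSpace X] [T2Space X] [TopologicalSpace.PseudoMetrizableSpace X] [BorelSpace X] in
theorem tendsto_approxFilter (ν : Measure X) (f : X → ℂ) :
    Tendsto (fun g : C(X, ℂ) => eLpNorm (fun t => f t - g t) 2 ν) (approxFilter ν f) (𝓝 0) := tendsto_comap

omit [CompactSpace X] [T2Space X] [TopologicalSpace.PseudoMetrizableSpace X] [BorelSpace X] in
theorem approxFilter_mono {ν ν' : Measure X} (h : ν ≤ ν') (f : X → ℂ) :
    approxFilter ν' f ≤ approxFilter ν f := by
  refine tendsto_iff_comap.1 (tendsto_of_tendsto_of_tendsto_of_le_of_le tendsto_const_nhds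
    (tendsto_approxFilter ν' f) (fun _ => zero_le) fun g => eLpNorm_mono_measure _ h)

theorem approxFilter_neBot {ν : Measure X} [IsFiniteMeasure ν] {f : X → ℂ} (hf : MemLp f 2 ν) :
    (approxFilter ν f).NeBot := by
  refine comap_neBot fun s hs => ?_
  obtain ⟨ε, hε, hεs⟩ := ENNReal.nhds_zero_basis_Iic.mem_iff.1 hs
  obtain ⟨g, hg, -⟩ := hf.exists_boundedContinuous_eLpNorm_sub_le ENNReal.ofNat_ne_top hε.ne'
  exact ⟨g.toContinuousMap, hεs hg⟩

/-- Bounded measurable functions. -/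
def BddMeas {α : Type*} [MeasurableSpace α] (f : α → ℂ) : Prop :=
  Measurable f ∧ ∃ C : ℝ, ∀ t, ‖f t‖ ≤ C

theorem BddMeas.memLp {α : Type*} [MeasurableSpace α] {f : α → ℂ} (hf : BddMeas f) (ν : Measure α)
    [IsFiniteMeasure ν] : MemLp f 2 ν := by
  obtain ⟨hm, C, hC⟩ := hf
  exact MemLp.of_bound hm.aestronglyMeasurable C (Eventually.of_forall hC)

theorem BddMeas.add {α : Type*} [MeasurableSpace α] {f g : α → ℂ} (hf : BddMeas f)
    (hg : BddMeas g) : BddMeas (f + g) := by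
  obtain ⟨hm, C, hC⟩ := hf
  obtain ⟨hm', C', hC'⟩ := hg
  exact ⟨hm.add hm', C + C', fun t => (norm_add_le _ _).trans (add_le_add (hC t) (hC' t))⟩

theorem BddMeas.mul {α : Type*} [MeasurableSpace α] {f g : α → ℂ} (hf : BddMeas f)
    (hg : BddMeas g) : BddMeas (f * g) := by
  obtain ⟨hm, C, hC⟩ := hf
  obtain ⟨hm', C', hC'⟩ := hg
  refine ⟨hm.mul hm', C * C', fun t => ?_⟩
  rw [Pi.mul_apply, norm_mul]
  exact mul_le_mul (hC t) (hC' t) (norm_nonneg _) ((norm_nonneg _).trans (hC t))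

theorem BddMeas.const {α : Type*} [MeasurableSpace α] (c : ℂ) : BddMeas fun _ : α => c :=
  ⟨measurable_const, ‖c‖, fun _ => le_rfl⟩

theorem BddMeas.conj {α : Type*} [MeasurableSpace α] {f : α → ℂ} (hf : BddMeas f) :
    BddMeas (fun t => conj (f t)) := by
  obtain ⟨hm, C, hC⟩ := hf
  exact ⟨Complex.continuous_conj.measurable.comp hm, C, fun t => by simpa using hC t⟩

omit [T2Space X] [TopologicalSpace.PseudoMetrizableSpace X] in
theorem bddMeas_coe (g : C(X, ℂ)) : BddMeas g :=
  ⟨g.continuous.measurable, ‖g‖, g.norm_coe_le_norm⟩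

/-- The vector `∫ f dP x`, for `f` in `L²(μ_x)`. -/
def vecIntegral (f : X → ℂ) (x : 𝓗) : 𝓗 :=
  limUnder (approxFilter (vecMeasure π x) f) fun g => π g x

omit [CompactSpace X] [T2Space X] [TopologicalSpace.PseudoMetrizableSpace X] in
theorem eLpNorm_sub_coe_le {ν : Measure X} {f : X → ℂ} (hf : MemLp f 2 ν) {g g' : C(X, ℂ)} :
    eLpNorm (g - g' : C(X, ℂ)) 2 ν ≤ eLpNorm (fun t => f t - g t) 2 ν + eLpNorm (fun t => f t - g' t) 2 ν := by
  have h1 : ((g - g' : C(X, ℂ)) : X → ℂ) = (f - g') - (f - g) := by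
    ext t; simp
  rw [h1, add_comm]
  exact eLpNorm_sub_le (hf.1.sub g'.continuous.aestronglyMeasurable)
    (hf.1.sub g.continuous.aestronglyMeasurable) one_le_two

theorem tendsto_vecIntegral_self {f : X → ℂ} {x : 𝓗} (hf : MemLp f 2 (vecMeasure π x)) :
    Tendsto (fun g => π g x) (approxFilter (vecMeasure π x) f) (𝓝 (vecIntegral π f x)) := by
  have := approxFilter_neBot hf
  refine tendsto_nhds_limUnder (cauchy_map_iff_exists_tendsto.1 (cauchy_map_iff.2 ⟨this, ?_⟩))
  refine uniformity_basis_edist.tendsto_right_iff.2 fun ε hε => ?_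
  have h1 : Tendsto (fun p : C(X, ℂ) × C(X, ℂ) =>
      eLpNorm (fun t => f t - p.1 t) 2 (vecMeasure π x) +
      eLpNorm (fun t => f t - p.2 t) 2 (vecMeasure π x))
      (approxFilter (vecMeasure π x) f ×ˢ approxFilter (vecMeasure π x) f) (𝓝 (0 + 0)) :=
    ((tendsto_approxFilter _ f).comp tendsto_fst).add ((tendsto_approxFilter _ f).comp tendsto_snd)
  rw [add_zero] at h1
  filter_upwards [h1.eventually_lt_const hε] with p hp
  refine lt_of_le_of_lt ?_ hp
  have h2 : π p.1 x - π p.2 x = π (p.1 - p.2) x := by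
    rw [map_sub]
    rfl
  change edist (π p.1 x) (π p.2 x) ≤ _
  rw [edist_eq_enorm_sub, h2, ← eLpNorm_vecMeasure]
  exact eLpNorm_sub_coe_le hf

theorem tendsto_vecIntegral {f : X → ℂ} {x : 𝓗} {ν : Measure X} (hν : vecMeasure π x ≤ ν)
    (hf : MemLp f 2 (vecMeasure π x)) :
    Tendsto (fun g => π g x) (approxFilter ν f) (𝓝 (vecIntegral π f x)) :=
  (tendsto_vecIntegral_self π hf).mono_left (approxFilter_mono hν f)

theorem enorm_vecIntegral {f : X → ℂ} {x : 𝓗} (hf : MemLp f 2 (vecMeasure π x)) :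
    ‖vecIntegral π f x‖ₑ = eLpNorm f 2 (vecMeasure π x) := by
  have := approxFilter_neBot hf
  set μ := vecMeasure π x with hμ
  have h1 : Tendsto (fun g => ‖π g x‖ₑ) (approxFilter μ f) (𝓝 ‖vecIntegral π f x‖ₑ) :=
    (tendsto_vecIntegral_self π hf).enorm
  have h2 : ∀ g : C(X, ℂ), ‖π g x‖ₑ ≤ eLpNorm f 2 μ + eLpNorm (fun t => f t - g t) 2 μ := by
    intro g
    rw [← eLpNorm_vecMeasure]
    have : (g : X → ℂ) = f - fun t => f t - g t := by ext t; simp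
    conv_lhs => rw [this]
    exact eLpNorm_sub_le hf.1 (hf.1.sub g.continuous.aestronglyMeasurable) one_le_two
  have h3 : ∀ g : C(X, ℂ), eLpNorm f 2 μ ≤ ‖π g x‖ₑ + eLpNorm (fun t => f t - g t) 2 μ := by
    intro g
    rw [← eLpNorm_vecMeasure]
    have : f = g + fun t => f t - g t := by ext t; simp
    conv_lhs => rw [this]
    exact eLpNorm_add_le g.continuous.aestronglyMeasurable
      (hf.1.sub g.continuous.aestronglyMeasurable) one_le_two
  have h0 := tendsto_approxFilter μ f
  refine le_antisymm ?_ ?_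
  · refine le_of_tendsto_of_tendsto' h1 ?_ h2
    simpa using h0.const_add (eLpNorm f 2 μ)
  · refine ge_of_tendsto' (x := approxFilter μ f) ?_ h3
    simpa using h1.add h0

theorem vecIntegral_eq {f : X → ℂ} {x y : 𝓗} {ν : Measure X} [IsFiniteMeasure ν]
    (hν : vecMeasure π x ≤ ν) (hf : BddMeas f)
    (h : Tendsto (fun g => π g x) (approxFilter ν f) (𝓝 y)) : vecIntegral π f x = y := by
  have := approxFilter_neBot (hf.memLp ν)
  exact tendsto_nhds_unique (tendsto_vecIntegral π hν (hf.memLp _)) h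

theorem vecIntegral_coe (g : C(X, ℂ)) (x : 𝓗) : vecIntegral π g x = π g x := by
  have h : pure g ≤ approxFilter (vecMeasure π x) g := by
    refine tendsto_iff_comap.1 ?_
    rw [tendsto_pure_left]
    intro s hs
    simpa using mem_of_mem_nhds hs
  exact tendsto_nhds_unique ((tendsto_vecIntegral_self π ((bddMeas_coe g).memLp _)).mono_left h)
    (tendsto_pure_nhds _ _)

theorem vecIntegral_add_vec {f : X → ℂ} (hf : BddMeas f) (x y : 𝓗) :
    vecIntegral π f (x + y) = vecIntegral π f x + vecIntegral π f y := by
  set ν := vecMeasure π x + vecMeasure π y + vecMeasure π (x + y) with hν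
  have hx : vecMeasure π x ≤ ν := by
    rw [hν, add_assoc]; exact Measure.le_add_right le_rfl
  have hy : vecMeasure π y ≤ ν := by
    rw [hν, add_right_comm]; exact Measure.le_add_left le_rfl
  have hxy : vecMeasure π (x + y) ≤ ν := Measure.le_add_left le_rfl
  refine vecIntegral_eq π hxy hf ?_
  simp only [map_add]
  exact (tendsto_vecIntegral π hx (hf.memLp _)).add (tendsto_vecIntegral π hy (hf.memLp _))

theorem vecIntegral_smul_vec {f : X → ℂ} (hf : BddMeas f) (c : ℂ) (x : 𝓗) :
    vecIntegral π f (c • x) = c • vecIntegral π f x := by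
  set ν := vecMeasure π x + vecMeasure π (c • x) with hν
  have hx : vecMeasure π x ≤ ν := Measure.le_add_right le_rfl
  have hcx : vecMeasure π (c • x) ≤ ν := Measure.le_add_left le_rfl
  refine vecIntegral_eq π hcx hf ?_
  simp only [map_smul]
  exact (tendsto_vecIntegral π hx (hf.memLp _)).const_smul c

theorem enorm_vecIntegral_le {f : X → ℂ} (hf : Measurable f) {C : ℝ} (hC : ∀ t, ‖f t‖ ≤ C) (x : 𝓗) :
    ‖vecIntegral π f x‖ ≤ |C| * ‖x‖ := by
  have h1 := enorm_vecIntegral π (x := x) (BddMeas.memLp ⟨hf, C, hC⟩ _)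
  have h2 := eLpNorm_le_mul_eLpNorm_of_ae_le_mul (μ := vecMeasure π x) (f := f)
    (g := (1 : C(X, ℂ))) (c := |C|)
    (Eventually.of_forall fun t => by simpa using (hC t).trans (le_abs_self C)) 2
  rw [← h1, eLpNorm_vecMeasure, map_one] at h2
  rw [← ofReal_norm, ← ofReal_norm, ← ENNReal.ofReal_mul (abs_nonneg _)] at h2
  exact (ENNReal.ofReal_le_ofReal_iff (by positivity)).1 h2

theorem vecIntegral_add {f f' : X → ℂ} (hf : BddMeas f) (hf' : BddMeas f') (x : 𝓗) :
    vecIntegral π (f + f') x = vecIntegral π f x + vecIntegral π f' x := by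
  set μ := vecMeasure π x with hμ
  have := approxFilter_neBot (hf.memLp μ)
  have := approxFilter_neBot (hf'.memLp μ)
  have h1 : Tendsto (fun p : C(X, ℂ) × C(X, ℂ) => p.1 + p.2) (approxFilter μ f ×ˢ approxFilter μ f')
      (approxFilter μ (f + f')) := by
    refine tendsto_comap_iff.2 (tendsto_of_tendsto_of_tendsto_of_le_of_le tendsto_const_nhds
      (h := fun p => eLpNorm (fun t => f t - p.1 t) 2 μ + eLpNorm (fun t => f' t - p.2 t) 2 μ)
      ?_ (fun _ => zero_le) fun p => ?_)
    · have := ((tendsto_approxFilter μ f).comp tendsto_fst).add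
        ((tendsto_approxFilter μ f').comp (tendsto_snd (f := approxFilter μ f)))
      rwa [add_zero] at this
    · have : (fun t => (f + f') t - (p.1 + p.2) t) =
          (fun t => f t - p.1 t) + fun t => f' t - p.2 t := by
        ext t; simp; ring
      change eLpNorm (fun t => (f + f') t - (p.1 + p.2) t) 2 μ ≤ _
      rw [this]
      exact eLpNorm_add_le (hf.1.aestronglyMeasurable.sub p.1.continuous.aestronglyMeasurable)
        (hf'.1.aestronglyMeasurable.sub p.2.continuous.aestronglyMeasurable) one_le_two
  have h2 := (tendsto_vecIntegral_self π ((hf.add hf').memLp μ)).comp h1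
  have h3 := ((tendsto_vecIntegral_self π (hf.memLp μ)).comp
    (tendsto_fst (g := approxFilter μ f'))).add
    ((tendsto_vecIntegral_self π (hf'.memLp μ)).comp (tendsto_snd (f := approxFilter μ f)))
  refine tendsto_nhds_unique (h2.congr fun p => ?_) h3
  change π (p.1 + p.2) x = π p.1 x + π p.2 x
  rw [map_add]
  rfl

theorem apply_vecIntegral {f : X → ℂ} (hf : BddMeas f) (g : C(X, ℂ)) (x : 𝓗) :
    π g (vecIntegral π f x) = vecIntegral π (g * f) x := by
  set μ := vecMeasure π x with hμ
  have := approxFilter_neBot (hf.memLp μ)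
  have h1 : Tendsto (fun k => g * k) (approxFilter μ f) (approxFilter μ (g * f)) := by
    refine tendsto_comap_iff.2 (tendsto_of_tendsto_of_tendsto_of_le_of_le tendsto_const_nhds
      (h := fun k => ENNReal.ofReal ‖g‖ * eLpNorm (fun t => f t - k t) 2 μ)
      ?_ (fun _ => zero_le) fun k => ?_)
    · simpa using ENNReal.Tendsto.const_mul (tendsto_approxFilter μ f)
        (Or.inr (ENNReal.ofReal_ne_top (r := ‖g‖)))
    · refine eLpNorm_le_mul_eLpNorm_of_ae_le_mul (Eventually.of_forall fun t => ?_) 2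
      have : (g * f : X → ℂ) t - (g * k) t = g t * (f t - k t) := by simp; ring
      rw [this, norm_mul]
      exact mul_le_mul_of_nonneg_right (g.norm_coe_le_norm t) (norm_nonneg _)
  have h2 := (tendsto_vecIntegral_self π (((bddMeas_coe g).mul hf).memLp μ)).comp h1
  have h3 := ((π g).continuous.tendsto _).comp (tendsto_vecIntegral_self π (hf.memLp μ))
  refine tendsto_nhds_unique h3 (h2.congr fun k => ?_)
  change π (g * k) x = π g (π k x)
  rw [map_mul]
  rfl

theorem vecIntegral_neg {f : X → ℂ} (hf : BddMeas f) (x : 𝓗) :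
    vecIntegral π (-f) x = -vecIntegral π f x := by
  have h1 := apply_vecIntegral π hf (-1) x
  have h2 : ((-1 : C(X, ℂ)) : X → ℂ) * f = -f := by ext t; simp
  rw [h2, map_neg, map_one] at h1
  exact h1.symm

theorem BddMeas.neg {α : Type*} [MeasurableSpace α] {f : α → ℂ} (hf : BddMeas f) : BddMeas (-f) := by
  obtain ⟨hm, C, hC⟩ := hf
  exact ⟨hm.neg, C, fun t => by simpa using hC t⟩

theorem vecIntegral_vecIntegral {f h : X → ℂ} (hf : BddMeas f) (hh : BddMeas h) (x : 𝓗) :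
    vecIntegral π h (vecIntegral π f x) = vecIntegral π (h * f) x := by
  set z := vecIntegral π f x with hz
  set ν := vecMeasure π z + vecMeasure π x with hν
  obtain ⟨C, hC⟩ := hf.2
  have hzν : vecMeasure π z ≤ ν := Measure.le_add_right le_rfl
  have hxν : vecMeasure π x ≤ ν := Measure.le_add_left le_rfl
  refine vecIntegral_eq π hzν hh ?_
  rw [tendsto_iff_edist_tendsto_0]
  refine tendsto_of_tendsto_of_tendsto_of_le_of_le tendsto_const_nhds
    (h := fun k => ENNReal.ofReal C * eLpNorm (fun t => h t - k t) 2 (vecMeasure π x))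
    ?_ (fun _ => zero_le) fun k => ?_
  · simpa using ENNReal.Tendsto.const_mul
      ((tendsto_approxFilter _ h).mono_left (approxFilter_mono hxν h))
      (Or.inr (ENNReal.ofReal_ne_top (r := C)))
  · have h1 : π k z - vecIntegral π (h * f) x = vecIntegral π (k * f + -(h * f)) x := by
      rw [hz, apply_vecIntegral π hf, vecIntegral_add π ((bddMeas_coe k).mul hf) (hh.mul hf).neg,
        vecIntegral_neg π (hh.mul hf), sub_eq_add_neg]
    change edist (π k z) _ ≤ _
    rw [edist_eq_enorm_sub, h1, enorm_vecIntegral π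
      ((((bddMeas_coe k).mul hf).add (hh.mul hf).neg).memLp _)]
    refine eLpNorm_le_mul_eLpNorm_of_ae_le_mul (Eventually.of_forall fun t => ?_) 2
    have : ((k : X → ℂ) * f + -(h * f)) t = -(f t * (h t - k t)) := by simp; ring
    rw [this, norm_neg, norm_mul]
    exact mul_le_mul_of_nonneg_right (hC t) (norm_nonneg _)

theorem inner_vecIntegral {f : X → ℂ} (hf : BddMeas f) (x y : 𝓗) :
    (inner ℂ (vecIntegral π f x) y : ℂ) = inner ℂ x (vecIntegral π (fun t => conj (f t)) y) := by
  set ν := vecMeasure π x + vecMeasure π y with hν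
  have hxν : vecMeasure π x ≤ ν := Measure.le_add_right le_rfl
  have hyν : vecMeasure π y ≤ ν := Measure.le_add_left le_rfl
  have := approxFilter_neBot (hf.memLp ν)
  have h1 : Tendsto (fun g : C(X, ℂ) => star g) (approxFilter ν f)
      (approxFilter ν fun t => conj (f t)) := by
    refine tendsto_comap_iff.2 ((tendsto_approxFilter ν f).congr fun g => ?_)
    refine eLpNorm_congr_norm_ae (Eventually.of_forall fun t => ?_)
    have : conj (f t) - (star g) t = conj (f t - g t) := by simp
    rw [this, RCLike.norm_conj]
  have h2 := (tendsto_vecIntegral π hyν (hf.conj.memLp _)).comp h1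
  have h3 := tendsto_vecIntegral π hxν (hf.memLp _)
  have h4 := h3.inner (𝕜 := ℂ) (tendsto_const_nhds (x := y))
  have h5 := (tendsto_const_nhds (x := x)).inner (𝕜 := ℂ) h2
  refine tendsto_nhds_unique h4 (h5.congr fun g => ?_)
  have h6 := inner_map_star_mul π g 1 x y
  rw [mul_one, map_one] at h6
  exact h6

end BorelCalculus

section BorelCalculus

open MeasureTheory Filter
open scoped ENNReal

variable {𝓗 : Type*} [NormedAddCommGroup 𝓗] [InnerProductSpace ℂ 𝓗]

/-- A functional calculus for bounded Borel functions. -/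
structure BorelCalculus (X : Type*) [MeasurableSpace X] (𝓗 : Type*) [NormedAddCommGroup 𝓗]
    [InnerProductSpace ℂ 𝓗] where
  /-- the operator `f(A)` -/
  op : (X → ℂ) → (𝓗 →L[ℂ] 𝓗)
  /-- the measure `s ↦ ‖1_s(A) x‖²` -/
  meas : 𝓗 → Measure X
  finite : ∀ x, IsFiniteMeasure (meas x)
  enorm_op : ∀ f, BddMeas f → ∀ x, ‖op f x‖ₑ = eLpNorm f 2 (meas x)
  op_add : ∀ f g, BddMeas f → BddMeas g → op (f + g) = op f + op g
  op_mul : ∀ f g, BddMeas f → BddMeas g → op (f * g) = op f * op g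
  op_const : ∀ c, op (fun _ => c) = c • 1
  inner_op : ∀ f, BddMeas f → ∀ x y,
    (inner ℂ (op f x) y : ℂ) = inner ℂ x (op (fun t => conj (f t)) y)

instance {X : Type*} [MeasurableSpace X] (B : BorelCalculus X 𝓗) (x : 𝓗) :
    IsFiniteMeasure (B.meas x) := B.finite x

open Classical in
/-- The Borel functional calculus extending a continuous functional calculus. -/
def BorelCalculus.ofStarAlgHom [CompleteSpace 𝓗] {X : Type*} [TopologicalSpace X] [CompactSpace X]
    [T2Space X] [TopologicalSpace.PseudoMetrizableSpace X] [MeasurableSpace X] [BorelSpace X]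
    (π : C(X, ℂ) →⋆ₐ[ℂ] (𝓗 →L[ℂ] 𝓗)) : BorelCalculus X 𝓗 :=
  let opAux : (X → ℂ) → (𝓗 →L[ℂ] 𝓗) := fun f =>
    if hf : BddMeas f then
      LinearMap.mkContinuous
        { toFun := vecIntegral π f
          map_add' := vecIntegral_add_vec π hf
          map_smul' := vecIntegral_smul_vec π hf } |hf.2.choose|
        (enorm_vecIntegral_le π hf.1 hf.2.choose_spec)
    else 0
  have hop : ∀ f, BddMeas f → ∀ x, opAux f x = vecIntegral π f x := fun f hf x => by
    simp only [opAux, dif_pos hf]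
    rfl
  { op := opAux
    meas := vecMeasure π
    finite := fun _ => inferInstance
    enorm_op := fun f hf x => by rw [hop f hf, enorm_vecIntegral π (hf.memLp _)]
    op_add := fun f g hf hg => by
      ext x
      rw [hop _ (hf.add hg), vecIntegral_add π hf hg, _root_.add_apply, hop f hf, hop g hg]
    op_mul := fun f g hf hg => by
      ext x
      rw [hop _ (hf.mul hg), ← vecIntegral_vecIntegral π hg hf, ← hop g hg, ← hop f hf]
      rfl
    op_const := fun c => by
      ext x
      have h1 := vecIntegral_coe π (algebraMap ℂ C(X, ℂ) c) x
      rw [AlgHomClass.commutes, Algebra.algebraMap_eq_smul_one (A := 𝓗 →L[ℂ] 𝓗)] at h1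
      rw [hop _ (BddMeas.const c), ← h1]
      rfl
    inner_op := fun f hf x y => by
      rw [hop f hf, hop _ hf.conj, inner_vecIntegral π hf] }

theorem BorelCalculus.ofStarAlgHom_coe [CompleteSpace 𝓗] {X : Type*} [TopologicalSpace X]
    [CompactSpace X] [T2Space X] [TopologicalSpace.PseudoMetrizableSpace X] [MeasurableSpace X]
    [BorelSpace X] (π : C(X, ℂ) →⋆ₐ[ℂ] (𝓗 →L[ℂ] 𝓗)) (g : C(X, ℂ)) :
    (BorelCalculus.ofStarAlgHom π).op g = π g := by
  ext x
  rw [← vecIntegral_coe]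
  simp only [BorelCalculus.ofStarAlgHom, dif_pos (bddMeas_coe g)]
  rfl

theorem BddMeas.comp {X Y : Type*} [MeasurableSpace X] [MeasurableSpace Y] {f : Y → ℂ}
    (hf : BddMeas f) {κ : X → Y} (hκ : Measurable κ) : BddMeas (f ∘ κ) :=
  ⟨hf.1.comp hκ, hf.2.choose, fun t => hf.2.choose_spec (κ t)⟩

/-- The image of a Borel functional calculus under a measurable map. -/
def BorelCalculus.map {X Y : Type*} [MeasurableSpace X] [MeasurableSpace Y]
    (B : BorelCalculus X 𝓗) {κ : X → Y} (hκ : Measurable κ) : BorelCalculus Y 𝓗 where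
  op f := B.op (f ∘ κ)
  meas x := (B.meas x).map κ
  finite x := inferInstance
  enorm_op f hf x := by
    rw [B.enorm_op _ (hf.comp hκ), eLpNorm_map_measure hf.1.aestronglyMeasurable hκ.aemeasurable]
  op_add f g hf hg := B.op_add _ _ (hf.comp hκ) (hg.comp hκ)
  op_mul f g hf hg := B.op_mul _ _ (hf.comp hκ) (hg.comp hκ)
  op_const c := B.op_const c
  inner_op f hf x y := B.inner_op _ (hf.comp hκ) x y

theorem BddMeas.indicator {X : Type*} [MeasurableSpace X] {s : Set X} (hs : MeasurableSet s) :
    BddMeas (s.indicator (1 : X → ℂ)) :=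
  ⟨measurable_one.indicator hs, 1, fun t => by
    by_cases h : t ∈ s <;> simp [h]⟩

theorem BddMeas.sub {α : Type*} [MeasurableSpace α] {f g : α → ℂ} (hf : BddMeas f)
    (hg : BddMeas g) : BddMeas (f - g) := sub_eq_add_neg f g ▸ hf.add hg.neg

theorem BddMeas.smul {α : Type*} [MeasurableSpace α] {f : α → ℂ} (c : ℂ) (hf : BddMeas f) :
    BddMeas (c • f) := (BddMeas.const c).mul hf

theorem BddMeas.sum {α ι : Type*} [MeasurableSpace α] {f : ι → α → ℂ} (hf : ∀ i, BddMeas (f i))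
    (F : Finset ι) : BddMeas (∑ i ∈ F, f i) :=
  Finset.sum_induction f BddMeas (fun _ _ => BddMeas.add) (BddMeas.const 0) fun i _ => hf i

namespace BorelCalculus

variable {X : Type*} [MeasurableSpace X] (B : BorelCalculus X 𝓗)

theorem op_one : B.op 1 = 1 := (B.op_const 1).trans (one_smul _ _)

theorem op_zero : B.op 0 = 0 := (B.op_const 0).trans (zero_smul _ _)

theorem op_smul (c : ℂ) {f : X → ℂ} (hf : BddMeas f) : B.op (c • f) = c • B.op f := by
  have h : c • f = (fun _ => c) * f := rfl
  rw [h, B.op_mul _ _ (BddMeas.const c) hf, B.op_const, smul_mul_assoc, one_mul]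

theorem op_sub {f g : X → ℂ} (hf : BddMeas f) (hg : BddMeas g) :
    B.op (f - g) = B.op f - B.op g := by
  rw [eq_sub_iff_add_eq, ← B.op_add _ _ (hf.sub hg) hg, sub_add_cancel]

theorem op_sum {ι : Type*} {f : ι → X → ℂ} (hf : ∀ i, BddMeas (f i)) (F : Finset ι) :
    B.op (∑ i ∈ F, f i) = ∑ i ∈ F, B.op (f i) := by
  classical
  induction F using Finset.induction_on with
  | empty => simpa using B.op_zero
  | insert a F ha ih =>
    rw [Finset.sum_insert ha, Finset.sum_insert ha, B.op_add _ _ (hf a) (BddMeas.sum hf F), ih]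

theorem norm_op_le {f : X → ℂ} (hf : Measurable f) {C : ℝ} (hC : ∀ t, ‖f t‖ ≤ C) (hC0 : 0 ≤ C) :
    ‖B.op f‖ ≤ C := by
  refine ContinuousLinearMap.opNorm_le_bound _ hC0 fun x => ?_
  have h1 := eLpNorm_le_mul_eLpNorm_of_ae_le_mul (μ := B.meas x) (f := f) (g := (1 : X → ℂ)) (c := C)
    (Eventually.of_forall fun t => by simpa using hC t) 2
  rw [← B.enorm_op _ ⟨hf, C, hC⟩, ← B.enorm_op 1 (BddMeas.const 1), op_one] at h1
  rw [← ofReal_norm, ← ofReal_norm, ← ENNReal.ofReal_mul hC0] at h1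
  exact (ENNReal.ofReal_le_ofReal_iff (by positivity)).1 h1

theorem enorm_op_indicator_sq {s : Set X} (hs : MeasurableSet s) (x : 𝓗) :
    ‖B.op (s.indicator 1) x‖ₑ ^ 2 = B.meas x s := by
  rw [B.enorm_op _ (BddMeas.indicator hs)]
  have h := eLpNorm_indicator_const (μ := B.meas x) (p := 2) (c := (1 : ℂ)) hs two_ne_zero
    ENNReal.ofNat_ne_top
  have h2 : s.indicator (1 : X → ℂ) = s.indicator fun _ => 1 := rfl
  rw [h2, h]
  simp only [enorm_one, one_mul, ENNReal.toReal_ofNat]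
  rw [← ENNReal.rpow_natCast, ← ENNReal.rpow_mul]
  norm_num

theorem norm_op_indicator_sq {s : Set X} (hs : MeasurableSet s) (x : 𝓗) :
    ‖B.op (s.indicator 1) x‖ ^ 2 = (B.meas x).real s := by
  rw [measureReal_def, ← B.enorm_op_indicator_sq hs, ENNReal.toReal_pow, toReal_enorm]

omit [MeasurableSpace X] in
theorem indicator_mul_indicator (s t : Set X) :
    s.indicator (1 : X → ℂ) * t.indicator 1 = (s ∩ t).indicator 1 := by
  rw [Set.inter_indicator_one]

variable [CompleteSpace 𝓗]

theorem isStarProjection_op_indicator {s : Set X} (hs : MeasurableSet s) :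
    IsStarProjection (B.op (s.indicator 1)) := by
  refine ⟨?_, ?_⟩
  · rw [IsIdempotentElem, ← B.op_mul _ _ (BddMeas.indicator hs) (BddMeas.indicator hs),
      indicator_mul_indicator, Set.inter_self]
  · refine ContinuousLinearMap.isSelfAdjoint_iff'.2 ?_
    refine ((ContinuousLinearMap.eq_adjoint_iff _ _).2 fun x y => ?_).symm
    rw [B.inner_op _ (BddMeas.indicator hs)]
    congr 3
    ext t
    by_cases h : t ∈ s <;> simp [h]

omit [CompleteSpace 𝓗] in
theorem hasSum_op_indicator {s : ℕ → Set X} (hs : ∀ n, MeasurableSet (s n))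
    (hd : Pairwise (Function.onFun Disjoint s)) (x : 𝓗) :
    HasSum (fun n => B.op ((s n).indicator 1) x) (B.op ((⋃ n, s n).indicator 1) x) := by
  have h1 : HasSum (fun n => (B.meas x).real (s n)) ((B.meas x).real (⋃ n, s n)) := by
    simp only [measureReal_def]
    rw [measure_iUnion hd hs, ENNReal.tsum_toReal_eq fun n => measure_ne_top (B.meas x) _]
    exact (ENNReal.hasSum_toReal (by
      rw [← measure_iUnion hd hs]; exact measure_ne_top (B.meas x) _))
  have h2 : ∀ F : Finset ℕ, ‖∑ n ∈ F, B.op ((s n).indicator 1) x - B.op ((⋃ n, s n).indicator 1) x‖ ^ 2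
      = (B.meas x).real (⋃ n, s n) - ∑ n ∈ F, (B.meas x).real (s n) := by
    intro F
    have hF : MeasurableSet (⋃ n ∈ F, s n) := F.measurableSet_biUnion fun n _ => hs n
    have hsub : (⋃ n ∈ F, s n) ⊆ ⋃ n, s n := Set.iUnion₂_subset fun n _ => Set.subset_iUnion s n
    have h3 : ∑ n ∈ F, (s n).indicator (1 : X → ℂ) = (⋃ n ∈ F, s n).indicator 1 := by
      rw [Finset.indicator_biUnion F s (fun i _ j _ hij => hd hij)]
      ext t
      simp
    have h4 : (⋃ n, s n).indicator (1 : X → ℂ) - (⋃ n ∈ F, s n).indicator 1 =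
        ((⋃ n, s n) \ (⋃ n ∈ F, s n)).indicator 1 := (Set.indicator_sdiff hsub _).symm
    have h5 : ∑ n ∈ F, B.op ((s n).indicator 1) x = B.op ((⋃ n ∈ F, s n).indicator 1) x := by
      rw [← h3, B.op_sum fun n => BddMeas.indicator (hs n), _root_.sum_apply]
    rw [h5, norm_sub_rev]
    rw [← _root_.sub_apply, ← B.op_sub (BddMeas.indicator (MeasurableSet.iUnion hs))
      (BddMeas.indicator hF), h4, B.norm_op_indicator_sq ((MeasurableSet.iUnion hs).diff hF),
      measureReal_sdiff hsub hF, measureReal_biUnion_finset (fun i _ j _ hij => hd hij) fun n _ => hs n]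
  have h6 : Tendsto (fun F : Finset ℕ => ‖∑ n ∈ F, B.op ((s n).indicator 1) x -
      B.op ((⋃ n, s n).indicator 1) x‖ ^ 2) atTop (𝓝 0) := by
    simp only [h2]
    simpa using (tendsto_const_nhds (x := (B.meas x).real (⋃ n, s n))).sub h1
  rw [HasSum, SummationFilter.unconditional_filter, tendsto_iff_norm_sub_tendsto_zero]
  have h7 := (Real.continuous_sqrt.tendsto 0).comp h6
  rw [Real.sqrt_zero] at h7
  refine h7.congr fun F => ?_
  exact Real.sqrt_sq (norm_nonneg _)

/-- The spectral measure of a Borel functional calculus on `ℝ`. -/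
def spectralMeasure (B : BorelCalculus ℝ 𝓗) : SpectralMeasure 𝓗 where
  proj s := B.op (s.indicator 1)
  isStarProjection s hs := B.isStarProjection_op_indicator hs
  proj_univ := by rw [Set.indicator_univ, op_one]
  proj_inter s t hs ht := by
    rw [← B.op_mul _ _ (BddMeas.indicator hs) (BddMeas.indicator ht), indicator_mul_indicator]
  hasSum s hs hd x := B.hasSum_op_indicator hs hd x

theorem measureAt_spectralMeasure (B : BorelCalculus ℝ 𝓗) (x : 𝓗) :
    B.spectralMeasure.measureAt x = B.meas x := by
  refine Measure.ext fun s hs => ?_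
  rw [SpectralMeasure.measureAt, Measure.ofMeasurable_apply s hs]
  change ENNReal.ofReal (‖B.op (s.indicator 1) x‖ ^ 2) = _
  rw [B.norm_op_indicator_sq hs, ofReal_measureReal]

theorem _root_.FrohlichDist.bddMeas_simpleFunc (g : SimpleFunc X ℂ) : BddMeas g :=
  ⟨g.measurable, g.exists_forall_norm_le⟩

theorem simpleIntegral_spectralMeasure (B : BorelCalculus ℝ 𝓗) (g : SimpleFunc ℝ ℂ) (x : 𝓗) :
    B.spectralMeasure.simpleIntegral g x = B.op g x := by
  have hi : ∀ c : ℂ, BddMeas ((g ⁻¹' {c}).indicator (1 : ℝ → ℂ)) := fun c =>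
    BddMeas.indicator (g.measurableSet_fiber c)
  have h1 : (g : ℝ → ℂ) = ∑ c ∈ g.range, c • (g ⁻¹' {c}).indicator (1 : ℝ → ℂ) := by
    ext t
    rw [Finset.sum_apply, Finset.sum_eq_single (g t)]
    · simp
    · intro c _ hc
      simp [hc.symm]
    · intro h
      exact absurd (g.mem_range_self t) h
  conv_rhs => rw [h1]
  rw [B.op_sum (f := fun c => c • (g ⁻¹' {c}).indicator (1 : ℝ → ℂ))
    fun c => (hi c).smul c, _root_.sum_apply]
  refine Finset.sum_congr rfl fun c _ => ?_
  rw [B.op_smul c (hi c)]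
  rfl

end BorelCalculus

end BorelCalculus

section BorelCalculus

open MeasureTheory Filter
open scoped ENNReal

variable {𝓗 : Type*} [NormedAddCommGroup 𝓗] [InnerProductSpace ℂ 𝓗]

/-- The indicator function of `[-n, n]`. -/
def cut (n : ℕ) : ℝ → ℂ := (Set.Icc (-(n : ℝ)) n).indicator 1

theorem bddMeas_cut (n : ℕ) : BddMeas (cut n) := BddMeas.indicator measurableSet_Icc

theorem cut_mul_cut (n : ℕ) : cut n * cut n = cut n := by
  rw [cut, BorelCalculus.indicator_mul_indicator, Set.inter_self]

theorem bddMeas_cut_mul (n : ℕ) {f : ℝ → ℂ} (hf : Continuous f) : BddMeas (cut n * f) := by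
  obtain ⟨C, hC⟩ := (isCompact_Icc (a := -(n : ℝ)) (b := n)).exists_bound_of_continuousOn
    hf.continuousOn
  refine ⟨(bddMeas_cut n).1.mul hf.measurable, |C|, fun t => ?_⟩
  by_cases h : t ∈ Set.Icc (-(n : ℝ)) n
  · simpa [cut, h] using (hC t h).trans (le_abs_self C)
  · simp [cut, h]

theorem norm_cut_le (n : ℕ) (t : ℝ) : ‖cut n t‖ ≤ 1 := by
  by_cases h : t ∈ Set.Icc (-(n : ℝ)) n <;> simp [cut, h]

theorem eventually_cut_eq (t : ℝ) : ∀ᶠ n : ℕ in atTop, cut n t = 1 := by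
  obtain ⟨N, hN⟩ := exists_nat_ge |t|
  filter_upwards [eventually_ge_atTop N] with n hn
  have h : t ∈ Set.Icc (-(n : ℝ)) n := by
    have : (N : ℝ) ≤ n := by exact_mod_cast hn
    exact abs_le.1 (hN.trans this)
  simp [cut, h]

theorem tendsto_eLpNorm_sub_cut_mul {μ : Measure ℝ} {f : ℝ → ℂ} (hf : MemLp f 2 μ) :
    Tendsto (fun n => eLpNorm (fun t => f t - cut n t * f t) 2 μ) atTop (𝓝 0) := by
  have h1 : ∀ n, eLpNorm (fun t => f t - cut n t * f t) 2 μ =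
      (∫⁻ t, ‖f t - cut n t * f t‖ₑ ^ (2 : ℝ) ∂μ) ^ (1 / (2 : ℝ)) := by
    intro n
    rw [eLpNorm_eq_lintegral_rpow_enorm_toReal two_ne_zero ENNReal.ofNat_ne_top]
    simp
  have h2 : Tendsto (fun n => ∫⁻ t, ‖f t - cut n t * f t‖ₑ ^ (2 : ℝ) ∂μ) atTop
      (𝓝 (∫⁻ _, 0 ∂μ)) := by
    refine tendsto_lintegral_of_dominated_convergence' (fun t => ‖f t‖ₑ ^ (2 : ℝ)) (fun n => ?_)
      (fun n => Eventually.of_forall fun t => ?_) ?_ (Eventually.of_forall fun t => ?_)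
    · exact ((hf.1.sub ((bddMeas_cut n).1.aestronglyMeasurable.mul hf.1)).enorm).pow_const _
    · change ‖f t - cut n t * f t‖ₑ ^ (2 : ℝ) ≤ ‖f t‖ₑ ^ (2 : ℝ)
      gcongr
      by_cases h : t ∈ Set.Icc (-(n : ℝ)) n <;> simp [cut, h]
    · have := lintegral_rpow_enorm_lt_top_of_eLpNorm_lt_top (p := 2) two_ne_zero
        ENNReal.ofNat_ne_top hf.2
      simpa using this.ne
    · refine tendsto_const_nhds.congr' ?_
      filter_upwards [eventually_cut_eq t] with n hn
      simp [hn]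
  have h3 := (ENNReal.continuous_rpow_const (y := 1 / (2 : ℝ))).tendsto 0
  rw [lintegral_zero] at h2
  have h4 := h3.comp h2
  simp only [one_div, ENNReal.zero_rpow_of_pos (show (0 : ℝ) < 2⁻¹ by norm_num)] at h4
  refine h4.congr fun n => ?_
  rw [h1, one_div]
  rfl

namespace BorelCalculus

theorem tendsto_op_cut (B : BorelCalculus ℝ 𝓗) (x : 𝓗) :
    Tendsto (fun n => B.op (cut n) x) atTop (𝓝 x) := by
  rw [tendsto_iff_edist_tendsto_0]
  have h := tendsto_eLpNorm_sub_cut_mul ((BddMeas.const 1).memLp (B.meas x))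
  refine h.congr fun n => ?_
  have h1 : x - B.op (cut n) x = B.op ((fun _ => 1) - cut n) x := by
    rw [B.op_sub (BddMeas.const 1) (bddMeas_cut n), B.op_const, one_smul]
    rfl
  rw [edist_comm, edist_eq_enorm_sub, h1, B.enorm_op _ ((BddMeas.const 1).sub (bddMeas_cut n))]
  congr 1
  ext t
  simp

variable [CompleteSpace 𝓗]

theorem hasIntegral_iff (B : BorelCalculus ℝ 𝓗) {f : ℝ → ℂ} (hf : Continuous f) (x y : 𝓗) :
    B.spectralMeasure.HasIntegral f x y ↔ ∀ n, B.op (cut n * f) x = B.op (cut n) y := by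
  rw [SpectralMeasure.HasIntegral, B.measureAt_spectralMeasure]
  simp only [B.simpleIntegral_spectralMeasure]
  set μ := B.meas x with hμ
  have hcut : ∀ n, BddMeas (cut n * f) := fun n => bddMeas_cut_mul n hf
  constructor
  · rintro ⟨hfL, g, hg, hgy⟩ n
    have h1 : Tendsto (fun k => B.op (cut n) (B.op (g k) x)) atTop (𝓝 (B.op (cut n) y)) :=
      ((B.op (cut n)).continuous.tendsto y).comp hgy
    have h2 : Tendsto (fun k => B.op (cut n) (B.op (g k) x)) atTop (𝓝 (B.op (cut n * f) x)) := by
      rw [tendsto_iff_edist_tendsto_0]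
      refine tendsto_of_tendsto_of_tendsto_of_le_of_le tendsto_const_nhds hg (fun _ => zero_le)
        fun k => ?_
      have h3 : B.op (cut n) (B.op (g k) x) - B.op (cut n * f) x =
          B.op (cut n * g k - cut n * f) x := by
        rw [B.op_sub ((bddMeas_cut n).mul (bddMeas_simpleFunc _)) (hcut n),
          B.op_mul _ _ (bddMeas_cut n) (bddMeas_simpleFunc _)]
        rfl
      change edist (B.op (cut n) (B.op (g k) x)) _ ≤ _
      rw [edist_eq_enorm_sub, h3, B.enorm_op _
        (((bddMeas_cut n).mul (bddMeas_simpleFunc _)).sub (hcut n))]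
      refine eLpNorm_mono fun t => ?_
      have h4 : (cut n * (g k : ℝ → ℂ) - cut n * f) t = -(cut n t * (f t - g k t)) := by
        simp only [Pi.sub_apply, Pi.mul_apply]; ring
      rw [h4, norm_neg, norm_mul]
      exact mul_le_of_le_one_left (norm_nonneg _) (norm_cut_le n t)
    exact tendsto_nhds_unique h2 h1
  · intro h
    have hy := B.tendsto_op_cut y
    have hfL : MemLp f 2 μ := by
      refine ⟨hf.aestronglyMeasurable, ?_⟩
      have h1 := Lp.eLpNorm_lim_le_liminf_eLpNorm (μ := μ) (p := 2) (f := fun n => cut n * f)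
        (fun n => (hcut n).1.aestronglyMeasurable) f (Eventually.of_forall fun t => by
          refine tendsto_const_nhds.congr' ?_
          filter_upwards [eventually_cut_eq t] with n hn
          simp [hn])
      have h2 : Tendsto (fun n => eLpNorm (cut n * f) 2 μ) atTop (𝓝 ‖y‖ₑ) := by
        refine hy.enorm.congr fun n => ?_
        rw [← h, B.enorm_op _ (hcut n)]
      rw [h2.liminf_eq] at h1
      exact h1.trans_lt enorm_lt_top
    refine ⟨hfL, ?_⟩
    have hpos : ∀ k : ℕ, ((k : ℝ≥0∞) + 1)⁻¹ ≠ 0 := fun k => by simp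
    choose g hg _ using fun k : ℕ =>
      hfL.exists_simpleFunc_eLpNorm_sub_lt ENNReal.ofNat_ne_top (hpos k)
    have hinv : Tendsto (fun k : ℕ => ((k : ℝ≥0∞) + 1)⁻¹) atTop (𝓝 0) := by
      have := (tendsto_add_atTop_iff_nat 1).2 ENNReal.tendsto_inv_nat_nhds_zero
      simpa using this
    have hg0 : Tendsto (fun k => eLpNorm (fun t => f t - g k t) 2 μ) atTop (𝓝 0) :=
      tendsto_of_tendsto_of_tendsto_of_le_of_le tendsto_const_nhds hinv (fun _ => zero_le)
        fun k => (hg k).le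
    refine ⟨g, hg0, ?_⟩
    have h1 : Tendsto (fun k => edist (B.op (g k) x) (B.op (cut k) y)) atTop (𝓝 0) := by
      have h2 := (tendsto_eLpNorm_sub_cut_mul hfL).add hg0
      rw [add_zero] at h2
      refine tendsto_of_tendsto_of_tendsto_of_le_of_le tendsto_const_nhds h2 (fun _ => zero_le)
        fun k => ?_
      change edist (B.op (g k) x) (B.op (cut k) y) ≤ _
      rw [← h, edist_eq_enorm_sub, ← _root_.sub_apply, ← B.op_sub (bddMeas_simpleFunc _) (hcut k),
        B.enorm_op _ ((bddMeas_simpleFunc _).sub (hcut k))]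
      have h3 : (g k : ℝ → ℂ) - cut k * f = (fun t => f t - cut k t * f t) - fun t => f t - g k t := by
        ext t; simp
      rw [h3]
      exact eLpNorm_sub_le (hfL.1.sub (hcut k).1.aestronglyMeasurable)
        (hfL.1.sub (g k).measurable.aestronglyMeasurable) one_le_two
    have h4 : Tendsto (fun k => B.op (g k) x - B.op (cut k) y) atTop (𝓝 0) := by
      rw [tendsto_iff_edist_tendsto_0]
      refine h1.congr fun k => ?_
      rw [edist_eq_enorm_sub, edist_eq_enorm_sub, sub_zero]
    simpa using h4.add hy

/-- If `B` is the functional calculus of an operator with graph `G` and resolvent `R = (A + i)⁻¹`, then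
its spectral measure is that of `A`. -/
theorem hasIntegral_id_iff (B : BorelCalculus ℝ 𝓗) {G : Set (𝓗 × 𝓗)} {R : 𝓗 →L[ℂ] 𝓗}
    (hR : ∀ x y, (x, y) ∈ G ↔ x = R (y + Complex.I • x))
    (h1 : ∀ f h : ℝ → ℂ, BddMeas f → BddMeas h → (∀ t, h t = ((t : ℂ) + Complex.I) * f t) →
      B.op h * R = B.op f ∧ R * B.op h = B.op f) (x y : 𝓗) :
    B.spectralMeasure.HasIntegral (fun t => (t : ℂ)) x y ↔ (x, y) ∈ G := by
  have hc : Continuous fun t : ℝ => (t : ℂ) := Complex.continuous_ofReal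
  rw [B.hasIntegral_iff hc, hR]
  have hb : ∀ n, BddMeas (cut n * fun t : ℝ => (t : ℂ)) := fun n => bddMeas_cut_mul n hc
  have hb2 : ∀ n, BddMeas (Complex.I • cut n) := fun n => (bddMeas_cut n).smul _
  have h2 := fun n => h1 (cut n) ((cut n * fun t : ℝ => (t : ℂ)) + Complex.I • cut n)
    (bddMeas_cut n) ((hb n).add (hb2 n)) fun t => by
      simp only [Pi.add_apply, Pi.mul_apply, Pi.smul_apply, smul_eq_mul]; ring
  have h3 : ∀ n z, B.op ((cut n * fun t : ℝ => (t : ℂ)) + Complex.I • cut n) z =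
      B.op (cut n * fun t : ℝ => (t : ℂ)) z + Complex.I • B.op (cut n) z := by
    intro n z
    rw [B.op_add _ _ (hb n) (hb2 n), B.op_smul _ (bddMeas_cut n)]
    rfl
  constructor
  · intro h
    have h4 : ∀ n, R (B.op (cut n) (y + Complex.I • x)) = B.op (cut n) x := by
      intro n
      rw [map_add, map_smul, ← h n, ← h3, ← (h2 n).2]
      rfl
    exact tendsto_nhds_unique (B.tendsto_op_cut x)
      ((((R.continuous.tendsto _).comp (B.tendsto_op_cut (y + Complex.I • x)))).congr h4)
  · intro h n
    have h4 : B.op ((cut n * fun t : ℝ => (t : ℂ)) + Complex.I • cut n) x =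
        B.op (cut n) (y + Complex.I • x) := by
      rw [← (h2 n).1]
      conv_lhs => rw [h]
      rfl
    rw [h3, map_add, map_smul] at h4
    exact add_right_cancel h4

/-- Solutions of `v' = A v` are given by the exponential function. -/
theorem hasIntegral_exp (B : BorelCalculus ℝ 𝓗) {v v' : ℝ → 𝓗} {a b : ℝ}
    (h0 : (0 : ℝ) ∈ Set.Ioo a b) (hv : ∀ s ∈ Set.Ioo a b, HasDerivAt v (v' s) s)
    (hA : ∀ s ∈ Set.Ioo a b, B.spectralMeasure.HasIntegral (fun t => (t : ℂ)) (v s) (v' s))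
    {s : ℝ} (hs : s ∈ Set.Ioo a b) :
    B.spectralMeasure.HasIntegral (fun t => ((Real.exp (s * t) : ℝ) : ℂ)) (v 0) (v s) := by
  have hc : Continuous fun t : ℝ => (t : ℂ) := Complex.continuous_ofReal
  have he : ∀ s : ℝ, Continuous fun t : ℝ => ((Real.exp (s * t) : ℝ) : ℂ) := fun s => by fun_prop
  rw [B.hasIntegral_iff (he s)]
  intro n
  set E : ℝ → (𝓗 →L[ℂ] 𝓗) := fun s => B.op (cut n * fun t : ℝ => ((Real.exp (s * t) : ℝ) : ℂ)) with hE
  have hEb : ∀ s : ℝ, BddMeas (cut n * fun t : ℝ => ((Real.exp (s * t) : ℝ) : ℂ)) :=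
    fun s => bddMeas_cut_mul n (he s)
  set Q : 𝓗 →L[ℂ] 𝓗 := B.op (cut n * fun t : ℝ => (t : ℂ)) with hQ
  have hQb : BddMeas (cut n * fun t : ℝ => (t : ℂ)) := bddMeas_cut_mul n hc
  have hE0 : E 0 = B.op (cut n) := by
    simp only [hE]; congr 1; ext t; simp
  have hcc : ∀ t, cut n t * cut n t = cut n t := fun t => congrFun (cut_mul_cut n) t
  have hEadd : ∀ s r, E (s + r) = E s * E r := by
    intro s r
    simp only [hE]
    rw [← B.op_mul _ _ (hEb s) (hEb r)]
    congr 1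
    ext t
    simp only [Pi.mul_apply]
    rw [add_mul, Real.exp_add, Complex.ofReal_mul]
    linear_combination -((Real.exp (s * t) : ℝ) : ℂ) * ((Real.exp (r * t) : ℝ) : ℂ) * hcc t
  have hEP : ∀ s, E s * B.op (cut n) = E s := by
    intro s
    rw [← hE0, ← hEadd, add_zero]
  have hEd0 : HasDerivAt E Q 0 := by
    rw [hasDerivAt_iff_isLittleO_nhds_zero]
    refine Asymptotics.IsBigO.trans_isLittleO (g := fun h : ℝ => h ^ 2) ?_ ?_
    · refine Asymptotics.IsBigO.of_bound ((n : ℝ) ^ 2) ?_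
      have : ∀ᶠ h : ℝ in 𝓝 0, |h| * n < 1 := by
        refine (Continuous.tendsto (by fun_prop) 0).eventually_lt_const ?_
        simp
      filter_upwards [this] with h hh
      have h1 : E (0 + h) - E 0 - h • Q = B.op ((cut n * fun t : ℝ => ((Real.exp (h * t) : ℝ) : ℂ)) -
          cut n - (h : ℂ) • (cut n * fun t : ℝ => (t : ℂ))) := by
        rw [B.op_sub ((hEb h).sub (bddMeas_cut n)) (hQb.smul _),
          B.op_sub (hEb h) (bddMeas_cut n), B.op_smul _ hQb, ← hE0, zero_add]
        rfl
      rw [h1]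
      refine B.norm_op_le (((hEb h).sub (bddMeas_cut n)).sub (hQb.smul _)).1
        (fun t => ?_) (by positivity)
      simp only [Pi.sub_apply, Pi.mul_apply, Pi.smul_apply, smul_eq_mul]
      by_cases ht : t ∈ Set.Icc (-(n : ℝ)) n
      · have htn : |t| ≤ n := abs_le.2 ht
        have h2 : |h * t| ≤ 1 := by
          rw [abs_mul]
          exact (mul_le_mul_of_nonneg_left htn (abs_nonneg h)).trans hh.le
        have h3 := Real.abs_exp_sub_one_sub_id_le h2
        have h4 : cut n t = 1 := by simp [cut, ht]
        have h5 : cut n t * ((Real.exp (h * t) : ℝ) : ℂ) - cut n t - h * (cut n t * (t : ℂ)) =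
            ((Real.exp (h * t) - 1 - h * t : ℝ) : ℂ) := by
          rw [h4]; push_cast; ring
        rw [h5, Complex.norm_real, Real.norm_eq_abs, Real.norm_eq_abs, abs_of_nonneg (sq_nonneg h)]
        calc |Real.exp (h * t) - 1 - h * t| ≤ (h * t) ^ 2 := h3
          _ = t ^ 2 * h ^ 2 := by ring
          _ ≤ (n : ℝ) ^ 2 * h ^ 2 := mul_le_mul_of_nonneg_right (sq_le_sq' ht.1 ht.2) (sq_nonneg h)
      · have h4 : cut n t = 0 := by simp [cut, ht]
        simp only [h4, zero_mul, mul_zero, sub_zero, norm_zero]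
        positivity
    · exact Asymptotics.isLittleO_pow_id one_lt_two
  have hEd : ∀ r, HasDerivAt E (E r * Q) r := by
    intro r
    have h1 : HasDerivAt (fun q => E r * E (q - r)) (E r * Q) r := by
      refine HasDerivAt.const_mul (E r) ?_
      have := HasDerivAt.comp_sub_const r r (f := E) (f' := Q) (by rwa [sub_self])
      exact this
    refine h1.congr_of_eventuallyEq (Eventually.of_forall fun q => ?_)
    change E q = E r * E (q - r)
    rw [← hEadd]
    congr 1
    ring
  have hQv : ∀ r ∈ Set.Ioo a b, Q (v r) = B.op (cut n) (v' r) := fun r hr =>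
    (B.hasIntegral_iff hc _ _).1 (hA r hr) n
  have hder : ∀ r ∈ Set.Ioo a b, HasDerivAt (fun r => E (-r) (v r)) 0 r := by
    intro r hr
    have h1 := ((ContinuousLinearMap.restrictScalarsL ℂ 𝓗 𝓗 ℝ ℝ).hasFDerivAt.comp_hasDerivAt r
      ((hEd (-r)).scomp r (hasDerivAt_neg r)))
    refine (h1.clm_apply (hv r hr)).congr_deriv ?_
    rw [neg_smul, one_smul]
    have h3 : E (-r) (B.op (cut n) (v' r)) = E (-r) (v' r) :=
      congrArg (fun T : 𝓗 →L[ℂ] 𝓗 => T (v' r)) (hEP (-r))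
    change -(E (-r) (Q (v r))) + E (-r) (v' r) = 0
    rw [hQv r hr, h3, neg_add_cancel]
  have hconst : E (-s) (v s) = E (-0) (v 0) :=
    (convex_Ioo a b).is_const_of_fderivWithin_eq_zero (𝕜 := ℝ) (f := fun r => E (-r) (v r))
      (fun r hr => (hder r hr).differentiableAt.differentiableWithinAt)
      (fun r hr => by
        rw [fderivWithin_eq_fderiv (isOpen_Ioo.uniqueDiffWithinAt hr)
          (hder r hr).differentiableAt]
        have := (hder r hr).hasFDerivAt.fderiv
        rw [this]
        ext
        simp) hs h0
  rw [neg_zero, hE0] at hconst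
  have h1 : E s (E (-s) (v s)) = B.op (cut n) (v s) := by
    have := hEadd s (-s)
    rw [add_neg_cancel, hE0] at this
    rw [this]
    rfl
  rw [hconst] at h1
  rw [← h1]
  exact (congrArg (fun T : 𝓗 →L[ℂ] 𝓗 => T (v 0)) (hEP s)).symm

end BorelCalculus

end BorelCalculus

section BorelCalculus

open MeasureTheory Filter

variable {𝓗 : Type*} [NormedAddCommGroup 𝓗] [InnerProductSpace ℂ 𝓗] [CompleteSpace 𝓗]

/-- The function `u ↦ (1 - u) / 2i` on the spectrum of the Cayley transform. -/
def resolventFun (s : Set ℂ) : C(s, ℂ) :=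
  ⟨fun u => (1 - (u : ℂ)) / (2 * Complex.I), by fun_prop⟩

/-- The inverse Cayley transform. -/
def invCayley (s : Set ℂ) (u : s) : ℝ := (resolventFun s u)⁻¹.re

theorem measurable_invCayley (s : Set ℂ) : Measurable (invCayley s) :=
  Complex.measurable_re.comp (resolventFun s).continuous.measurable.inv

theorem resolventFun_mul {s : Set ℂ} (hs : ∀ u ∈ s, ‖u‖ = 1) {u : s} (hu : (u : ℂ) ≠ 1) :
    ((invCayley s u : ℂ) + Complex.I) * resolventFun s u = 1 := by
  have h0 : (1 - (u : ℂ)) ≠ 0 := sub_ne_zero.2 (Ne.symm hu)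
  have h1 : resolventFun s u ≠ 0 := div_ne_zero h0 (by simp)
  have h2 : (u : ℂ) * conj (u : ℂ) = 1 := by
    rw [Complex.mul_conj, Complex.normSq_eq_norm_sq, hs u u.2]; simp
  have h3 : conj (u : ℂ) - 1 ≠ 0 := by
    intro h
    have : conj (u : ℂ) = conj 1 := by simpa [sub_eq_zero] using h
    exact hu ((starRingEnd ℂ).injective this)
  have h4 : (resolventFun s u)⁻¹ - Complex.I = conj ((resolventFun s u)⁻¹ - Complex.I) := by
    change (((1 - (u : ℂ)) / (2 * Complex.I))⁻¹ - Complex.I) =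
      conj (((1 - (u : ℂ)) / (2 * Complex.I))⁻¹ - Complex.I)
    have h5 : (1 - conj (u : ℂ)) ≠ 0 := by rw [← neg_sub]; exact neg_ne_zero.2 h3
    simp only [map_sub, map_div₀, map_mul, map_one, Complex.conj_I, map_ofNat, inv_div]
    field_simp
    linear_combination (-2 : ℂ) * h2
  have h5 : ((invCayley s u : ℝ) : ℂ) = (resolventFun s u)⁻¹ - Complex.I := by
    rw [Complex.conj_eq_iff_re.1 h4.symm |>.symm]
    simp [invCayley]
  rw [h5, sub_add_cancel, inv_mul_cancel₀ h1]

/-- The spectral theorem for a selfadjoint operator with graph `G`. -/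
theorem IsSymmGraph.exists_borelCalculus {G : Submodule ℂ (𝓗 × 𝓗)} (hG : IsSymmGraph G)
    (hd : NoDeficiency G) (hcl : IsClosed (G : Set (𝓗 × 𝓗))) (hgr : ∀ y, ((0 : 𝓗), y) ∈ G → y = 0) :
    ∃ B : BorelCalculus ℝ 𝓗, ∀ x y,
      B.spectralMeasure.HasIntegral (fun t => (t : ℂ)) x y ↔ (x, y) ∈ G := by
  obtain ⟨R, hR, hU⟩ := hG.exists_resolvent hd hcl
  set U : 𝓗 →L[ℂ] 𝓗 := 1 - (2 * Complex.I) • R with hUdef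
  have hUn : IsStarNormal U := ⟨by
    rw [commute_iff_eq, (Unitary.mem_iff.1 hU).1, (Unitary.mem_iff.1 hU).2]⟩
  set S := spectrum ℂ U with hS
  have hS1 : ∀ u ∈ S, ‖u‖ = 1 := fun u hu => by
    simpa using spectrum.subset_circle_of_unitary hU hu
  have : CompactSpace S := isCompact_iff_compactSpace.1 (spectrum.isCompact U)
  set ρ := resolventFun S with hρ
  let B₀ : BorelCalculus S 𝓗 := BorelCalculus.ofStarAlgHom (cfcHom hUn)
  have hB₀ : B₀.op ρ = R := by
    have h1 : cfcHom hUn ((ContinuousMap.id ℂ).restrict S) = U := cfcHom_id hUn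
    have h2 : ρ = (2 * Complex.I)⁻¹ • (1 - (ContinuousMap.id ℂ).restrict S) := by
      ext u
      simp [hρ, resolventFun, div_eq_inv_mul]
    have h3 : cfcHom hUn ρ = R := by
      rw [h2, map_smul, map_sub, map_one, h1, hUdef, sub_sub_cancel, smul_smul,
        inv_mul_cancel₀ (by simp), one_smul]
    rw [← h3]
    exact BorelCalculus.ofStarAlgHom_coe _ ρ
  have hρb : BddMeas ρ := bddMeas_coe ρ
  have hs1 : MeasurableSet {u : S | (u : ℂ) = 1} :=
    measurable_subtype_coe (measurableSet_singleton (1 : ℂ))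
  have hinj : ∀ y, R y = 0 → y = 0 := fun y hy => by
    refine hgr y ((hR 0 y).2 ?_)
    rw [smul_zero, add_zero, hy]
  have hnull : B₀.op ({u : S | (u : ℂ) = 1}.indicator 1) = 0 := by
    have h1 : (ρ : S → ℂ) * ({u : S | (u : ℂ) = 1}.indicator 1) = 0 := by
      ext u
      by_cases hu : (u : ℂ) = 1 <;> simp [hu, hρ, resolventFun]
    have h2 := B₀.op_mul _ _ hρb (BddMeas.indicator hs1)
    rw [h1, B₀.op_zero, hB₀] at h2
    ext y
    exact hinj _ (congrArg (fun T : 𝓗 →L[ℂ] 𝓗 => T y) h2.symm)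
  have hcongr : ∀ f g : S → ℂ, BddMeas f → BddMeas g → (∀ u : S, (u : ℂ) ≠ 1 → f u = g u) →
      B₀.op f = B₀.op g := by
    intro f g hf hg hfg
    have h1 : f - g = (f - g) * ({u : S | (u : ℂ) = 1}.indicator 1) := by
      ext u
      by_cases hu : (u : ℂ) = 1
      · simp [hu]
      · simp [hu, hfg u hu]
    have h2 := B₀.op_mul _ _ (hf.sub hg) (BddMeas.indicator hs1)
    rw [hnull, mul_zero, ← h1, B₀.op_sub hf hg] at h2
    exact sub_eq_zero.1 h2
  have hκ := measurable_invCayley S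
  refine ⟨B₀.map hκ, (B₀.map hκ).hasIntegral_id_iff hR fun f h hf hh hfh => ?_⟩
  have hpt : ∀ u : S, (u : ℂ) ≠ 1 → ρ u * h (invCayley S u) = f (invCayley S u) := by
    intro u hu
    rw [hfh, ← mul_assoc, mul_comm (ρ u), resolventFun_mul hS1 hu, one_mul]
  constructor
  · change B₀.op (h ∘ invCayley S) * R = B₀.op (f ∘ invCayley S)
    rw [← hB₀, ← B₀.op_mul _ _ (hh.comp hκ) hρb]
    refine hcongr _ _ ((hh.comp hκ).mul hρb) (hf.comp hκ) fun u hu => ?_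
    rw [Pi.mul_apply, mul_comm]
    exact hpt u hu
  · change R * B₀.op (h ∘ invCayley S) = B₀.op (f ∘ invCayley S)
    rw [← hB₀, ← B₀.op_mul _ _ hρb (hh.comp hκ)]
    exact hcongr _ _ (hρb.mul (hh.comp hκ)) (hf.comp hκ) hpt

end BorelCalculus

section PartialDerivatives

variable {E : Type*} [NormedAddCommGroup E] [NormedSpace ℝ E]
  {G : Type*} [NormedAddCommGroup G] [NormedSpace ℝ G]

variable (E G) in
/-- The restriction of linear maps on `ℝ × E` to `E`. -/
def restrictSnd : (ℝ × E →L[ℝ] G) →L[ℝ] (E →L[ℝ] G) :=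
  ContinuousLinearMap.precomp G (ContinuousLinearMap.inr ℝ ℝ E)

theorem contDiffOn_restrictSnd {g : ℝ × E → ℝ × E →L[ℝ] G} {W : Set (ℝ × E)}
    (hg : ContDiffOn ℝ ∞ g W) :
    ContDiffOn ℝ ∞ (fun p => (g p).comp (ContinuousLinearMap.inr ℝ ℝ E)) W :=
  (restrictSnd E G).contDiff.comp_contDiffOn hg

theorem hasDerivAt_restrictSnd {g : ℝ → ℝ × E →L[ℝ] G} {g' : ℝ × E →L[ℝ] G} {t : ℝ}
    (hg : HasDerivAt g g' t) :
    HasDerivAt (fun s => (g s).comp (ContinuousLinearMap.inr ℝ ℝ E))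
      (g'.comp (ContinuousLinearMap.inr ℝ ℝ E)) t :=
  (restrictSnd E G).hasFDerivAt.comp_hasDerivAt t hg

theorem fderiv_snd_eq {f : ℝ × E → G} {p : ℝ × E} (hf : DifferentiableAt ℝ f p) :
    fderiv ℝ (fun y => f (p.1, y)) p.2 = (fderiv ℝ f p).comp (ContinuousLinearMap.inr ℝ ℝ E) := by
  have h1 : HasFDerivAt (fun y : E => (p.1, y)) (ContinuousLinearMap.inr ℝ ℝ E) p.2 :=
    hasFDerivAt_prodMk_right p.1 p.2
  exact (HasFDerivAt.comp p.2 (g := f) (f := fun y : E => (p.1, y)) hf.hasFDerivAt h1).fderiv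

theorem hasDerivAt_fst {f : ℝ × E → G} {p : ℝ × E} (hf : DifferentiableAt ℝ f p) :
    HasDerivAt (fun s => f (s, p.2)) (fderiv ℝ f p (1, 0)) p.1 := by
  have h1 : HasDerivAt (fun s : ℝ => (s, p.2)) ((1 : ℝ), (0 : E)) p.1 :=
    (hasDerivAt_id p.1).prodMk (hasDerivAt_const _ _)
  exact HasFDerivAt.comp_hasDerivAt p.1 (l := f) hf.hasFDerivAt h1

variable {f : ℝ × E → G} {W : Set (ℝ × E)}

theorem contDiffOn_iteratedFDeriv_snd (hW : IsOpen W) (hf : ContDiffOn ℝ ∞ f W) (j : ℕ) :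
    ContDiffOn ℝ ∞ (fun p : ℝ × E => iteratedFDeriv ℝ j (fun y => f (p.1, y)) p.2) W := by
  induction j with
  | zero =>
    exact (continuousMultilinearCurryFin0 ℝ E G).symm.contDiff.comp_contDiffOn hf
  | succ j ih =>
    set g := fun p : ℝ × E => iteratedFDeriv ℝ j (fun y => f (p.1, y)) p.2 with hg
    have h1 : ContDiffOn ℝ ∞ (fun p => (fderiv ℝ g p).comp (ContinuousLinearMap.inr ℝ ℝ E)) W :=
      contDiffOn_restrictSnd (G := ContinuousMultilinearMap ℝ (fun _ : Fin j => E) G)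
        (ih.fderiv_of_isOpen (m := ∞) hW (by simp))
    have h2 := ((continuousMultilinearCurryLeftEquiv ℝ (fun _ : Fin (j + 1) => E)
      G).symm.contDiff (n := ∞)).comp_contDiffOn h1
    refine h2.congr fun p hp => ?_
    have h3 := fderiv_snd_eq ((ih.contDiffAt (hW.mem_nhds hp)).differentiableAt (by simp))
    change _ = (continuousMultilinearCurryLeftEquiv ℝ (fun _ : Fin (j + 1) => E) G).symm
      ((fderiv ℝ g p).comp (ContinuousLinearMap.inr ℝ ℝ E))
    rw [← h3]
    rfl

theorem fderiv_iteratedFDeriv_snd (hW : IsOpen W) (hf : ContDiffOn ℝ ∞ f W) (j : ℕ) : ∀ p ∈ W,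
    fderiv ℝ (fun p : ℝ × E => iteratedFDeriv ℝ j (fun y => f (p.1, y)) p.2) p (1, 0) =
      iteratedFDeriv ℝ j (fun y => fderiv ℝ f (p.1, y) (1, 0)) p.2 := by
  induction j with
  | zero =>
    intro p hp
    have h1 := hasDerivAt_fst ((contDiffOn_iteratedFDeriv_snd hW hf 0).contDiffAt
      (hW.mem_nhds hp) |>.differentiableAt (by simp))
    have h2 := hasDerivAt_fst ((hf.contDiffAt (hW.mem_nhds hp)).differentiableAt (by simp))
    have h3 := ((continuousMultilinearCurryFin0 ℝ E G).symm.toContinuousLinearEquiv.hasFDerivAt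
      (x := f (p.1, p.2))).comp_hasDerivAt p.1 h2
    exact h1.unique h3
  | succ j ih =>
    intro p hp
    set g := fun p : ℝ × E => iteratedFDeriv ℝ j (fun y => f (p.1, y)) p.2 with hg
    have hgs : ContDiffOn ℝ ∞ g W := contDiffOn_iteratedFDeriv_snd hW hf j
    have hgp := hgs.contDiffAt (hW.mem_nhds hp)
    set ι := (continuousMultilinearCurryLeftEquiv ℝ (fun _ : Fin (j + 1) => E) G).symm with hι
    have hsucc : ∀ q ∈ W, iteratedFDeriv ℝ (j + 1) (fun y => f (q.1, y)) q.2 =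
        ι ((fderiv ℝ g q).comp (ContinuousLinearMap.inr ℝ ℝ E)) := by
      intro q hq
      rw [← fderiv_snd_eq ((hgs.contDiffAt (hW.mem_nhds hq)).differentiableAt (by simp))]
      rfl
    have h1 := hasDerivAt_fst ((contDiffOn_iteratedFDeriv_snd hW hf (j + 1)).contDiffAt
      (hW.mem_nhds hp) |>.differentiableAt (by simp))
    have hd2 : DifferentiableAt ℝ (fderiv ℝ g) p :=
      ((hgs.fderiv_of_isOpen (m := ∞) hW (by simp)).contDiffAt (hW.mem_nhds hp)).differentiableAt
        (by simp)
    have h2 := (ι.toContinuousLinearEquiv.hasFDerivAt).comp_hasDerivAt p.1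
      (hasDerivAt_restrictSnd (G := ContinuousMultilinearMap ℝ (fun _ : Fin j => E) G)
        (hasDerivAt_fst (G := ℝ × E →L[ℝ] ContinuousMultilinearMap ℝ (fun _ : Fin j => E) G) hd2))
    have hev : ∀ᶠ s in 𝓝 p.1, (s, p.2) ∈ W :=
      (Continuous.tendsto (f := fun s : ℝ => (s, p.2)) (by fun_prop) p.1).eventually
        (hW.mem_nhds hp)
    have h3 := h1.unique (h2.congr_of_eventuallyEq (hev.mono fun s hs => hsucc (s, p.2) hs))
    rw [h3]
    have h4 : iteratedFDeriv ℝ (j + 1) (fun y => fderiv ℝ f (p.1, y) (1, 0)) p.2 =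
        ι (fderiv ℝ (iteratedFDeriv ℝ j (fun y => fderiv ℝ f (p.1, y) (1, 0))) p.2) := rfl
    rw [h4]
    change ι _ = _
    congr 1
    have hev2 : ∀ᶠ y in 𝓝 p.2, (p.1, y) ∈ W :=
      (Continuous.tendsto (f := fun y : E => (p.1, y)) (by fun_prop) p.2).eventually
        (hW.mem_nhds hp)
    have h5 : iteratedFDeriv ℝ j (fun y => fderiv ℝ f (p.1, y) (1, 0)) =ᶠ[𝓝 p.2]
        fun y => fderiv ℝ g (p.1, y) (1, 0) := hev2.mono fun y hy => (ih (p.1, y) hy).symm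
    rw [h5.fderiv_eq]
    have h6 : DifferentiableAt ℝ (fun q => fderiv ℝ g q (1, 0)) p :=
      hd2.clm_apply (differentiableAt_const _)
    rw [fderiv_snd_eq (f := fun q => fderiv ℝ g q (1, 0)) h6]
    ext1 v
    have h7 : fderiv ℝ (fun q => fderiv ℝ g q (1, 0)) p (0, v) =
        fderiv ℝ (fderiv ℝ g) p (0, v) (1, 0) := by
      have := (hd2.hasFDerivAt.clm_apply (hasFDerivAt_const ((1 : ℝ), (0 : E)) p)).fderiv
      rw [this]
      simp
    have h8 : IsSymmSndFDerivAt ℝ g p := hgp.isSymmSndFDerivAt (by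
      rw [minSmoothness_of_isRCLikeNormedField]; exact WithTop.coe_le_coe.2 le_top)
    change fderiv ℝ (fderiv ℝ g) p (1, 0) (0, v) = fderiv ℝ (fun q => fderiv ℝ g q (1, 0)) p (0, v)
    rw [h7]
    exact h8 _ _

/-- The difference quotients in the first variable converge uniformly on compact sets, together with
their derivatives. -/
theorem eventually_norm_iteratedFDeriv_sub_le (hW : IsOpen W) (hf : ContDiffOn ℝ ∞ f W) {s₀ : ℝ}
    {L : Set E} (hL : IsCompact L) (hLW : ∀ y ∈ L, (s₀, y) ∈ W) (j : ℕ) {ε : ℝ} (hε : 0 < ε) :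
    ∀ᶠ s in 𝓝 s₀, ∀ y ∈ L, ‖iteratedFDeriv ℝ j (fun y => f (s, y)) y -
      iteratedFDeriv ℝ j (fun y => f (s₀, y)) y -
      (s - s₀) • iteratedFDeriv ℝ j (fun y => fderiv ℝ f (s₀, y) (1, 0)) y‖ ≤ ε * |s - s₀| := by
  set g := fun p : ℝ × E => iteratedFDeriv ℝ j (fun y => f (p.1, y)) p.2 with hg
  have hgs : ContDiffOn ℝ ∞ g W := contDiffOn_iteratedFDeriv_snd hW hf j
  set h := fun p : ℝ × E => fderiv ℝ g p (1, 0) with hh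
  have hhc : ContinuousOn h W :=
    ((hgs.continuousOn_fderiv_of_isOpen hW (by simp)).clm_apply continuousOn_const)
  have h1 : ∀ᶠ s in 𝓝 s₀, ∀ y ∈ L, (s, y) ∈ W ∧ ‖h (s, y) - h (s₀, y)‖ < ε := by
    refine hL.eventually_forall_of_forall_eventually fun y hy => ?_
    have hW' : W ∈ 𝓝 (s₀, y) := hW.mem_nhds (hLW y hy)
    have hc := hhc.continuousAt hW'
    have hc2 : ContinuousAt (fun q : ℝ × E => h (s₀, q.2)) (s₀, y) :=
      ContinuousAt.comp (g := h) (f := fun q : ℝ × E => (s₀, q.2)) (x := (s₀, y)) hc (by fun_prop)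
    have hc3 := (hc.sub hc2).norm
    filter_upwards [hW', hc3.eventually_lt_const (by simpa using hε)] with q hq1 hq2
    exact ⟨hq1, hq2⟩
  obtain ⟨r, hr, hball⟩ := Metric.eventually_nhds_iff_ball.1 h1
  filter_upwards [Metric.ball_mem_nhds s₀ hr] with s hs y hy
  have hd : ∀ q ∈ Metric.ball s₀ r, HasDerivWithinAt
      (fun q => g (q, y) - (q - s₀) • h (s₀, y)) (h (q, y) - h (s₀, y)) (Metric.ball s₀ r) q := by
    intro q hq
    have h2 := hasDerivAt_fst (p := (q, y)) (f := g)
      ((hgs.contDiffAt (hW.mem_nhds (hball q hq y hy).1)).differentiableAt (by simp))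
    have h3 : HasDerivAt (fun q : ℝ => (q - s₀) • h (s₀, y)) ((1 : ℝ) • h (s₀, y)) q :=
      HasDerivAt.smul_const (F := ContinuousMultilinearMap ℝ (fun _ : Fin j => E) G)
        ((hasDerivAt_id q).sub_const s₀) _
    rw [one_smul] at h3
    exact (h2.sub h3).hasDerivWithinAt
  have h4 := (convex_ball s₀ r).norm_image_sub_le_of_norm_hasDerivWithin_le hd
    (fun q hq => (hball q hq y hy).2.le) (Metric.mem_ball_self hr) hs
  rw [sub_self, zero_smul, sub_zero, Real.norm_eq_abs] at h4
  have h5 := fderiv_iteratedFDeriv_snd hW hf j (s₀, y) (hLW y hy)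
  refine le_trans (le_of_eq ?_) h4
  rw [← h5]
  congr 1
  abel

end PartialDerivatives

section SmoothFamilies

variable {E : Type*} [NormedAddCommGroup E] [NormedSpace ℝ E]
  {H : Type*} [TopologicalSpace H] {I : ModelWithCorners ℝ E H}
  {M : Type*} [TopologicalSpace M] [ChartedSpace H M]

/-- `F s` is a family of test functions depending smoothly on `s ∈ 𝒥`, with derivative `F'`. -/
structure SmoothFamily (𝒥 : Set ℝ) (F F' : ℝ → smoothCc I M) : Prop where
  smooth : ContMDiffOn (𝓘(ℝ, ℝ).prod I) 𝓘(ℝ, ℂ) ∞ (fun p : ℝ × M => (F p.1 : M → ℂ) p.2)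
    (𝒥 ×ˢ Set.univ)
  deriv : ∀ s ∈ 𝒥, ∀ x, HasDerivAt (fun s => (F s : M → ℂ) x) ((F' s : M → ℂ) x) s
  supp : ∀ s ∈ 𝒥, ∃ C : Set M, IsCompact C ∧ ∀ᶠ r in 𝓝 s, tsupport (F r : M → ℂ) ⊆ C

theorem SmoothFamily.contDiffOn_chart [I.Boundaryless] [IsManifold I ∞ M] {𝒥 : Set ℝ}
    {F F' : ℝ → smoothCc I M} (hF : SmoothFamily 𝒥 F F') (x : M) :
    ContDiffOn ℝ ∞ (fun p : ℝ × E => (F p.1 : M → ℂ) ((extChartAt I x).symm p.2))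
      (𝒥 ×ˢ (extChartAt I x).target) := by
  rw [← contMDiffOn_iff_contDiffOn]
  have h1 : ContMDiffOn 𝓘(ℝ, ℝ × E) 𝓘(ℝ, ℝ) ∞ (fun p : ℝ × E => p.1)
      (𝒥 ×ˢ (extChartAt I x).target) := contDiff_fst.contMDiff.contMDiffOn
  have h2 : ContMDiffOn 𝓘(ℝ, ℝ × E) I ∞ (fun p : ℝ × E => (extChartAt I x).symm p.2)
      (𝒥 ×ˢ (extChartAt I x).target) :=
    (contMDiffOn_extChartAt_symm x).comp contDiff_snd.contMDiff.contMDiffOn fun p hp => hp.2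
  exact hF.smooth.comp (h1.prodMk h2) fun p hp => ⟨hp.1, Set.mem_univ _⟩

theorem SmoothFamily.hasDerivAt_apply [I.Boundaryless] [IsManifold I ∞ M] [T2Space M]
    {u : smoothCc I M →ₗ⋆[ℂ] ℂ} (hu : IsDistribution u) {𝒥 : Set ℝ} (h𝒥 : IsOpen 𝒥)
    {F F' : ℝ → smoothCc I M} (hF : SmoothFamily 𝒥 F F') {s₀ : ℝ} (hs₀ : s₀ ∈ 𝒥) :
    HasDerivAt (fun s => u (F s)) (u (F' s₀)) s₀ := by
  obtain ⟨C, hC, hFC⟩ := hF.supp s₀ hs₀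
  obtain ⟨n, k, x, L, c, hL, hbound⟩ := hu C hC
  have hsupp : ∀ s, tsupport (F s : M → ℂ) ⊆ C → ∀ y, y ∉ C → (F s : M → ℂ) y = 0 := fun s hs y hy =>
    image_eq_zero_of_notMem_tsupport fun h => hy (hs h)
  have hF'C : ∀ y, y ∉ C → (F' s₀ : M → ℂ) y = 0 := by
    intro y hy
    refine (hF.deriv s₀ hs₀ y).unique ?_
    refine (hasDerivAt_const s₀ (0 : ℂ)).congr_of_eventuallyEq ?_
    filter_upwards [hFC] with s hs using hsupp s hs y hy
  rw [hasDerivAt_iff_isLittleO, Asymptotics.isLittleO_iff]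
  intro ε hε
  set f : Fin n → ℝ × E → ℂ := fun i p => (F p.1 : M → ℂ) ((extChartAt I (x i)).symm p.2) with hf
  have hfs : ∀ i, ContDiffOn ℝ ∞ (f i) (𝒥 ×ˢ (extChartAt I (x i)).target) := fun i =>
    hF.contDiffOn_chart (x i)
  have hW : ∀ i, IsOpen (𝒥 ×ˢ (extChartAt I (x i)).target) := fun i =>
    h𝒥.prod (isOpen_extChartAt_target (x i))
  set δ := ε / (|c| + 1) with hδ
  have hδ0 : 0 < δ := by positivity
  have hev : ∀ᶠ s in 𝓝 s₀, ∀ i : Fin n, ∀ j ∈ Finset.range (k + 1), ∀ y ∈ L i,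
      ‖iteratedFDeriv ℝ j (fun y => f i (s, y)) y - iteratedFDeriv ℝ j (fun y => f i (s₀, y)) y -
      (s - s₀) • iteratedFDeriv ℝ j (fun y => fderiv ℝ (f i) (s₀, y) (1, 0)) y‖ ≤ δ * |s - s₀| := by
    refine Filter.eventually_all.2 fun i => (Filter.eventually_all_finset _).2 fun j _ => ?_
    exact eventually_norm_iteratedFDeriv_sub_le (hW i) (hfs i) (hL i).1
      (fun y hy => ⟨hs₀, (hL i).2 hy⟩) j hδ0
  filter_upwards [hev, hFC, h𝒥.mem_nhds hs₀] with s hs hsC hs𝒥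
  set D : smoothCc I M := F s - F s₀ - ((s - s₀ : ℝ) : ℂ) • F' s₀ with hD
  have huD : u (F s) - u (F s₀) - (s - s₀) • u (F' s₀) = u D := by
    rw [hD, map_sub, map_sub, LinearMap.map_smulₛₗ, Complex.conj_ofReal]
    rfl
  rw [huD]
  have hDC : tsupport (D : M → ℂ) ⊆ C := by
    refine closure_minimal (fun y hy => ?_) hC.isClosed
    by_contra hyC
    refine hy ?_
    change (F s : M → ℂ) y - (F s₀ : M → ℂ) y - ((s - s₀ : ℝ) : ℂ) * (F' s₀ : M → ℂ) y = 0
    rw [hsupp s hsC y hyC, hsupp s₀ hFC.self_of_nhds y hyC, hF'C y hyC]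
    simp
  have h1 := hbound D hDC (δ * |s - s₀|) (by positivity) fun i j hj y hy => by
    have hyt := (hL i).2 hy
    refine le_trans (le_of_eq ?_) (hs i j (Finset.mem_range.2 (Nat.lt_succ_of_le hj)) y hy)
    congr 1
    have hslice : ∀ r ∈ 𝒥, ContDiffAt ℝ j (fun y => f i (r, y)) y := fun r hr =>
      (((hfs i).contDiffAt ((hW i).mem_nhds ⟨hr, hyt⟩)).comp y
        (contDiffAt_const.prodMk contDiffAt_id)).of_le (by exact_mod_cast le_top)
    have hfd : ContDiffAt ℝ j (fun y => fderiv ℝ (f i) (s₀, y) (1, 0)) y := by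
      have h2 : ContDiffOn ℝ ∞ (fderiv ℝ (f i)) _ := (hfs i).fderiv_of_isOpen (hW i) (by simp)
      have h3 := (h2.contDiffAt ((hW i).mem_nhds ⟨hs₀, hyt⟩)).comp y
        (contDiffAt_const.prodMk contDiffAt_id : ContDiffAt ℝ ∞ (fun y => (s₀, y)) y)
      exact (h3.clm_apply contDiffAt_const).of_le (by exact_mod_cast le_top)
    have hDe : (D : M → ℂ) ∘ (extChartAt I (x i)).symm =ᶠ[𝓝 y]
        (((fun y => f i (s, y)) - fun y => f i (s₀, y)) -
          (s - s₀) • fun y => fderiv ℝ (f i) (s₀, y) (1, 0)) := by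
      filter_upwards [(isOpen_extChartAt_target (x i)).mem_nhds hyt] with z hz
      have h4 : fderiv ℝ (f i) (s₀, z) (1, 0) = (F' s₀ : M → ℂ) ((extChartAt I (x i)).symm z) :=
        (hasDerivAt_fst (p := (s₀, z)) (((hfs i).contDiffAt ((hW i).mem_nhds
          ⟨hs₀, hz⟩)).differentiableAt (by simp))).unique
          (hF.deriv s₀ hs₀ ((extChartAt I (x i)).symm z))
      change (F s : M → ℂ) _ - (F s₀ : M → ℂ) _ - ((s - s₀ : ℝ) : ℂ) * (F' s₀ : M → ℂ) _ = _
      simp only [Pi.sub_apply, Pi.smul_apply, h4]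
      rfl
    have hdiff : ContDiffAt ℝ j ((fun y => f i (s, y)) - fun y => f i (s₀, y)) y :=
      (hslice s hs𝒥).sub (hslice s₀ hs₀)
    have hsm : ContDiffAt ℝ j ((s - s₀) • fun y => fderiv ℝ (f i) (s₀, y) (1, 0)) y :=
      hfd.const_smul (s - s₀)
    rw [(hDe.iteratedFDeriv ℝ j).self_of_nhds, iteratedFDeriv_sub_apply hdiff hsm,
      iteratedFDeriv_sub_apply (hslice s hs𝒥) (hslice s₀ hs₀), iteratedFDeriv_const_smul_apply hfd]
  refine h1.trans ?_
  rw [Real.norm_eq_abs, ← mul_assoc]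
  refine mul_le_mul_of_nonneg_right ?_ (abs_nonneg _)
  calc c * δ ≤ (|c| + 1) * δ := by
        refine mul_le_mul_of_nonneg_right ?_ hδ0.le
        linarith [le_abs_self c]
    _ = ε := by rw [hδ]; field_simp

theorem tsupport_tensor_subset {φ ψ : smoothCc I M} {C D : Set M} (hC : IsClosed C) (hD : IsClosed D)
    (hφ : tsupport (φ : M → ℂ) ⊆ C) (hψ : tsupport (ψ : M → ℂ) ⊆ D) :
    tsupport (tensor φ ψ : M × M → ℂ) ⊆ C ×ˢ D := by
  refine closure_minimal (fun p hp => ?_) (hC.prod hD)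
  exact ⟨hφ (subset_tsupport _ (left_ne_zero_of_mul hp)),
    hψ (subset_tsupport _ (right_ne_zero_of_mul hp))⟩

theorem tsupport_conjFun (φ : smoothCc I M) :
    tsupport (conjFun φ : M → ℂ) = tsupport (φ : M → ℂ) := by
  rw [tsupport, tsupport]
  congr 1
  ext x
  simp [conjFun]

theorem SmoothFamily.tensor_conj [T2Space M] {𝒥 : Set ℝ} {F F' G G' : ℝ → smoothCc I M}
    (hF : SmoothFamily 𝒥 F F') (hG : SmoothFamily 𝒥 G G') :
    SmoothFamily 𝒥 (fun s => tensor (conjFun (F s)) (G s))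
      (fun s => tensor (conjFun (F' s)) (G s) + tensor (conjFun (F s)) (G' s)) where
  smooth := by
    have h1 : ContMDiffOn (𝓘(ℝ, ℝ).prod (I.prod I)) (𝓘(ℝ, ℝ).prod I) ∞
        (fun p : ℝ × (M × M) => (p.1, p.2.1)) (𝒥 ×ˢ Set.univ) :=
      (contMDiff_fst.prodMk (contMDiff_fst.comp contMDiff_snd)).contMDiffOn
    have h2 : ContMDiffOn (𝓘(ℝ, ℝ).prod (I.prod I)) (𝓘(ℝ, ℝ).prod I) ∞
        (fun p : ℝ × (M × M) => (p.1, p.2.2)) (𝒥 ×ˢ Set.univ) :=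
      (contMDiff_fst.prodMk (contMDiff_snd.comp contMDiff_snd)).contMDiffOn
    have h3 := hF.smooth.comp h1 fun p hp => ⟨hp.1, Set.mem_univ _⟩
    have h4 := hG.smooth.comp h2 fun p hp => ⟨hp.1, Set.mem_univ _⟩
    have hmul : ContDiff ℝ ∞ (fun p : ℂ × ℂ => p.1 * p.2) := contDiff_mul
    exact hmul.contMDiff.comp_contMDiffOn
      (((Complex.conjCLE.contDiff : ContDiff ℝ ∞ Complex.conjCLE).contMDiff.comp_contMDiffOn h3).prodMk_space h4)
  deriv s hs p := by
    have h1 := (Complex.conjCLE.hasFDerivAt.comp_hasDerivAt s (hF.deriv s hs p.1)).mul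
      (hG.deriv s hs p.2)
    exact h1
  supp s hs := by
    obtain ⟨C, hC, hFC⟩ := hF.supp s hs
    obtain ⟨D, hD, hGD⟩ := hG.supp s hs
    refine ⟨C ×ˢ D, hC.prod hD, ?_⟩
    filter_upwards [hFC, hGD] with r hr hr'
    exact tsupport_tensor_subset hC.isClosed hD.isClosed ((tsupport_conjFun _).trans_subset hr) hr'

theorem SmoothFamily.const {𝒥 : Set ℝ} (ψ : smoothCc I M) :
    SmoothFamily 𝒥 (fun _ => ψ) (fun _ => 0) where
  smooth := (ψ.2.1.comp contMDiff_snd).contMDiffOn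
  deriv _ _ _ := hasDerivAt_const _ _
  supp _ _ := ⟨_, ψ.2.2, Filter.Eventually.of_forall fun _ => subset_rfl⟩

theorem SmoothFamily.neg {𝒥 : Set ℝ} {F F' : ℝ → smoothCc I M} (h : SmoothFamily 𝒥 F F') :
    SmoothFamily 𝒥 (fun s => -F s) (fun s => -F' s) where
  smooth := (contDiff_neg (𝕜 := ℝ) (F := ℂ)).contMDiff.comp_contMDiffOn h.smooth
  deriv s hs x := (h.deriv s hs x).neg
  supp s hs := by
    obtain ⟨C, hC, hF⟩ := h.supp s hs
    refine ⟨C, hC, hF.mono fun r hr => ?_⟩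
    have : tsupport ((-F r : smoothCc I M) : M → ℂ) = tsupport (F r : M → ℂ) := by
      rw [tsupport, tsupport]
      congr 1
      exact Function.support_neg _
    rwa [this]

theorem norm_le_of_inner_vec_le (K : PosDefDistribution I M) {w : HilbertSpace K} {B : ℝ} (hB : 0 ≤ B)
    (h : ∀ ψ, ‖(inner ℂ (vec K ψ) w : ℂ)‖ ≤ B * ‖vec K ψ‖) : ‖w‖ ≤ B := by
  have h1 : ∀ v : HilbertSpace K, ‖(inner ℂ v w : ℂ)‖ ≤ B * ‖v‖ := fun v =>
    (denseRange_vec K).induction_on v (isClosed_le (by fun_prop) (by fun_prop)) h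
  have h2 := h1 w
  rw [inner_self_eq_norm_sq_to_K, norm_pow, norm_algebraMap', norm_norm, sq] at h2
  rcases (norm_nonneg w).eq_or_lt with h0 | h0
  · rwa [← h0]
  · exact le_of_mul_le_mul_right h2 h0

variable [IsManifold I ∞ M] [I.Boundaryless] [T2Space M] (K : PosDefDistribution I M)

theorem SmoothFamily.hasDerivAt_inner_vec {𝒥 : Set ℝ} (h𝒥 : IsOpen 𝒥) {F F' G G' : ℝ → smoothCc I M}
    (hF : SmoothFamily 𝒥 F F') (hG : SmoothFamily 𝒥 G G') {s : ℝ} (hs : s ∈ 𝒥) :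
    HasDerivAt (fun s => (inner ℂ (vec K (F s)) (vec K (G s)) : ℂ))
      (inner ℂ (vec K (F s)) (vec K (G' s)) + inner ℂ (vec K (F' s)) (vec K (G s))) s := by
  have h := (hG.tensor_conj hF).hasDerivAt_apply K.isDistribution h𝒥 hs
  simp only [inner_vec]
  rw [map_add] at h
  exact h

theorem SmoothFamily.eventually_norm_vec_le {𝒥 : Set ℝ} (h𝒥 : IsOpen 𝒥) {F F' : ℝ → smoothCc I M}
    (hF : SmoothFamily 𝒥 F F') {s : ℝ} (hs : s ∈ 𝒥) :
    ∃ B : ℝ, 0 ≤ B ∧ ∀ᶠ r in 𝓝 s, ‖vec K (F r)‖ ≤ B := by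
  have h1 := (Complex.continuous_re.continuousAt.comp
    (hF.hasDerivAt_inner_vec K h𝒥 hF hs).continuousAt)
  have h2 : ∀ r, (inner ℂ (vec K (F r)) (vec K (F r)) : ℂ).re = ‖vec K (F r)‖ ^ 2 := fun r =>
    inner_self_eq_norm_sq (𝕜 := ℂ) _
  have h3 : ContinuousAt (fun r => √(‖vec K (F r)‖ ^ 2)) s := by
    refine Real.continuous_sqrt.continuousAt.comp (f := fun r => ‖vec K (F r)‖ ^ 2) ?_
    simpa only [Function.comp_def, h2] using h1
  simp only [Real.sqrt_sq (norm_nonneg _)] at h3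
  refine ⟨‖vec K (F s)‖ + 1, by positivity, ?_⟩
  exact (h3.eventually_lt_const (lt_add_one _)).mono fun r hr => hr.le

/-- The vectors `K_{F s}` depend differentiably on `s`. -/
theorem SmoothFamily.hasDerivAt_vec {𝒥 : Set ℝ} (h𝒥 : IsOpen 𝒥) {F F' F'' : ℝ → smoothCc I M}
    (hF : SmoothFamily 𝒥 F F') (hF' : SmoothFamily 𝒥 F' F'') {s₀ : ℝ} (hs₀ : s₀ ∈ 𝒥)
    (hF'' : ∃ B : ℝ, 0 ≤ B ∧ ∀ᶠ r in 𝓝 s₀, ‖vec K (F'' r)‖ ≤ B) :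
    HasDerivAt (fun s => vec K (F s)) (vec K (F' s₀)) s₀ := by
  obtain ⟨B, hB0, hB⟩ := hF''
  obtain ⟨r, hr, hball⟩ := Metric.eventually_nhds_iff_ball.1 (hB.and (h𝒥.mem_nhds hs₀))
  have hweak : ∀ {F F' : ℝ → smoothCc I M}, SmoothFamily 𝒥 F F' → ∀ ψ, ∀ q ∈ 𝒥,
      HasDerivAt (fun s => (inner ℂ (vec K ψ) (vec K (F s)) : ℂ))
        (inner ℂ (vec K ψ) (vec K (F' q))) q := by
    intro F F' hF ψ q hq
    have := (SmoothFamily.const (𝒥 := 𝒥) ψ).hasDerivAt_inner_vec K h𝒥 hF hq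
    rwa [map_zero, inner_zero_left, add_zero] at this
  have h1 : ∀ s ∈ Metric.ball s₀ r, ∀ ψ,
      ‖(inner ℂ (vec K ψ) (vec K (F' s) - vec K (F' s₀)) : ℂ)‖ ≤ B * ‖vec K ψ‖ * |s - s₀| := by
    intro s hs ψ
    have h2 := (convex_ball s₀ r).norm_image_sub_le_of_norm_hasDerivWithin_le
      (fun q hq => (hweak hF' ψ q (hball q hq).2).hasDerivWithinAt)
      (C := B * ‖vec K ψ‖) (fun q hq => by
        rw [mul_comm]
        exact (norm_inner_le_norm _ _).trans
          (mul_le_mul_of_nonneg_left (hball q hq).1 (norm_nonneg _))) (Metric.mem_ball_self hr) hs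
    rw [inner_sub_right]
    exact h2
  have h3 : ∀ s ∈ Metric.ball s₀ r,
      ‖vec K (F s) - vec K (F s₀) - (s - s₀) • vec K (F' s₀)‖ ≤ B * |s - s₀| * |s - s₀| := by
    intro s hs
    refine norm_le_of_inner_vec_le K (by positivity) fun ψ => ?_
    have hsub : Metric.closedBall s₀ |s - s₀| ⊆ Metric.ball s₀ r :=
      Metric.closedBall_subset_ball (by simpa [Real.dist_eq] using hs)
    have h4 := (convex_closedBall s₀ |s - s₀|).norm_image_sub_le_of_norm_hasDerivWithin_le
      (f := fun q : ℝ => (inner ℂ (vec K ψ) (vec K (F q)) : ℂ) -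
        (q - s₀) • (inner ℂ (vec K ψ) (vec K (F' s₀)) : ℂ))
      (f' := fun q => (inner ℂ (vec K ψ) (vec K (F' q) - vec K (F' s₀)) : ℂ))
      (C := B * ‖vec K ψ‖ * |s - s₀|) (x := s₀) (y := s) (fun q hq => by
        refine HasDerivAt.hasDerivWithinAt ?_
        have h5 := ((hasDerivAt_id q).sub_const s₀).smul_const
          (inner ℂ (vec K ψ) (vec K (F' s₀)) : ℂ)
        rw [one_smul] at h5
        rw [inner_sub_right]
        exact (hweak hF ψ q (hball q (hsub hq)).2).sub h5)
      (fun q hq => by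
        refine (h1 q (hsub hq) ψ).trans ?_
        have : |q - s₀| ≤ |s - s₀| := hq
        gcongr)
      (Metric.mem_closedBall_self (abs_nonneg _)) (by simp [Real.dist_eq])
    have h6 : (inner ℂ (vec K ψ) (vec K (F s) - vec K (F s₀) - (s - s₀) • vec K (F' s₀)) : ℂ) =
        (inner ℂ (vec K ψ) (vec K (F s)) - (s - s₀) • (inner ℂ (vec K ψ) (vec K (F' s₀)) : ℂ)) -
        (inner ℂ (vec K ψ) (vec K (F s₀)) - (s₀ - s₀) • (inner ℂ (vec K ψ) (vec K (F' s₀)) : ℂ)) := by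
      rw [sub_self, zero_smul, sub_zero, inner_sub_right, inner_sub_right, inner_smul_right_eq_smul]
      ring
    rw [h6]
    refine h4.trans (le_of_eq ?_)
    rw [Real.norm_eq_abs]
    ring
  rw [hasDerivAt_iff_isLittleO]
  refine Asymptotics.IsBigO.trans_isLittleO (g := fun s : ℝ => ‖s - s₀‖ ^ 2) ?_ ?_
  · refine Asymptotics.IsBigO.of_bound B ?_
    filter_upwards [Metric.ball_mem_nhds s₀ hr] with s hs
    refine (h3 s hs).trans (le_of_eq ?_)
    rw [norm_pow, norm_norm, Real.norm_eq_abs, sq, mul_assoc]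
  · exact Asymptotics.isLittleO_pow_sub_sub s₀ one_lt_two

end SmoothFamilies

section Flow

variable {E : Type*} [NormedAddCommGroup E] [NormedSpace ℝ E]
  {H : Type*} [TopologicalSpace H] {I : ModelWithCorners ℝ E H}
  {M : Type*} [TopologicalSpace M] [ChartedSpace H M] [IsManifold I ∞ M]
  {X : SmoothField I M}

theorem contMDiff_one_section (X : SmoothField I M) :
    ContMDiff I I.tangent 1 (fun x => (⟨x, X x⟩ : TangentBundle I M)) :=
  X.contMDiff.of_le (by simp)

theorem hasDerivAt_comp_curve {g : M → ℂ} {γ : ℝ → M} {t : ℝ}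
    (hg : MDifferentiableAt I 𝓘(ℝ, ℂ) g (γ t))
    (hγ : HasMFDerivAt 𝓘(ℝ, ℝ) I γ t ((1 : ℝ →L[ℝ] ℝ).smulRight (X (γ t)))) :
    HasDerivAt (fun r => g (γ r)) (derivAlong X g (γ t)) t := by
  have h := hg.hasMFDerivAt.comp t hγ
  set L : ℝ →L[ℝ] ℂ := (mfderiv I 𝓘(ℝ, ℂ) g (γ t)).comp
    ((1 : ℝ →L[ℝ] ℝ).smulRight (X (γ t))) with hL
  have h2 : HasFDerivAt (fun r => g (γ r)) L t := hasMFDerivAt_iff_hasFDerivAt.1 h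
  refine h2.hasDerivAt.congr_deriv ?_
  change mfderiv I 𝓘(ℝ, ℂ) g (γ t) (((1 : ℝ →L[ℝ] ℝ) 1) • X (γ t)) = _
  rw [one_apply_eq_self, one_smul]
  rfl

theorem IsLocalFlow.hasMFDerivAt {𝒟 : Set (ℝ × M)} {Φ : ℝ → M → M} (h : IsLocalFlow I 𝒟 Φ)
    (hv : ∀ x, HasMFDerivAt 𝓘(ℝ, ℝ) I (fun t => Φ t x) 0
      ((1 : ℝ →L[ℝ] ℝ).smulRight (X (Φ 0 x)))) {t : ℝ} {x : M} (ht : (t, x) ∈ 𝒟) :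
    HasMFDerivAt 𝓘(ℝ, ℝ) I (fun t => Φ t x) t ((1 : ℝ →L[ℝ] ℝ).smulRight (X (Φ t x))) := by
  have h0 : Φ 0 (Φ t x) = Φ t x := h.map_zero _
  have h1 := hv (Φ t x)
  have hsub : HasMFDerivAt 𝓘(ℝ, ℝ) 𝓘(ℝ, ℝ) (fun r : ℝ => r - t) t (ContinuousLinearMap.id ℝ ℝ) :=
    ((hasFDerivAt_id t).sub_const t).hasMFDerivAt
  have h2 : HasMFDerivAt 𝓘(ℝ, ℝ) I (fun r => Φ (r - t) (Φ t x)) t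
      ((1 : ℝ →L[ℝ] ℝ).smulRight (X (Φ 0 (Φ t x)))) := by
    have h1' : HasMFDerivAt 𝓘(ℝ, ℝ) I (fun r => Φ r (Φ t x)) (t - t)
      ((1 : ℝ →L[ℝ] ℝ).smulRight (X (Φ 0 (Φ t x)))) := by rw [sub_self]; exact h1
    exact HasMFDerivAt.comp (f := fun r : ℝ => r - t) t h1' hsub
  rw [h0] at h2
  refine h2.congr_of_eventuallyEq ?_
  have e1 : ∀ᶠ r in 𝓝 t, (r, x) ∈ 𝒟 :=
    (Continuous.prodMk_left x).continuousAt.preimage_mem_nhds (h.isOpen.mem_nhds ht)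
  have e2 : ∀ᶠ r in 𝓝 t, (r - t, Φ t x) ∈ 𝒟 := by
    have hc : Continuous fun r : ℝ => (r - t, Φ t x) := by fun_prop
    refine hc.continuousAt.preimage_mem_nhds (h.isOpen.mem_nhds ?_)
    simpa using h.zero_mem (Φ t x)
  filter_upwards [e1, e2] with r hr hr'
  rw [h.map_add t (r - t) x ht hr' (by simpa using hr), add_sub_cancel]

section Uniqueness

variable [I.Boundaryless] [T2Space M]

theorem eq_of_isMIntegralCurveOn {γ γ' : ℝ → M} {a b a' b' t : ℝ}
    (hγ : IsMIntegralCurveOn (I := I) γ (fun y => X y) (Set.Ioo a b))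
    (hγ' : IsMIntegralCurveOn (I := I) γ' (fun y => X y) (Set.Ioo a' b'))
    (h0 : (0 : ℝ) ∈ Set.Ioo a b) (h0' : (0 : ℝ) ∈ Set.Ioo a' b') (h : γ 0 = γ' 0)
    (ht : t ∈ Set.Ioo a b) (ht' : t ∈ Set.Ioo a' b') : γ t = γ' t := by
  have hi : Set.Ioo (max a a') (min b b') = Set.Ioo a b ∩ Set.Ioo a' b' := Set.Ioo_inter_Ioo.symm
  refine isMIntegralCurveOn_Ioo_eqOn_of_contMDiff_boundaryless (t₀ := 0) (a := max a a')
    (b := min b b') (v := fun y => X y) (hi ▸ ⟨h0, h0'⟩)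
    (contMDiff_one_section X) (hγ.mono (hi ▸ Set.inter_subset_left))
    (hγ'.mono (hi ▸ Set.inter_subset_right)) h (hi ▸ ⟨ht, ht'⟩)

theorem IsFlowLine.maxFlow_eq {t : ℝ} {x : M} {γ : ℝ → M} (h : IsFlowLine X t x γ) :
    maxFlow X t x = γ t := by
  have hex : ∃ γ, IsFlowLine X t x γ := ⟨γ, h⟩
  rw [maxFlow, dif_pos hex]
  obtain ⟨h1, a, b, h0, ht, hc⟩ := hex.choose_spec
  obtain ⟨h1', a', b', h0', ht', hc'⟩ := h
  exact eq_of_isMIntegralCurveOn hc hc' h0 h0' (h1.trans h1'.symm) ht ht'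

/-- An integral curve through `γ s` is a part of the maximal one. -/
theorem mem_flowDomain_of_curve {γ : ℝ → M} {a b s t : ℝ}
    (hγ : IsMIntegralCurveOn (I := I) γ (fun y => X y) (Set.Ioo a b)) (hs : s ∈ Set.Ioo a b)
    (ht : s + t ∈ Set.Ioo a b) :
    (t, γ s) ∈ flowDomain X ∧ maxFlow X t (γ s) = γ (s + t) := by
  have h : IsFlowLine X t (γ s) (γ ∘ (· + s)) := by
    refine ⟨by simp, a - s, b - s, ⟨by linarith [hs.1], by linarith [hs.2]⟩,
      ⟨by linarith [ht.1], by linarith [ht.2]⟩, ?_⟩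
    refine (hγ.comp_add s).mono fun r hr => ?_
    exact ⟨by linarith [hr.1], by linarith [hr.2]⟩
  refine ⟨⟨_, h⟩, ?_⟩
  rw [h.maxFlow_eq, Function.comp_apply, add_comm]

theorem exists_curve {p : ℝ × M} (hp : p ∈ flowDomain X) :
    ∃ (a b : ℝ), 0 ∈ Set.Ioo a b ∧ p.1 ∈ Set.Ioo a b ∧
      (∀ t ∈ Set.Ioo a b, (t, p.2) ∈ flowDomain X) ∧ maxFlow X 0 p.2 = p.2 ∧
      IsMIntegralCurveOn (I := I) (fun t => maxFlow X t p.2) (fun y => X y) (Set.Ioo a b) := by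
  obtain ⟨γ, h1, a, b, h0, ht, hγ⟩ := hp
  have h2 : ∀ t ∈ Set.Ioo a b, (t, p.2) ∈ flowDomain X ∧ maxFlow X t p.2 = γ t := by
    intro t ht
    have := mem_flowDomain_of_curve hγ h0 (t := t) (by rwa [zero_add])
    rwa [h1, zero_add] at this
  refine ⟨a, b, h0, ht, fun t ht => (h2 t ht).1, (h2 0 h0).2.trans h1, ?_⟩
  intro t ht
  have h3 := hγ t ht
  rw [← (h2 t ht).2] at h3
  exact h3.congr_of_eventuallyEq (Filter.eventually_of_mem self_mem_nhdsWithin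
    fun r hr => (h2 r hr).2) (h2 t ht).2

theorem maxFlow_add {s t : ℝ} {x : M} (hs : (s, x) ∈ flowDomain X)
    (ht : (t, maxFlow X s x) ∈ flowDomain X) :
    (s + t, x) ∈ flowDomain X ∧ maxFlow X (s + t) x = maxFlow X t (maxFlow X s x) := by
  obtain ⟨a, b, h0, hs', hd, hz, hγ⟩ := exists_curve hs
  obtain ⟨a', b', h0', ht', hd', hz', hγ'⟩ := exists_curve ht
  simp only at h0 hs' hd hz hγ h0' ht' hd' hz' hγ'
  have hγs : IsMIntegralCurveOn (I := I) ((fun t => maxFlow X t (maxFlow X s x)) ∘ (· + -s))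
      (fun y => X y) (Set.Ioo (a' + s) (b' + s)) := by
    refine (hγ'.comp_add (-s)).mono fun r hr => ?_
    exact ⟨by linarith [hr.1], by linarith [hr.2]⟩
  have hmem : s ∈ Set.Ioo a b ∩ Set.Ioo (a' + s) (b' + s) :=
    ⟨hs', by linarith [h0'.1], by linarith [h0'.2]⟩
  have heq : maxFlow X s x = ((fun t => maxFlow X t (maxFlow X s x)) ∘ (· + -s)) s := by
    simp [hz']
  have hglue := isMIntegralCurveOn_piecewise (v := fun y => X y) (contMDiff_one_section X)
    hγ hγs hmem heq
  have hag := eqOn_piecewise_of_isMIntegralCurveOn_Ioo (v := fun y => X y) (contMDiff_one_section X)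
    hγ hγs hmem heq
  set δ := Set.piecewise (Set.Ioo a b) (fun t => maxFlow X t x)
    ((fun t => maxFlow X t (maxFlow X s x)) ∘ (· + -s)) with hδ
  rw [Set.Ioo_union_Ioo' (hmem.2.1.trans hs'.2) (hs'.1.trans hmem.2.2)] at hglue
  have h0'' : (0 : ℝ) ∈ Set.Ioo (min a (a' + s)) (max b (b' + s)) :=
    ⟨(min_le_left _ _).trans_lt h0.1, h0.2.trans_le (le_max_left _ _)⟩
  have hst : s + t ∈ Set.Ioo (a' + s) (b' + s) := ⟨by linarith [ht'.1], by linarith [ht'.2]⟩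
  have hres := mem_flowDomain_of_curve hglue h0'' (t := s + t)
    (by rw [zero_add]; exact ⟨(min_le_right _ _).trans_lt hst.1, hst.2.trans_le (le_max_right _ _)⟩)
  have hδ0 : δ 0 = x := by rw [hδ, Set.piecewise_eq_of_mem _ _ _ h0]; exact hz
  rw [hδ0, zero_add] at hres
  refine ⟨hres.1, hres.2.trans ?_⟩
  have := hag hst
  simpa using this

theorem maxFlow_neg {s : ℝ} {x : M} (hs : (s, x) ∈ flowDomain X) :
    (-s, maxFlow X s x) ∈ flowDomain X ∧ maxFlow X (-s) (maxFlow X s x) = x := by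
  obtain ⟨a, b, h0, hs', hd, hz, hγ⟩ := exists_curve hs
  have h := mem_flowDomain_of_curve hγ hs' (t := -s) (by simpa using h0)
  simpa [hz] using h

theorem hasMFDerivAt_maxFlow {t : ℝ} {x : M} (h : (t, x) ∈ flowDomain X) :
    HasMFDerivAt 𝓘(ℝ, ℝ) I (fun t => maxFlow X t x) t
      ((1 : ℝ →L[ℝ] ℝ).smulRight (X (maxFlow X t x))) := by
  obtain ⟨a, b, h0, ht, hd, hz, hγ⟩ := exists_curve h
  exact (hγ t ht).hasMFDerivAt (Ioo_mem_nhds ht.1 ht.2)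

theorem IsLocallyIntegrable.exists_box (hX : IsLocallyIntegrable X) (x₀ : M) :
    ∃ δ : ℝ, 0 < δ ∧ ∃ U : Set M, IsOpen U ∧ x₀ ∈ U ∧
      Set.Ioo (-δ) δ ×ˢ U ⊆ flowDomain X ∧
      ContMDiffOn (𝓘(ℝ, ℝ).prod I) I ∞ (fun p : ℝ × M => maxFlow X p.1 p.2)
        (Set.Ioo (-δ) δ ×ˢ U) := by
  obtain ⟨𝒟, Φ, hΦ, hv⟩ := hX
  obtain ⟨W, hW, U, hU, hWU⟩ := mem_nhds_prod_iff.1 (hΦ.isOpen.mem_nhds (hΦ.zero_mem x₀))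
  obtain ⟨δ, hδ, hδW⟩ := Metric.mem_nhds_iff.1 hW
  rw [Real.ball_eq_Ioo, zero_sub, zero_add] at hδW
  obtain ⟨U', hU'U, hU'o, hxU'⟩ := mem_nhds_iff.1 hU
  have hbox : Set.Ioo (-δ) δ ×ˢ U' ⊆ 𝒟 := (Set.prod_mono hδW hU'U).trans hWU
  have h0 : (0 : ℝ) ∈ Set.Ioo (-δ) δ := ⟨by linarith, hδ⟩
  have key : ∀ p ∈ Set.Ioo (-δ) δ ×ˢ U', p ∈ flowDomain X ∧ maxFlow X p.1 p.2 = Φ p.1 p.2 := by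
    rintro ⟨t, x⟩ ⟨ht, hx⟩
    have hc : IsMIntegralCurveOn (I := I) (fun t => Φ t x) (fun y => X y) (Set.Ioo (-δ) δ) :=
      fun r hr => (hΦ.hasMFDerivAt hv (hbox ⟨hr, hx⟩)).hasMFDerivWithinAt
    have := mem_flowDomain_of_curve hc h0 (t := t) (by rwa [zero_add])
    simpa [hΦ.map_zero] using this
  exact ⟨δ, hδ, U', hU'o, hxU', fun p hp => (key p hp).1,
    (hΦ.smooth.mono hbox).congr fun p hp => (key p hp).2⟩

/-- The maximal local flow has an open domain and is smooth. -/
theorem IsLocallyIntegrable.smooth_maxFlow (hX : IsLocallyIntegrable X) {p : ℝ × M}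
    (hp : p ∈ flowDomain X) :
    flowDomain X ∈ 𝓝 p ∧
      ContMDiffAt (𝓘(ℝ, ℝ).prod I) I ∞ (fun p : ℝ × M => maxFlow X p.1 p.2) p := by
  obtain ⟨t, x⟩ := p
  obtain ⟨a, b, h0, ht, hd, hz, hγ⟩ := exists_curve hp
  simp only at h0 ht hd hz hγ
  set F := fun p : ℝ × M => maxFlow X p.1 p.2 with hF
  set G : ℝ → Prop := fun t => flowDomain X ∈ 𝓝 (t, x) ∧ ContMDiffAt (𝓘(ℝ, ℝ).prod I) I ∞ F (t, x)
    with hG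
  have hopen : ∀ (δ : ℝ) {U : Set M}, IsOpen U → IsOpen (Set.Ioo (-δ) δ ×ˢ U) := fun δ U hU =>
    isOpen_Ioo.prod hU
  have hstep : ∀ (δ : ℝ) (U : Set M), IsOpen U → Set.Ioo (-δ) δ ×ˢ U ⊆ flowDomain X →
      ContMDiffOn (𝓘(ℝ, ℝ).prod I) I ∞ F (Set.Ioo (-δ) δ ×ˢ U) → ∀ s s' : ℝ,
      maxFlow X s x ∈ U → s' - s ∈ Set.Ioo (-δ) δ → G s → G s' := by
    rintro δ U hU hbox hsm s s' hsU hss ⟨hs1, hs2⟩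
    set σ : ℝ × M → ℝ × M := fun q => (q.1 - (s' - s), q.2) with hσ
    have hσs : σ (s', x) = (s, x) := by simp [hσ]
    have hσc : ContinuousAt σ (s', x) := by fun_prop
    have e1 : ∀ᶠ q in 𝓝 (s', x), σ q ∈ flowDomain X := by
      refine hσc.preimage_mem_nhds ?_
      rwa [hσs]
    have e2 : ∀ᶠ q in 𝓝 (s', x), F (σ q) ∈ U := by
      have : ContinuousAt F (σ (s', x)) := by rw [hσs]; exact hs2.continuousAt
      refine (this.comp hσc).preimage_mem_nhds (hU.mem_nhds ?_)
      simpa [hσs] using hsU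
    have e3 : ∀ᶠ q in 𝓝 (s', x), q ∈ flowDomain X ∧ F q = F (s' - s, F (σ q)) := by
      filter_upwards [e1, e2] with q hq1 hq2
      have := maxFlow_add hq1 (hbox ⟨hss, hq2⟩)
      rwa [sub_add_cancel] at this
    refine ⟨e3.mono fun q hq => hq.1, ?_⟩
    refine ContMDiffAt.congr_of_eventuallyEq ?_ (e3.mono fun q hq => hq.2)
    have hσsm : ContMDiffAt (𝓘(ℝ, ℝ).prod I) (𝓘(ℝ, ℝ).prod I) ∞ σ (s', x) := by
      refine ContMDiffAt.prodMk ?_ contMDiffAt_snd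
      have : ContDiff ℝ ∞ fun r : ℝ => r - (s' - s) := contDiff_id.sub contDiff_const
      exact (this.contMDiff.comp contMDiff_fst).contMDiffAt
    have h5 : ContMDiffAt (𝓘(ℝ, ℝ).prod I) I ∞ (fun q => F (σ q)) (s', x) := by
      refine ContMDiffAt.comp (s', x) (g := F) ?_ hσsm
      rwa [hσs]
    have h6 : ContMDiffAt (𝓘(ℝ, ℝ).prod I) I ∞ F (s' - s, F (σ (s', x))) := by
      refine hsm.contMDiffAt ((hopen δ hU).mem_nhds ⟨hss, ?_⟩)
      rw [hσs]
      exact hsU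
    exact h6.comp (s', x) (f := fun q => (s' - s, F (σ q))) (contMDiffAt_const.prodMk h5)
  have hG0 : G 0 := by
    obtain ⟨δ, hδ, U, hU, hxU, hbox, hsm⟩ := hX.exists_box x
    have hmem : ((0 : ℝ), x) ∈ Set.Ioo (-δ) δ ×ˢ U := ⟨⟨by simpa using hδ, hδ⟩, hxU⟩
    have hn := (hopen δ hU).mem_nhds hmem
    exact ⟨Filter.mem_of_superset hn hbox, hsm.contMDiffAt hn⟩
  have hconn := (isPreconnected_Ioo (a := a) (b := b)).induction₂ (fun s s' => G s ↔ G s')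
    (fun τ hτ => by
      obtain ⟨δ, hδ, U, hU, hxU, hbox, hsm⟩ := hX.exists_box (maxFlow X τ x)
      have hc : ContinuousAt (fun t => maxFlow X t x) τ :=
        (hγ.continuousWithinAt hτ).continuousAt (Ioo_mem_nhds hτ.1 hτ.2)
      refine nhdsWithin_le_nhds ?_
      filter_upwards [hc.preimage_mem_nhds (hU.mem_nhds hxU), Metric.ball_mem_nhds τ hδ] with s hs hsδ
      rw [Metric.mem_ball, Real.dist_eq, abs_lt] at hsδ
      exact ⟨hstep δ U hU hbox hsm τ s hxU hsδ,
        hstep δ U hU hbox hsm s τ hs ⟨by linarith [hsδ.2], by linarith [hsδ.1]⟩⟩)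
    (fun _ _ _ _ _ _ h h' => h.trans h') (fun _ _ _ _ h => h.symm) h0 ht
  exact hconn.1 hG0

end Uniqueness
end Flow

section Transport

variable {E : Type*} [NormedAddCommGroup E] [NormedSpace ℝ E]
  {H : Type*} [TopologicalSpace H] {I : ModelWithCorners ℝ E H}
  {M : Type*} [TopologicalSpace M] [ChartedSpace H M] [IsManifold I ∞ M]
  {X : SmoothField I M}

theorem tsupport_lieDeriv_subset (X : SmoothField I M) (φ : smoothCc I M) :
    tsupport (lieDeriv X φ : M → ℂ) ⊆ tsupport (φ : M → ℂ) := by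
  refine closure_minimal (fun x hx => ?_) (isClosed_tsupport _)
  by_contra h
  exact hx (derivAlong_eq_zero X h)

theorem prod_tsupport_lieDeriv_subset {φ : smoothCc I M} {𝒥 : Set ℝ}
    (hφ : 𝒥 ×ˢ tsupport (φ : M → ℂ) ⊆ flowDomain X) :
    𝒥 ×ˢ tsupport (lieDeriv X φ : M → ℂ) ⊆ flowDomain X :=
  (Set.prod_mono subset_rfl (tsupport_lieDeriv_subset X φ)).trans hφ

variable [I.Boundaryless] [T2Space M]

theorem IsLocallyIntegrable.isOpen_flowDomain (hX : IsLocallyIntegrable X) :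
    IsOpen (flowDomain X) :=
  isOpen_iff_mem_nhds.2 fun _ hp => (hX.smooth_maxFlow hp).1

theorem IsLocallyIntegrable.continuousOn_maxFlow (hX : IsLocallyIntegrable X) :
    ContinuousOn (fun p : ℝ × M => maxFlow X p.1 p.2) (flowDomain X) := fun _ hp =>
  (hX.smooth_maxFlow hp).2.continuousAt.continuousWithinAt

theorem IsLocallyIntegrable.zero_mem (hX : IsLocallyIntegrable X) (x : M) :
    ((0 : ℝ), x) ∈ flowDomain X ∧ maxFlow X 0 x = x := by
  obtain ⟨δ, hδ, U, hU, hxU, hbox, -⟩ := hX.exists_box x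
  have h : ((0 : ℝ), x) ∈ flowDomain X := hbox ⟨⟨by simpa using hδ, hδ⟩, hxU⟩
  obtain ⟨a, b, -, -, -, hz, -⟩ := exists_curve h
  exact ⟨h, hz⟩

theorem mem_of_pullbackFlow_ne_zero {f : M → ℂ} {s : ℝ} {x : M}
    (h : pullbackFlow X (-s) f x ≠ 0) :
    (-s, x) ∈ flowDomain X ∧ maxFlow X (-s) x ∈ tsupport f ∧
      (s, maxFlow X (-s) x) ∈ flowDomain X ∧ maxFlow X s (maxFlow X (-s) x) = x := by
  have h1 : (-s, x) ∈ flowDomain X := by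
    by_contra hn
    exact h (if_neg hn)
  rw [pullbackFlow, if_pos h1] at h
  have h2 := maxFlow_neg h1
  rw [neg_neg] at h2
  exact ⟨h1, subset_tsupport f h, h2⟩

section

variable {C : Set M} {𝒥 : Set ℝ} {s : ℝ}

/-- The flow-out of a compact set for a compact neighbourhood of times. -/
theorem IsLocallyIntegrable.exists_compact_nhds (hX : IsLocallyIntegrable X) (hC : IsCompact C)
    (h𝒥 : IsOpen 𝒥) (hCJ : 𝒥 ×ˢ C ⊆ flowDomain X) (hs : s ∈ 𝒥) :
    ∃ J₀ ∈ 𝓝 s, IsCompact ((fun p : ℝ × M => (p.1, maxFlow X p.1 p.2)) '' (J₀ ×ˢ C)) := by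
  obtain ⟨J₀, hJ₀, hJ₀𝒥, hc⟩ := local_compact_nhds (h𝒥.mem_nhds hs)
  refine ⟨J₀, hJ₀, (hc.prod hC).image_of_continuousOn ?_⟩
  exact continuous_fst.continuousOn.prodMk
    (hX.continuousOn_maxFlow.mono ((Set.prod_mono hJ₀𝒥 subset_rfl).trans hCJ))

theorem IsLocallyIntegrable.mem_or_eventually_eq_zero (hX : IsLocallyIntegrable X)
    (hC : IsCompact C) (h𝒥 : IsOpen 𝒥) (hCJ : 𝒥 ×ˢ C ⊆ flowDomain X) (hs : s ∈ 𝒥) (x : M) :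
    (-s, x) ∈ flowDomain X ∨ ∀ᶠ q : ℝ × M in 𝓝 (s, x), ∀ f : M → ℂ, tsupport f ⊆ C →
      pullbackFlow X (-q.1) f q.2 = 0 := by
  obtain ⟨J₀, hJ₀, hc⟩ := hX.exists_compact_nhds hC h𝒥 hCJ hs
  by_cases hx : (s, x) ∈ (fun p : ℝ × M => (p.1, maxFlow X p.1 p.2)) '' (J₀ ×ˢ C)
  · obtain ⟨⟨r, y⟩, ⟨-, hy⟩, hp⟩ := hx
    obtain ⟨rfl, rfl⟩ := Prod.mk.inj hp
    exact Or.inl (maxFlow_neg (hCJ ⟨hs, hy⟩)).1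
  · right
    filter_upwards [hc.isClosed.isOpen_compl.mem_nhds hx,
      continuous_fst.continuousAt.preimage_mem_nhds hJ₀] with q hq hqJ f hf
    by_contra hne
    obtain ⟨h1, h2, h3, h4⟩ := mem_of_pullbackFlow_ne_zero hne
    exact hq ⟨(q.1, maxFlow X (-q.1) q.2), ⟨hqJ, hf h2⟩, Prod.ext rfl h4⟩

theorem IsLocallyIntegrable.contMDiffAt_pullbackFlow (hX : IsLocallyIntegrable X)
    {f : M → ℂ} (hf : ContMDiff I 𝓘(ℝ, ℂ) ∞ f) {x : M} (h : (-s, x) ∈ flowDomain X) :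
    ContMDiffAt (𝓘(ℝ, ℝ).prod I) 𝓘(ℝ, ℂ) ∞ (fun p : ℝ × M => pullbackFlow X (-p.1) f p.2)
      (s, x) := by
  have hσ : ContMDiffAt (𝓘(ℝ, ℝ).prod I) (𝓘(ℝ, ℝ).prod I) ∞ (fun p : ℝ × M => (-p.1, p.2))
      (s, x) :=
    ((contDiff_neg (𝕜 := ℝ) (F := ℝ)).contMDiff.comp contMDiff_fst).contMDiffAt.prodMk
      contMDiffAt_snd
  have h1 : ContMDiffAt (𝓘(ℝ, ℝ).prod I) 𝓘(ℝ, ℂ) ∞ (fun p : ℝ × M => f (maxFlow X (-p.1) p.2))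
      (s, x) :=
    hf.contMDiffAt.comp (s, x) ((hX.smooth_maxFlow h).2.comp (s, x) (f := fun p : ℝ × M => (-p.1, p.2)) hσ)
  refine h1.congr_of_eventuallyEq ?_
  filter_upwards [hσ.continuousAt.preimage_mem_nhds (hX.isOpen_flowDomain.mem_nhds h)] with q hq
  exact if_pos hq

theorem IsLocallyIntegrable.contMDiffOn_pullbackFlow (hX : IsLocallyIntegrable X)
    (φ : smoothCc I M) (h𝒥 : IsOpen 𝒥) (hφ : 𝒥 ×ˢ tsupport (φ : M → ℂ) ⊆ flowDomain X) :
    ContMDiffOn (𝓘(ℝ, ℝ).prod I) 𝓘(ℝ, ℂ) ∞ (fun p : ℝ × M => pullbackFlow X (-p.1) φ p.2)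
      (𝒥 ×ˢ Set.univ) := by
  rintro ⟨s, x⟩ ⟨hs, -⟩
  refine ContMDiffAt.contMDiffWithinAt ?_
  rcases hX.mem_or_eventually_eq_zero φ.2.2 h𝒥 hφ hs x with h | h
  · exact hX.contMDiffAt_pullbackFlow φ.2.1 h
  · exact (contMDiffAt_const (c := (0 : ℂ))).congr_of_eventuallyEq
      (h.mono fun q hq => hq φ subset_rfl)

theorem IsLocallyIntegrable.exists_tsupport_pullbackFlow (hX : IsLocallyIntegrable X)
    (hC : IsCompact C) (h𝒥 : IsOpen 𝒥) (hCJ : 𝒥 ×ˢ C ⊆ flowDomain X) (hs : s ∈ 𝒥) :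
    ∃ D : Set M, IsCompact D ∧ ∀ᶠ r in 𝓝 s, ∀ f : M → ℂ, tsupport f ⊆ C →
      tsupport (pullbackFlow X (-r) f) ⊆ D := by
  obtain ⟨J₀, hJ₀, hc⟩ := hX.exists_compact_nhds hC h𝒥 hCJ hs
  refine ⟨_, hc.image continuous_snd, ?_⟩
  filter_upwards [hJ₀] with r hr f hf
  refine closure_minimal (fun x hx => ?_) (hc.image continuous_snd).isClosed
  obtain ⟨h1, h2, h3, h4⟩ := mem_of_pullbackFlow_ne_zero hx
  exact ⟨_, ⟨(r, maxFlow X (-r) x), ⟨hr, hf h2⟩, rfl⟩, h4⟩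

theorem IsLocallyIntegrable.pullbackFlow_mem (hX : IsLocallyIntegrable X)
    (φ : smoothCc I M) (h𝒥 : IsOpen 𝒥) (hφ : 𝒥 ×ˢ tsupport (φ : M → ℂ) ⊆ flowDomain X)
    (hs : s ∈ 𝒥) : pullbackFlow X (-s) φ ∈ smoothCc I M := by
  constructor
  · have h1 : ContMDiffOn I (𝓘(ℝ, ℝ).prod I) ∞ (fun x : M => (s, x)) Set.univ :=
      (contMDiff_const.prodMk contMDiff_id).contMDiffOn
    exact contMDiffOn_univ.1
      ((hX.contMDiffOn_pullbackFlow φ h𝒥 hφ).comp h1 fun x hx => ⟨hs, hx⟩)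
  · obtain ⟨D, hD, h⟩ := hX.exists_tsupport_pullbackFlow φ.2.2 h𝒥 hφ hs
    exact hD.of_isClosed_subset (isClosed_tsupport _) (h.self_of_nhds φ subset_rfl)

open Classical in
/-- The test function `φ ∘ Φ^X_{-s}`, or `0` if that is not a test function. -/
def transport (X : SmoothField I M) (φ : smoothCc I M) (s : ℝ) : smoothCc I M :=
  if h : pullbackFlow X (-s) φ ∈ smoothCc I M then ⟨_, h⟩ else 0

theorem IsLocallyIntegrable.coe_transport (hX : IsLocallyIntegrable X)
    (φ : smoothCc I M) (h𝒥 : IsOpen 𝒥) (hφ : 𝒥 ×ˢ tsupport (φ : M → ℂ) ⊆ flowDomain X)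
    (hs : s ∈ 𝒥) : (transport X φ s : M → ℂ) = pullbackFlow X (-s) φ := by
  rw [transport, dif_pos (hX.pullbackFlow_mem φ h𝒥 hφ hs)]

theorem IsLocallyIntegrable.transport_zero (hX : IsLocallyIntegrable X) (φ : smoothCc I M) :
    transport X φ 0 = φ := by
  have h : pullbackFlow X (-0) φ = (φ : M → ℂ) := by
    ext x
    rw [neg_zero, pullbackFlow, if_pos (hX.zero_mem x).1, (hX.zero_mem x).2]
  rw [transport, dif_pos (by rw [h]; exact φ.2)]
  exact Subtype.ext h

/-- `φ ∘ Φ^X_{-s}` depends smoothly on `s`, with derivative `-(ℒ_X φ) ∘ Φ^X_{-s}`. -/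
theorem IsLocallyIntegrable.smoothFamily_transport (hX : IsLocallyIntegrable X)
    (φ : smoothCc I M) (h𝒥 : IsOpen 𝒥) (hφ : 𝒥 ×ˢ tsupport (φ : M → ℂ) ⊆ flowDomain X) :
    SmoothFamily 𝒥 (transport X φ) (fun s => -transport X (lieDeriv X φ) s) where
  smooth := (hX.contMDiffOn_pullbackFlow φ h𝒥 hφ).congr fun p hp =>
    congrFun (hX.coe_transport φ h𝒥 hφ hp.1) p.2
  deriv s hs x := by
    have hL := hX.coe_transport (lieDeriv X φ) h𝒥 (prod_tsupport_lieDeriv_subset hφ) hs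
    have heq : (fun s => (transport X φ s : M → ℂ) x) =ᶠ[𝓝 s]
        fun s => pullbackFlow X (-s) φ x := by
      filter_upwards [h𝒥.mem_nhds hs] with r hr
      rw [hX.coe_transport φ h𝒥 hφ hr]
    refine HasDerivAt.congr_of_eventuallyEq ?_ heq
    change HasDerivAt _ (-(transport X (lieDeriv X φ) s : M → ℂ) x) s
    rw [hL]
    rcases hX.mem_or_eventually_eq_zero φ.2.2 h𝒥 hφ hs x with h | h
    · rw [pullbackFlow, if_pos h]
      have h1 : HasDerivAt (fun r => (φ : M → ℂ) (maxFlow X r x))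
          (derivAlong X φ (maxFlow X (-s) x)) (-s) :=
        hasDerivAt_comp_curve (φ.2.1.mdifferentiable (by simp) _) (hasMFDerivAt_maxFlow h)
      have h2 := HasDerivAt.scomp s h1 (hasDerivAt_neg s)
      rw [neg_one_smul] at h2
      refine h2.congr_of_eventuallyEq ?_
      have hc : Continuous fun r : ℝ => (-r, x) := by fun_prop
      filter_upwards [hc.continuousAt.preimage_mem_nhds (hX.isOpen_flowDomain.mem_nhds h)] with r hr
      exact if_pos hr
    · rw [h.self_of_nhds _ (tsupport_lieDeriv_subset X φ), neg_zero]
      refine (hasDerivAt_const s (0 : ℂ)).congr_of_eventuallyEq ?_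
      have hc : Continuous fun r : ℝ => (r, x) := by fun_prop
      filter_upwards [hc.continuousAt.eventually h] with r hr
      exact hr φ subset_rfl
  supp s hs := by
    obtain ⟨D, hD, h⟩ := hX.exists_tsupport_pullbackFlow φ.2.2 h𝒥 hφ hs
    refine ⟨D, hD, ?_⟩
    filter_upwards [h, h𝒥.mem_nhds hs] with r hr hr𝒥
    rw [hX.coe_transport φ h𝒥 hφ hr𝒥]
    exact hr φ subset_rfl

/-- `ℒ_X` commutes with the flow of `X`. -/
theorem IsLocallyIntegrable.lieDeriv_transport (hX : IsLocallyIntegrable X)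
    (φ : smoothCc I M) (h𝒥 : IsOpen 𝒥) (hφ : 𝒥 ×ˢ tsupport (φ : M → ℂ) ⊆ flowDomain X)
    (hs : s ∈ 𝒥) : lieDeriv X (transport X φ s) = transport X (lieDeriv X φ) s := by
  ext x
  rw [hX.coe_transport (lieDeriv X φ) h𝒥 (prod_tsupport_lieDeriv_subset hφ) hs]
  change derivAlong X (transport X φ s : M → ℂ) x = _
  have hsm : MDifferentiableAt I 𝓘(ℝ, ℂ) (transport X φ s : M → ℂ) x :=
    (transport X φ s).2.1.mdifferentiable (by simp) x
  rcases hX.mem_or_eventually_eq_zero φ.2.2 h𝒥 hφ hs x with h | h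
  · rw [pullbackFlow, if_pos h]
    obtain ⟨hx0, hx1⟩ := hX.zero_mem x
    have h1 : HasDerivAt (fun r => (transport X φ s : M → ℂ) (maxFlow X r x))
        (derivAlong X (transport X φ s : M → ℂ) (maxFlow X 0 x)) 0 :=
      hasDerivAt_comp_curve (by rw [hx1]; exact hsm) (hasMFDerivAt_maxFlow hx0)
    have h2 : HasDerivAt (fun r => (φ : M → ℂ) (maxFlow X r x))
        (derivAlong X φ (maxFlow X (-s) x)) (0 + -s) := by
      rw [zero_add]
      exact hasDerivAt_comp_curve (φ.2.1.mdifferentiable (by simp) _) (hasMFDerivAt_maxFlow h)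
    have h3 := h2.comp_add_const 0 (-s)
    rw [hx1] at h1
    refine h1.unique (h3.congr_of_eventuallyEq ?_)
    have e1 : ∀ᶠ r in 𝓝 (0 : ℝ), (r, x) ∈ flowDomain X :=
      (Continuous.prodMk_left x).continuousAt.preimage_mem_nhds
        (hX.isOpen_flowDomain.mem_nhds hx0)
    have e2 : ∀ᶠ r in 𝓝 (0 : ℝ), (-s, maxFlow X r x) ∈ flowDomain X := by
      have hc : ContinuousAt (fun r => (-s, maxFlow X r x)) 0 :=
        continuousAt_const.prodMk (hasMFDerivAt_maxFlow hx0).continuousAt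
      refine hc.preimage_mem_nhds (hX.isOpen_flowDomain.mem_nhds ?_)
      rwa [hx1]
    filter_upwards [e1, e2] with r hr hr'
    rw [hX.coe_transport φ h𝒥 hφ hs, pullbackFlow, if_pos hr', (maxFlow_add hr hr').2]
  · rw [h.self_of_nhds _ (tsupport_lieDeriv_subset X φ)]
    refine derivAlong_eq_zero X (notMem_tsupport_iff_eventuallyEq.2 ?_)
    have hc : Continuous fun y : M => (s, y) := by fun_prop
    rw [hX.coe_transport φ h𝒥 hφ hs]
    filter_upwards [hc.continuousAt.eventually h] with y hy
    exact hy φ subset_rfl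

end

/-- The set of times for which the flow is defined on a given compact set is open. -/
theorem IsLocallyIntegrable.isOpen_times (hX : IsLocallyIntegrable X) {C : Set M}
    (hC : IsCompact C) : IsOpen {s : ℝ | ∀ x ∈ C, (s, x) ∈ flowDomain X} := by
  rw [isOpen_iff_mem_nhds]
  intro s hs
  exact hC.eventually_forall_of_forall_eventually (x₀ := s)
    (P := fun (s : ℝ) (x : M) => (s, x) ∈ flowDomain X)
    fun x hx => hX.isOpen_flowDomain.mem_nhds (hs x hx)

end Transport

section LieOperator

variable {E : Type*} [NormedAddCommGroup E] [NormedSpace ℝ E]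
  {H : Type*} [TopologicalSpace H] {I : ModelWithCorners ℝ E H}
  {M : Type*} [TopologicalSpace M] [ChartedSpace H M] [IsManifold I ∞ M]
  (K : PosDefDistribution I M) {X : SmoothField I M}

theorem conjFun_lieDeriv (X : SmoothField I M) (φ : smoothCc I M) :
    conjFun (lieDeriv X φ) = lieDeriv X (conjFun φ) := by
  ext x
  have hφ : MDifferentiableAt I 𝓘(ℝ, ℂ) (φ : M → ℂ) x := φ.2.1.mdifferentiable (by simp) x
  let m : ℂ →L[ℝ] ℂ := Complex.conjCLE
  have h := ((m.hasMFDerivAt (x := (φ : M → ℂ) x)).comp x hφ.hasMFDerivAt).mfderiv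
  change _ = mfderiv I 𝓘(ℝ, ℂ) (m ∘ (φ : M → ℂ)) x (X x)
  rw [h]
  rfl

variable {K} in
theorem IsSymmetricField.inner_lieDeriv (hKX : IsSymmetricField K X) (φ ψ : smoothCc I M) :
    (inner ℂ (vec K (lieDeriv X ψ)) (vec K φ) : ℂ) = inner ℂ (vec K ψ) (vec K (lieDeriv X φ)) := by
  rw [inner_vec, inner_vec, conjFun_lieDeriv]
  exact (neg_inj.1 (hKX (conjFun φ) ψ)).symm

theorem mem_graph_lieOp_iff_inner {v w : HilbertSpace K} :
    (v, w) ∈ (lieOp K X).graph ↔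
      ∀ ψ, (inner ℂ (vec K ψ) w : ℂ) = -inner ℂ (vec K (lieDeriv X ψ)) v := by
  rw [mem_graph_lieOp, LinearMap.ext_iff]
  rfl

variable {K}

theorem IsSymmetricField.vec_mem_graph_lieOp (hKX : IsSymmetricField K X) (φ : smoothCc I M) :
    (vec K φ, -vec K (lieDeriv X φ)) ∈ (lieOp K X).graph := by
  rw [mem_graph_lieOp_iff_inner]
  intro ψ
  rw [inner_neg_right, hKX.inner_lieDeriv]

theorem IsSymmetricField.hilbertZero_le (hKX : IsSymmetricField K X) :
    HilbertZero K ≤ (lieOp K X).domain := by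
  rintro _ ⟨φ, rfl⟩
  exact LinearPMap.mem_domain_of_mem_graph (hKX.vec_mem_graph_lieOp φ)

variable (K X) in
/-- The restriction of `ℒ_X` to `ℋ_K^0`. -/
abbrev lieOpZero : HilbertSpace K →ₗ.[ℂ] HilbertSpace K :=
  (lieOp K X).domRestrict (HilbertZero K)

theorem IsSymmetricField.mem_graph_lieOpZero (hKX : IsSymmetricField K X)
    {p : HilbertSpace K × HilbertSpace K} :
    p ∈ (lieOpZero K X).graph ↔ ∃ φ, p = (vec K φ, -vec K (lieDeriv X φ)) := by
  have hle : (lieOpZero K X).graph ≤ (lieOp K X).graph :=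
    LinearPMap.le_graph_of_le LinearPMap.domRestrict_le
  constructor
  · obtain ⟨v, w⟩ := p
    intro hp
    obtain ⟨φ, rfl⟩ := (LinearPMap.mem_domain_of_mem_graph hp).1
    exact ⟨φ, Prod.ext rfl
      (LinearPMap.mem_graph_snd_inj _ (hle hp) (hKX.vec_mem_graph_lieOp φ) rfl)⟩
  · rintro ⟨φ, rfl⟩
    have hd : vec K φ ∈ (lieOpZero K X).domain := ⟨⟨φ, rfl⟩, hKX.hilbertZero_le ⟨φ, rfl⟩⟩
    have hg := (lieOpZero K X).mem_graph ⟨vec K φ, hd⟩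
    have := LinearPMap.mem_graph_snd_inj _ (hle hg) (hKX.vec_mem_graph_lieOp φ) rfl
    rwa [this] at hg

theorem IsSymmetricField.dense_domain_lieOpZero (hKX : IsSymmetricField K X) :
    Dense ((lieOpZero K X).domain : Set (HilbertSpace K)) := by
  refine (denseRange_vec K).mono ?_
  rintro _ ⟨φ, rfl⟩
  exact ⟨⟨φ, rfl⟩, hKX.hilbertZero_le ⟨φ, rfl⟩⟩

theorem IsSymmetricField.isSymmGraph (hKX : IsSymmetricField K X) :
    IsSymmGraph (lieOpZero K X).graph := by
  intro p hp q hq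
  obtain ⟨φ, rfl⟩ := hKX.mem_graph_lieOpZero.1 hp
  obtain ⟨ψ, rfl⟩ := hKX.mem_graph_lieOpZero.1 hq
  rw [inner_neg_left, inner_neg_right, hKX.inner_lieDeriv]

theorem IsSymmetricField.adjoint_lieOpZero (hKX : IsSymmetricField K X) :
    (lieOpZero K X).adjoint = lieOp K X := by
  refine LinearPMap.eq_of_eq_graph ?_
  rw [LinearPMap.adjoint_graph_eq_graph_adjoint hKX.dense_domain_lieOpZero]
  ext ⟨v, w⟩
  rw [Submodule.mem_adjoint_iff, mem_graph_lieOp_iff_inner]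
  constructor
  · intro h ψ
    have := h _ _ (hKX.mem_graph_lieOpZero.2 ⟨ψ, rfl⟩)
    rw [inner_neg_left, sub_eq_zero] at this
    exact this.symm
  · intro h a b hab
    obtain ⟨φ, hφ⟩ := hKX.mem_graph_lieOpZero.1 hab
    obtain ⟨rfl, rfl⟩ := Prod.mk.inj hφ
    rw [inner_neg_left, h φ, sub_self]

variable (X) in
/-- The times for which the flow of `X` is defined on the support of `φ`. -/
def flowTimes (φ : smoothCc I M) : Set ℝ :=
  {s : ℝ | ∀ x ∈ tsupport (φ : M → ℂ), (s, x) ∈ flowDomain X}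

theorem flowTimes_prod_subset (φ : smoothCc I M) :
    flowTimes X φ ×ˢ tsupport (φ : M → ℂ) ⊆ flowDomain X := fun p hp => hp.1 p.2 hp.2

section Transport

variable [I.Boundaryless] [T2Space M]

variable (K) in
theorem IsLocallyIntegrable.hasDerivAt_vec_transport (hX : IsLocallyIntegrable X)
    (φ : smoothCc I M) {𝒥 : Set ℝ} (h𝒥 : IsOpen 𝒥)
    (hφ : 𝒥 ×ˢ tsupport (φ : M → ℂ) ⊆ flowDomain X) {s : ℝ} (hs : s ∈ 𝒥) :
    HasDerivAt (fun s => vec K (transport X φ s)) (-vec K (lieDeriv X (transport X φ s))) s := by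
  have hφ1 := prod_tsupport_lieDeriv_subset hφ
  have hφ2 := prod_tsupport_lieDeriv_subset hφ1
  have h0 := hX.smoothFamily_transport φ h𝒥 hφ
  have h1 := (hX.smoothFamily_transport _ h𝒥 hφ1).neg
  have h2 := (hX.smoothFamily_transport _ h𝒥 hφ2).neg.neg
  have h := h0.hasDerivAt_vec K h𝒥 h1 hs (h2.eventually_norm_vec_le K h𝒥 hs)
  rwa [map_neg, ← hX.lieDeriv_transport φ h𝒥 hφ hs] at h

theorem lieDeriv_pow_transport (hX : IsLocallyIntegrable X)
    (φ : smoothCc I M) {𝒥 : Set ℝ} (h𝒥 : IsOpen 𝒥)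
    (hφ : 𝒥 ×ˢ tsupport (φ : M → ℂ) ⊆ flowDomain X) (n : ℕ) :
    𝒥 ×ˢ tsupport ((lieDeriv X ^ n) φ : M → ℂ) ⊆ flowDomain X ∧ ∀ s ∈ 𝒥,
      (lieDeriv X ^ n) (transport X φ s) = transport X ((lieDeriv X ^ n) φ) s := by
  induction n with
  | zero => exact ⟨hφ, fun s _ => rfl⟩
  | succ n ih =>
    rw [pow_succ']
    refine ⟨prod_tsupport_lieDeriv_subset ih.1, fun s hs => ?_⟩
    rw [Module.End.mul_apply, Module.End.mul_apply, ih.2 s hs, hX.lieDeriv_transport _ h𝒥 ih.1 hs]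

theorem IsLocallyIntegrable.isOpen_flowTimes (hX : IsLocallyIntegrable X) (φ : smoothCc I M) :
    IsOpen (flowTimes X φ) :=
  hX.isOpen_times φ.2.2

theorem IsLocallyIntegrable.exists_norm_vec_le (hX : IsLocallyIntegrable X)
    (hKX : IsSymmetricField K X) (φ : smoothCc I M) :
    ∃ C ρ : ℝ, 0 < ρ ∧ ∀ n : ℕ,
      ‖(-1 : ℂ) ^ n • vec K ((lieDeriv X ^ n) φ)‖ ≤ C * ρ ^ n * n.factorial := by
  have h𝒥 := hX.isOpen_flowTimes φ
  have hφ := flowTimes_prod_subset (X := X) φ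
  have h0 : (0 : ℝ) ∈ flowTimes X φ := fun x _ => (hX.zero_mem x).1
  obtain ⟨δ, hδ, hδ𝒥⟩ := Metric.isOpen_iff.1 h𝒥 0 h0
  rw [Real.ball_eq_Ioo, zero_sub, zero_add] at hδ𝒥
  have h := exists_norm_le_factorial hδ
    (fun n t => (-1 : ℂ) ^ n • vec K ((lieDeriv X ^ n) (transport X φ t))) ?_ ?_
  · simpa only [hX.transport_zero] using h
  · intro n t ht
    obtain ⟨hn, hn'⟩ := lieDeriv_pow_transport hX φ h𝒥 hφ n
    have h1 := (hX.hasDerivAt_vec_transport K _ h𝒥 hn (hδ𝒥 ht)).const_smul ((-1 : ℂ) ^ n)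
    rw [← hn' t (hδ𝒥 ht)] at h1
    refine (h1.congr_deriv ?_).congr_of_eventuallyEq ?_
    · rw [pow_succ, pow_succ', mul_smul, neg_one_smul]
      rfl
    · filter_upwards [h𝒥.mem_nhds (hδ𝒥 ht)] with s hs
      simp only [hn' s hs, Pi.smul_apply]
  · intro j k t
    simp only [inner_smul_left, inner_smul_right, pow_succ' (lieDeriv X), Module.End.mul_apply,
      hKX.inner_lieDeriv, pow_succ (-1 : ℂ), map_mul, map_neg, map_one]
    ring

theorem IsLocallyIntegrable.noDeficiency (hX : IsLocallyIntegrable X)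
    (hKX : IsSymmetricField K X) : NoDeficiency (lieOpZero K X).graph := by
  intro c hc w hw
  refine (denseRange_vec K).eq_zero_of_inner_left ℂ fun φ => ?_
  obtain ⟨C, ρ, hρ, hu⟩ := hX.exists_norm_vec_le hKX φ
  have h := inner_eq_zero_of_analytic
    (u := fun n : ℕ => (-1 : ℂ) ^ n • vec K ((lieDeriv X ^ n) φ))
    (a := fun n : ℕ => (inner ℂ (vec K φ) ((-1 : ℂ) ^ n • vec K ((lieDeriv X ^ n) φ)) : ℂ))
    ?_ hρ hu (w := w) hc ?_
  · simpa using h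
  · intro j
    induction j with
    | zero => intro k; simp [inner_smul_right]
    | succ j ih =>
      intro k
      rw [show j + 1 + k = j + (k + 1) by omega, ← ih]
      simp only [inner_smul_left, inner_smul_right, pow_succ' (lieDeriv X), Module.End.mul_apply,
        hKX.inner_lieDeriv, pow_succ (-1 : ℂ), map_mul, map_neg, map_one]
      ring
  · intro n
    have := hw _ (hKX.mem_graph_lieOpZero.2 ⟨(lieDeriv X ^ n) φ, rfl⟩)
    simp only [inner_neg_right] at this
    simp only [inner_smul_right, pow_succ' (lieDeriv X), Module.End.mul_apply, pow_succ (-1 : ℂ)]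
    linear_combination (-1 : ℂ) ^ n * this

theorem IsLocallyIntegrable.isEssentiallySelfAdjoint (hX : IsLocallyIntegrable X)
    (hKX : IsSymmetricField K X) :
    IsEssentiallySelfAdjoint (lieOpZero K X) ∧ (lieOpZero K X).closure = lieOp K X := by
  have h := closure_eq_adjoint hKX.dense_domain_lieOpZero hKX.isSymmGraph (hX.noDeficiency hKX)
  rwa [hKX.adjoint_lieOpZero] at h

theorem IsLocallyIntegrable.expApply (hX : IsLocallyIntegrable X) (hKX : IsSymmetricField K X)
    (φ : smoothCc I M) {a b t : ℝ} (h0 : 0 ∈ Set.Ioo a b) (ht : t ∈ Set.Ioo a b)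
    (hab : Set.Ioo a b ⊆ flowTimes X φ) :
    ExpApply (lieOp K X) t (vec K φ) (vec K (transport X φ t)) := by
  obtain ⟨⟨-, hcl, -⟩, hc⟩ := hX.isEssentiallySelfAdjoint hKX
  have hgraph : (lieOpZero K X).graph.topologicalClosure = (lieOp K X).graph := by
    rw [← hc]
    exact hcl.graph_closure_eq_closure_graph
  have hsymm : IsSymmGraph (lieOp K X).graph := hgraph ▸ hKX.isSymmGraph.topologicalClosure
  have hd : NoDeficiency (lieOp K X).graph :=
    hgraph ▸ (hX.noDeficiency hKX).mono (Submodule.le_topologicalClosure _)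
  have hclosed : IsClosed ((lieOp K X).graph : Set (HilbertSpace K × HilbertSpace K)) :=
    hgraph ▸ Submodule.isClosed_topologicalClosure _
  obtain ⟨B, hB⟩ := hsymm.exists_borelCalculus hd hclosed
    fun y hy => LinearPMap.graph_fst_eq_zero_snd _ hy rfl
  refine ⟨B.spectralMeasure, fun x y => (hB x y).symm, ?_⟩
  have h𝒥 := hX.isOpen_flowTimes φ
  have hφ := flowTimes_prod_subset (X := X) φ
  have h := B.hasIntegral_exp (v := fun s => vec K (transport X φ s))
    (v' := fun s => -vec K (lieDeriv X (transport X φ s))) h0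
    (fun s hs => hX.hasDerivAt_vec_transport K φ h𝒥 hφ (hab hs))
    (fun s _ => (hB _ _).2 (hKX.vec_mem_graph_lieOp _)) ht
  simpa only [hX.transport_zero] using h

end Transport

theorem exists_Ioo_subset {𝒥 : Set ℝ} (h𝒥 : IsOpen 𝒥) {ε : ℝ} (hε : 0 ≤ ε)
    (h : Set.Icc 0 ε ⊆ 𝒥) :
    ∃ a b, Set.Icc 0 ε ⊆ Set.Ioo a b ∧ Set.Ioo a b ⊆ 𝒥 := by
  obtain ⟨δ, hδ, h1⟩ := (isCompact_Icc (a := (0 : ℝ)) (b := ε)).exists_thickening_subset_open h𝒥 h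
  refine ⟨0 - δ, ε + δ, fun s hs => ⟨by linarith [hs.1], by linarith [hs.2]⟩, fun s hs => h1 ?_⟩
  rw [Metric.mem_thickening_iff]
  refine ⟨max 0 (min s ε), ⟨le_max_left _ _, max_le hε (min_le_right _ _)⟩, ?_⟩
  rw [Real.dist_eq, abs_lt]
  rcases le_total s ε with h2 | h2 <;> rcases le_total 0 s with h3 | h3 <;>
    simp only [min_eq_left, min_eq_right, max_eq_left, max_eq_right, h2, h3, hε] <;>
    constructor <;> linarith [hs.1, hs.2]

end LieOperator

end FrohlichDist


end

theorem theoremT {E : Type*} [NormedAddCommGroup E] [NormedSpace ℝ E] [FiniteDimensional ℝ E]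
    {H : Type*} [TopologicalSpace H] {I : ModelWithCorners ℝ E H} [I.Boundaryless]
    {M : Type*} [TopologicalSpace M] [ChartedSpace H M] [IsManifold I ∞ M] [T2Space M]
    (K : FrohlichDist.PosDefDistribution I M) (X : FrohlichDist.SmoothField I M)
    (hX : FrohlichDist.IsLocallyIntegrable X) (hKX : FrohlichDist.IsSymmetricField K X) :
    FrohlichDist.HilbertZero K ≤ (FrohlichDist.lieOp K X).domain ∧
    FrohlichDist.IsEssentiallySelfAdjoint
      ((FrohlichDist.lieOp K X).domRestrict (FrohlichDist.HilbertZero K)) ∧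
    ((FrohlichDist.lieOp K X).domRestrict (FrohlichDist.HilbertZero K)).closure =
      FrohlichDist.lieOp K X ∧
    ∀ (φ : FrohlichDist.smoothCc I M) (ε : ℝ), 0 ≤ ε →
      (∀ s ∈ Set.Icc 0 ε, ∀ x ∈ tsupport (φ : M → ℂ), (s, x) ∈ FrohlichDist.flowDomain X) →
      ∀ t ∈ Set.Icc 0 ε, ∃ ψ : FrohlichDist.smoothCc I M,
        (ψ : M → ℂ) = FrohlichDist.pullbackFlow X (-t) φ ∧
        FrohlichDist.ExpApply
          ((FrohlichDist.lieOp K X).domRestrict (FrohlichDist.HilbertZero K)).closure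
          t (FrohlichDist.vec K φ) (FrohlichDist.vec K ψ) := by
  obtain ⟨hess, hcl⟩ := hX.isEssentiallySelfAdjoint hKX
  refine ⟨hKX.hilbertZero_le, hess, hcl, fun φ ε hε hφ t ht => ?_⟩
  obtain ⟨a, b, h1, h2⟩ := FrohlichDist.exists_Ioo_subset (hX.isOpen_flowTimes φ) hε hφ
  refine ⟨FrohlichDist.transport X φ t, hX.coe_transport φ (hX.isOpen_flowTimes φ)
    (FrohlichDist.flowTimes_prod_subset φ) (hφ t ht), ?_⟩
  have h := hX.expApply hKX φ (h1 ⟨le_rfl, hε⟩) (h1 ht) h2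
  rwa [← hcl] at h
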